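/- The game 2048 is played on a $b\times b$ board whose cells are empty or hold a tile, with a value that is a power of two ($2,4,8,\dots$). A move in one of the directions up, down, left, right slides every tile as far as possible towards that wall; in each line, adjacent tiles of equal value $K$ (ignoring gaps) merge into one tile of value $2K$, two by two starting at the wall, and a tile made in a move does not merge again in that move. A move that changes nothing is invalid. In the only-2 version, after every valid move a new tile of value $2$ appears in an empty cell of the board that is determined as follows. (a) If the input consists only of $b$ and the list $L$ of the tiles on the initial board, the new tile always appears in the first empty cell in lexicographic order (leftmost, then topmost). (b) If the input moreover contains a finite list $S$ of cells, the $i$-th new tile appears in the first empty cell, in cyclic lexicographic order, starting from the $i$-th cell of $S$, and in the first empty cell of the board when $S$ has fewer than $i$ entries. (An empty list $S$ gives version (a).) Numbers in the input are written in binary; in particular $b$ takes about $\log b$ symbols. **Lemma.** Let $T=2^c$ with a constant integer $c\ge 1$. The problem to decide, given $b$ and $L$ as in (a), or given $b$, $L$ and $S$ as in (b), whether some finite (possibly empty) sequence of valid moves from the initial configuration leads to a configuration with a tile of value $T$, is in $\mathsf{NP}$. That is, the set of the words that encode a valid input with answer yes has a polynomial-time Turing machine verifier with certificates of polynomial length.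 Moreover, any sequence of valid moves from an initial configuration during which no tile of value $T$ is ever present on the board (initial configuration and new tiles included) has at most $T b^2/4$ moves. -/

import Mathlib

open Computability

namespace Make2048

/-! ### The class NP -/

/-- A language over a finite alphabet is in NP if it has a polynomial-time verifier with
certificates of polynomial length. The verifier is a Mathlib Turing machine; it reads the instance
word followed by the certificate, written in disjoint alphabets. -/
def InNP {Γ : Type} [Fintype Γ] (A : Language Γ) : Prop :=
  ∃ (p : Polynomial ℕ) (V : List Γ × List Bool → Bool),
    Nonempty (Turing.TM2ComputableInPolyTime
      (encodingProd (encodingList Γ) (encodingList Bool)).encode encodeBool V) ∧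
    ∀ x : List Γ, x ∈ A ↔ ∃ w : List Bool, w.length ≤ p.eval x.length ∧ V (x, w) = true

/-! ### The game -/

/-- A configuration on a `b × b` board. The cell `B x y` is in column `x` (from the left) and in
row `y` (from the top); it is empty (`none`) or holds a tile of a given value. -/
abbrev Board (b : ℕ) : Type := Fin b → Fin b → Option ℕ

inductive Dir
  | up
  | down
  | left
  | right

/-- The tiles of a line are listed from the wall outwards. Equal neighbours merge two by two,
starting at the wall; a tile made by a merge does not merge again in the same move. -/
def mergeTiles : List ℕ → List ℕ
  | [] => []
  | [a] => [a]
  | a :: a' :: l => if a = a' then (a + a') :: mergeTiles l else a :: mergeTiles (a' :: l)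

/-- A move on one line of cells, with index `0` next to the wall the tiles move to. -/
def slideLine {b : ℕ} (f : Fin b → Option ℕ) : Fin b → Option ℕ :=
  fun i => (mergeTiles (List.ofFn f).reduceOption)[(i : ℕ)]?

/-- The effect of a move on the whole board, before the new tile appears. -/
def slide {b : ℕ} (B : Board b) : Dir → Board b
  | .up => fun x y => slideLine (fun i => B x i) y
  | .down => fun x y => slideLine (fun i => B x i.rev) y.rev
  | .left => fun x y => slideLine (fun i => B i y) x
  | .right => fun x y => slideLine (fun i => B i.rev y) x.rev

/-- `(x, y)` is the first empty cell from the cell `a` on, in the (cyclic) lexicographic order of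
the cells: leftmost first, then topmost, and after the last cell of the board the order starts
again at `(0, 0)`. For `a = (0, 0)` this is the lexicographically first empty cell. -/
def IsFirstEmptyFrom {b : ℕ} (B : Board b) (a : ℕ × ℕ) (x y : Fin b) : Prop :=
  B x y = none ∧ ∀ x' y' : Fin b, B x' y' = none →
    (toLex a ≤ toLex ((x : ℕ), (y : ℕ)) ∧ toLex ((x' : ℕ), (y' : ℕ)) < toLex a) ∨
    ((toLex a ≤ toLex ((x : ℕ), (y : ℕ)) ↔ toLex a ≤ toLex ((x' : ℕ), (y' : ℕ))) ∧
      toLex ((x : ℕ), (y : ℕ)) ≤ toLex ((x' : ℕ), (y' : ℕ)))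

/-- A configuration, and the location information for the new tiles still to come. -/
structure Position (b : ℕ) where
  board : Board b
  locations : List (ℕ × ℕ)

/-- One turn: a valid move (one that changes the board), after which a new tile of value 2 appears
in the first empty cell from the next prescribed location on, or in the lexicographically first
empty cell when no location is prescribed (any more). -/
def Turn {b : ℕ} (P Q : Position b) : Prop :=
  ∃ d : Dir, slide P.board d ≠ P.board ∧
    ∃ x y : Fin b, IsFirstEmptyFrom (slide P.board d) (P.locations.headD (0, 0)) x y ∧
      Q.board = (fun i j => if i = x ∧ j = y then some 2 else slide P.board d i j) ∧
      Q.locations = P.locations.tail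

def HasTile {b : ℕ} (T : ℕ) (B : Board b) : Prop := ∃ x y : Fin b, B x y = some T

/-- Some sequence of turns leads from `P` to a configuration with a tile of value `T`. -/
def CanMake {b : ℕ} (T : ℕ) (P : Position b) : Prop :=
  ∃ Q : Position b, Relation.ReflTransGen Turn P Q ∧ HasTile T Q.board

/-! ### Instances -/

/-- A tile on the initial board, with its column, its row and its value. -/
structure Tile where
  col : ℕ
  row : ℕ
  value : ℕ

/-- The tiles lie in distinct cells of the `b × b` board, and their values are among
2, 4, 8, and so on. -/
def ValidTiles (b : ℕ) (L : List Tile) : Prop :=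
  (∀ t ∈ L, t.col < b ∧ t.row < b ∧ ∃ k : ℕ, 1 ≤ k ∧ t.value = 2 ^ k) ∧
    (L.map fun t => (t.col, t.row)).Nodup

/-- The locations are cells of the `b × b` board. -/
def ValidLocations (b : ℕ) (S : List (ℕ × ℕ)) : Prop :=
  ∀ a ∈ S, a.1 < b ∧ a.2 < b

/-- The configuration with the tiles of the list `L`. -/
def boardOf (b : ℕ) (L : List Tile) : Board b :=
  fun x y => (L.find? fun t => t.col == (x : ℕ) && t.row == (y : ℕ)).map Tile.value

/-- A natural number in binary. -/
def encodeNumber (n : ℕ) : List Γ' := (encodeNat n).map Γ'.bit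

def encodeTile (t : Tile) : List Γ' :=
  [Γ'.bra] ++ encodeNumber t.col ++ [Γ'.comma] ++ encodeNumber t.row ++ [Γ'.comma] ++
    encodeNumber t.value ++ [Γ'.ket]

def encodeLocation (a : ℕ × ℕ) : List Γ' :=
  [Γ'.bra] ++ encodeNumber a.1 ++ [Γ'.comma] ++ encodeNumber a.2 ++ [Γ'.ket]

/-- The board side in binary, followed by the list of the tiles. -/
def encodeInput (b : ℕ) (L : List Tile) : List Γ' :=
  encodeNumber b ++ L.flatMap encodeTile

/-- The only-2 problem for the target value `T` with input just the board side and the list of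
tiles, so that every new tile appears in the lexicographically first empty cell. -/
def MakeOnlyTwo (T : ℕ) : Language Γ' :=
  {u | ∃ (b : ℕ) (L : List Tile), ValidTiles b L ∧ u = encodeInput b L ∧
    CanMake T (⟨boardOf b L, []⟩ : Position b)}

/-- The only-2 problem for the target value `T` in which the input also prescribes a finite list
of locations for the new tiles. -/
def MakeOnlyTwoLocated (T : ℕ) : Language Γ' :=
  {u | ∃ (b : ℕ) (L : List Tile) (S : List (ℕ × ℕ)), ValidTiles b L ∧ ValidLocations b S ∧
    u = encodeInput b L ++ S.flatMap encodeLocation ∧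
    CanMake T (⟨boardOf b L, S⟩ : Position b)}

end Make2048

namespace Make2048

section

/-! ### Structured stack programs -/

/-! The bound on the number of moves comes from a potential: the sum of all tiles smaller than `T`.
A merge preserves it unless it makes a tile `T` out of two tiles `T/2`; larger tiles contribute
nothing before or after. As long as `T` is absent, every turn therefore raises the potential by
exactly 2, the value of the new tile, while a cell contributes at most `T/2`. Hence `2k ≤ b² T/2`.
This is `moves_bound`, resting on `turn_total` and `two_mul_total_le`.

Membership in NP does not follow at once: `b` is written in binary, so a play of about `T b²` moves
may be exponentially long. But on a board whose side exceeds the number of tiles plus the number of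
prescribed locations by at least `2c + 2`, a single tile suffices for the answer yes
(`canMake_of_large`). Arbitrary valid moves use up the prescribed locations, a move to the left
brings a tile into the first column if there is none, and from then on all moves go to the right.
Each of them empties the corner `(0, 0)`; the new 2 appears there and makes the next move valid.
Apart from a remnant of older tiles that never gets longer, the top row is a binary counter with
digits 0, 1, 2, the numbers of copies of each power: merges are carries, and the new 2 is the
increment (`Descending.mergeTiles_append`). Without a carry into `T` the row stays short and the
play goes on for ever, against `moves_bound`. On an empty board no move is valid, so the answer is
no.

On the remaining boards `b` is at most linear in the length of the input. A play cut at the first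
appearance of `T` then has polynomially many moves, and these are the certificate
(`canMake_iff_simulate`).

For the machine, `Prog` is a structured language compiled to stack machines, with binary trees as
data. `PolyTime` is closed under composition, case distinction and size-bounded iteration, so the
verifier can be written as a functional program whose running time is mostly established by
`fun_prop`; `computable_of_polyTime` returns to Turing machines. Numbers are unary trees and boards
hold exponents; the binary numbers of the input stay lists of digits or are cut off at a polynomial
threshold (`clamp`). -/

/-- Structured programs over a family of stacks. `branch` and `loop` pop a symbol and continue
according to it; `loop` stops as soon as its stack is empty. -/
inductive Prog {K : Type} (Γ : K → Type) : Type
  | skip : Prog Γ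
  | push (k : K) (a : Γ k) : Prog Γ
  | seq (p q : Prog Γ) : Prog Γ
  | branch (k : K) (f : Option (Γ k) → Prog Γ) : Prog Γ
  | loop (k : K) (f : Γ k → Prog Γ) : Prog Γ

namespace Prog

variable {K : Type} {Γ : K → Type}

/-- The labels of the machine that executes a program. -/
def Label : Prog Γ → Type
  | skip => Unit
  | push _ _ => Unit
  | seq p q => p.Label ⊕ q.Label
  | branch _ f => Option (Σ o, (f o).Label)
  | loop _ f => Option (Σ a, (f a).Label)

@[reducible]
noncomputable def labelFintype [∀ k, Fintype (Γ k)] : (p : Prog Γ) → Fintype p.Label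
  | skip => inferInstanceAs (Fintype Unit)
  | push _ _ => inferInstanceAs (Fintype Unit)
  | seq p q =>
    letI := labelFintype p
    letI := labelFintype q
    inferInstanceAs (Fintype (p.Label ⊕ q.Label))
  | branch _ f =>
    letI := fun o => labelFintype (f o)
    inferInstanceAs (Fintype (Option (Σ o, (f o).Label)))
  | loop _ f =>
    letI := fun o => labelFintype (f o)
    inferInstanceAs (Fintype (Option (Σ o, (f o).Label)))

def entry : (p : Prog Γ) → p.Label
  | skip => ()
  | push _ _ => ()
  | seq p _ => Sum.inl p.entry
  | branch _ _ => none
  | loop _ _ => none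

variable [DecidableEq K] {Λ : Type}

open Turing.TM2 in
/-- The code of a program inside a machine: `ι` embeds its labels, and `e` is the exit label. -/
def code : (p : Prog Γ) → (p.Label → Λ) → Λ → p.Label → Stmt Γ Λ (∀ k, Option (Γ k))
  | skip, _, e, _ => .goto fun _ => e
  | push k a, _, e, _ => .push k (fun _ => a) (.goto fun _ => e)
  | seq p q, ι, _, .inl l => code p (fun l => ι (.inl l)) (ι (.inr q.entry)) l
  | seq _ q, ι, e, .inr l => code q (fun l => ι (.inr l)) e l
  | branch k f, ι, _, none => .pop k (fun v o => Function.update v k o)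
      (.goto fun v => ι (some ⟨v k, (f (v k)).entry⟩))
  | branch _ f, ι, e, some ⟨o, l⟩ => code (f o) (fun l => ι (some ⟨o, l⟩)) e l
  | loop k f, ι, e, none => .pop k (fun v o => Function.update v k o)
      (.goto fun v => (v k).elim e fun a => ι (some ⟨a, (f a).entry⟩))
  | loop _ f, ι, _, some ⟨a, l⟩ => code (f a) (fun l => ι (some ⟨a, l⟩)) (ι none) l

theorem code_branch_entry (k : K) (f : Option (Γ k) → Prog Γ) (ι : (branch k f).Label → Λ)
    (e : Λ) : (branch k f).code ι e (branch k f).entry =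
      .pop k (fun v o => Function.update v k o)
        (.goto fun v => ι (some ⟨v k, (f (v k)).entry⟩)) := rfl

theorem code_loop_entry (k : K) (f : Γ k → Prog Γ) (ι : (loop k f).Label → Λ)
    (e : Λ) : (loop k f).code ι e (loop k f).entry =
      .pop k (fun v o => Function.update v k o)
        (.goto fun v => (v k).elim e fun a => ι (some ⟨a, (f a).entry⟩)) := rfl

/-- `Run p S S' t`: the program `p` leads from the stacks `S` to the stacks `S'` in time `t`. -/
inductive Run : Prog Γ → (∀ k, List (Γ k)) → (∀ k, List (Γ k)) → ℕ → Prop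
  | skip (S) : Run skip S S 1
  | push (k a S) : Run (push k a) S (Function.update S k (a :: S k)) 1
  | seq {p q S S' S'' t t'} : Run p S S' t → Run q S' S'' t' → Run (seq p q) S S'' (t + t')
  | branch {k f S S' t} : Run (f (S k).head?) (Function.update S k (S k).tail) S' t →
      Run (branch k f) S S' (1 + t)
  | loop_nil {k f S} : S k = [] → Run (loop k f) S S 1
  | loop_cons {k f S S' S'' t t' a l} : S k = a :: l → Run (f a) (Function.update S k l) S' t →
      Run (loop k f) S' S'' t' → Run (loop k f) S S'' (1 + t + t')

theorem iterate_one_some {σ : Type} (f : σ → Option σ) (c : σ) :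
    (flip bind f)^[1] (some c) = f c := by
  simp [flip]

/-- Induction on the run. Machine, embedding `ι` and exit `e` are universally quantified because a
subprogram sits in the same machine under a composed embedding and exits to the label of what
follows it. The variables `v` are arbitrary, since a jump only reads the symbol that was just
popped. -/
theorem Run.steps {p : Prog Γ} {S S' : ∀ k, List (Γ k)} {t : ℕ} (h : Run p S S' t) :
    ∀ (M : Λ → Turing.TM2.Stmt Γ Λ (∀ k, Option (Γ k))) (ι : p.Label → Λ) (e : Λ),
      (∀ l, M (ι l) = p.code ι e l) → ∀ v, ∃ v',
        (flip bind (Turing.TM2.step M))^[t] (some ⟨some (ι p.entry), v, S⟩) =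
          some ⟨some e, v', S'⟩ := by
  induction h with
  | skip S =>
    intro M ι e hM v
    refine ⟨v, ?_⟩
    rw [iterate_one_some, Turing.TM2.step, hM]
    rfl
  | push k a S =>
    intro M ι e hM v
    refine ⟨v, ?_⟩
    rw [iterate_one_some, Turing.TM2.step, hM]
    rfl
  | @seq p q S S' S'' t t' _ _ ih₁ ih₂ =>
    intro M ι e hM v
    obtain ⟨v', h'⟩ := ih₁ M (fun l => ι (.inl l)) (ι (.inr q.entry)) (fun l => hM (.inl l)) v
    obtain ⟨v'', h''⟩ := ih₂ M (fun l => ι (.inr l)) e (fun l => hM (.inr l)) v'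
    refine ⟨v'', ?_⟩
    rw [add_comm, Function.iterate_add_apply]
    exact (congrArg _ h').trans h''
  | @branch k f S S' t _ ih =>
    intro M ι e hM v
    obtain ⟨v', h'⟩ := ih M (fun l => ι (some ⟨_, l⟩)) e (fun l => hM (some ⟨_, l⟩))
      (Function.update v k (S k).head?)
    refine ⟨v', ?_⟩
    rw [add_comm, Function.iterate_add_apply, ← h']
    congr 1
    rw [iterate_one_some]
    simp only [Turing.TM2.step, hM, code_branch_entry, Turing.TM2.stepAux]
    rw [Function.update_self]
  | @loop_nil k f S hS =>
    intro M ι e hM v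
    refine ⟨Function.update v k none, ?_⟩
    rw [iterate_one_some]
    simp only [Turing.TM2.step, hM, code_loop_entry, Turing.TM2.stepAux, Function.update_self, hS,
      List.head?_nil, Option.elim, List.tail_nil]
    rw [← hS, Function.update_eq_self]
  | @loop_cons k f S S' S'' t t' a l hS _ _ ih₁ ih₂ =>
    intro M ι e hM v
    obtain ⟨v', h'⟩ := ih₁ M (fun l => ι (some ⟨a, l⟩)) (ι none) (fun l => hM (some ⟨a, l⟩))
      (Function.update v k (some a))
    obtain ⟨v'', h''⟩ := ih₂ M ι e hM v'
    refine ⟨v'', ?_⟩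
    rw [show 1 + t + t' = t' + (t + 1) by omega, Function.iterate_add_apply,
      Function.iterate_add_apply _ t 1, ← h'']
    congr 1
    refine Eq.trans ?_ h'
    congr 1
    rw [iterate_one_some]
    simp only [Turing.TM2.step, hM, code_loop_entry, Turing.TM2.stepAux, Function.update_self, hS,
      List.head?_cons, Option.elim, List.tail_cons]

/-- The machine that executes a program. -/
noncomputable def machine [Fintype K] [∀ k, Fintype (Γ k)] (p : Prog Γ) (k₀ k₁ : K) :
    Turing.FinTM2 :=
  letI := p.labelFintype
  { K := K
    k₀ := k₀
    k₁ := k₁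
    Γ := Γ
    Λ := Option p.Label
    main := some p.entry
    σ := ∀ k, Option (Γ k)
    initialState := fun _ => none
    -- A halting configuration must have the initial variables, so the exit label resets them. This
    -- last step is the `+ 1` in `machine_outputs`.
    m := fun l => l.elim (.load (fun _ _ => none) .halt) (p.code some none) }

theorem machine_outputs [Fintype K] [∀ k, Fintype (Γ k)] (p : Prog Γ) (k₀ k₁ : K)
    {s : List (Γ k₀)} {s' : List (Γ k₁)} {t m : ℕ}
    (h : Run p (Function.update (fun _ => []) k₀ s) (Function.update (fun _ => []) k₁ s') t)
    (hm : t + 1 ≤ m) :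
    Nonempty (Turing.TM2OutputsInTime (p.machine k₀ k₁) s (some s') m) := by
  obtain ⟨v, hv⟩ := h.steps (p.machine k₀ k₁).m some none (fun l => rfl) fun _ => none
  refine ⟨⟨⟨t + 1, ?_⟩, hm⟩⟩
  rw [add_comm, Function.iterate_add_apply]
  refine (congrArg _ (Eq.trans ?_ hv)).trans ?_
  · congr 2
    simp only [Turing.initList, machine]
    congr 1
    funext k
    by_cases hk : k = k₀
    · subst hk; simp; rfl
    · simp [hk]
  · refine (iterate_one_some _ _).trans ?_
    simp only [Turing.FinTM2.step, Turing.TM2.step, machine, Option.elim, Turing.TM2.stepAux, Turing.haltList,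
      Option.map]
    congr 2
    funext k
    by_cases hk : k = k₁
    · subst hk; simp; rfl
    · simp [hk]

end Prog

end

section

/-! ### Programs on a stack of binary trees -/

/-- Binary trees, the data of the functional programs below. -/
inductive Tree
  | nil
  | cons (a b : Tree)

namespace Tree

/-- Preorder traversal, a prefix code: trees can be concatenated on a stack without separators, and
the top symbol tells whether the top tree is `nil`. -/
def code : Tree → List Bool
  | nil => [false]
  | cons a b => true :: (code a ++ code b)

def size : Tree → ℕ
  | nil => 1
  | cons a b => size a + size b + 1

@[simp] theorem length_code (x : Tree) : x.code.length = x.size := by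
  induction x with
  | nil => rfl
  | cons a b iha ihb => simp [code, size, iha, ihb]

theorem size_pos (x : Tree) : 1 ≤ x.size := by
  cases x <;> simp [size]

theorem code_append_inj : ∀ {x y : Tree} {l m : List Bool},
    x.code ++ l = y.code ++ m → x = y ∧ l = m
  | nil, nil, l, m, h => by simpa [code] using h
  | nil, cons _ _, l, m, h => by simp [code] at h
  | cons _ _, nil, l, m, h => by simp [code] at h
  | cons a b, cons a' b', l, m, h => by
    simp only [code, List.cons_append, List.append_assoc, List.cons.injEq, true_and] at h
    obtain ⟨h₁, h₂⟩ := code_append_inj h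
    obtain ⟨h₃, h₄⟩ := code_append_inj h₂
    exact ⟨by rw [h₁, h₃], h₄⟩

theorem code_injective : Function.Injective code := fun x y h =>
  (code_append_inj (l := []) (m := []) (by simpa using h)).1

end Tree

/-- The working stacks: the data, two auxiliary stacks, and a counter. -/
inductive Work
  | main
  | left
  | right
  | count
  deriving DecidableEq

instance : Fintype Work := ⟨{.main, .left, .right, .count}, by rintro (_ | _ | _ | _) <;> simp⟩

/-- The alphabets of the stacks: `none` is the input stack. -/
@[reducible] def Sym (A : Type) : Option Work → Type
  | none => A
  | some _ => Bool

instance {A : Type} [Fintype A] : ∀ k, Fintype (Sym A k)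
  | none => inferInstanceAs (Fintype A)
  | some _ => inferInstanceAs (Fintype Bool)

variable {A : Type}

/-- The stacks with the given contents. -/
def tapes (i : List A) (m l r c : List Bool) : ∀ k, List (Sym A k)
  | none => i
  | some .main => m
  | some .left => l
  | some .right => r
  | some .count => c

section tapes
variable (i : List A) (m l r c x : List Bool) (y : List A)

@[simp] theorem tapes_input : tapes i m l r c none = i := rfl
@[simp] theorem tapes_main : tapes i m l r c (some .main) = m := rfl
@[simp] theorem tapes_left : tapes i m l r c (some .left) = l := rfl
@[simp] theorem tapes_right : tapes i m l r c (some .right) = r := rfl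
@[simp] theorem tapes_count : tapes i m l r c (some .count) = c := rfl

@[simp] theorem update_input :
    Function.update (tapes i m l r c) none y = tapes y m l r c := by
  funext k; rcases k with _ | (_ | _ | _ | _) <;> simp [tapes]
@[simp] theorem update_main :
    Function.update (tapes i m l r c) (some .main) x = tapes i x l r c := by
  funext k; rcases k with _ | (_ | _ | _ | _) <;> simp [tapes]
@[simp] theorem update_left :
    Function.update (tapes i m l r c) (some .left) x = tapes i m x r c := by
  funext k; rcases k with _ | (_ | _ | _ | _) <;> simp [tapes]
@[simp] theorem update_right :
    Function.update (tapes i m l r c) (some .right) x = tapes i m l x c := by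
  funext k; rcases k with _ | (_ | _ | _ | _) <;> simp [tapes]
@[simp] theorem update_count :
    Function.update (tapes i m l r c) (some .count) x = tapes i m l r x := by
  funext k; rcases k with _ | (_ | _ | _ | _) <;> simp [tapes]

end tapes

namespace Prog

/-- The program leads from the tapes `S` to the tapes `S'` in time at most `T`. -/
def RunIn (p : Prog (Sym A)) (S S' : ∀ k, List (Sym A k)) (T : ℕ) : Prop :=
  ∃ t ≤ T, Run p S S' t

variable {p q : Prog (Sym A)} {S S' S'' : ∀ k, List (Sym A k)} {T T' : ℕ}

theorem RunIn.mono (h : RunIn p S S' T) (hT : T ≤ T') : RunIn p S S' T' :=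
  let ⟨t, ht, h⟩ := h; ⟨t, ht.trans hT, h⟩

theorem RunIn.skip : RunIn skip S S 1 := ⟨1, le_rfl, .skip S⟩

theorem RunIn.push (k a) : RunIn (push k a) S (Function.update S k (a :: S k)) 1 :=
  ⟨1, le_rfl, .push k a S⟩

theorem RunIn.seq (h : RunIn p S S' T) (h' : RunIn q S' S'' T') :
    RunIn (seq p q) S S'' (T + T') :=
  let ⟨_, ht, h⟩ := h; let ⟨_, ht', h'⟩ := h'; ⟨_, add_le_add ht ht', .seq h h'⟩

theorem RunIn.branch {k f} (h : RunIn (f (S k).head?) (Function.update S k (S k).tail) S' T) :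
    RunIn (branch k f) S S' (1 + T) :=
  let ⟨_, ht, h⟩ := h; ⟨_, add_le_add le_rfl ht, .branch h⟩

theorem RunIn.loop_nil {k f} (h : S k = []) : RunIn (loop k f) S S 1 :=
  ⟨1, le_rfl, .loop_nil h⟩

theorem RunIn.loop_cons {k f a l} (h : S k = a :: l)
    (h₁ : RunIn (f a) (Function.update S k l) S' T) (h₂ : RunIn (loop k f) S' S'' T') :
    RunIn (loop k f) S S'' (1 + T + T') :=
  let ⟨_, ht, h₁⟩ := h₁; let ⟨_, ht', h₂⟩ := h₂
  ⟨_, add_le_add (add_le_add le_rfl ht) ht', .loop_cons h h₁ h₂⟩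

theorem RunIn.push_main {i : List A} {m l r c : List Bool} (a : Bool) :
    RunIn (.push (some .main) a) (tapes i m l r c) (tapes i (a :: m) l r c) 1 := by
  simpa using RunIn.push (S := tapes i m l r c) (some .main) a

theorem RunIn.push_left {i : List A} {m l r c : List Bool} (a : Bool) :
    RunIn (.push (some .left) a) (tapes i m l r c) (tapes i m (a :: l) r c) 1 := by
  simpa using RunIn.push (S := tapes i m l r c) (some .left) a

theorem RunIn.push_right {i : List A} {m l r c : List Bool} (a : Bool) :
    RunIn (.push (some .right) a) (tapes i m l r c) (tapes i m l (a :: r) c) 1 := by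
  simpa using RunIn.push (S := tapes i m l r c) (some .right) a

theorem RunIn.push_count {i : List A} {m l r c : List Bool} (a : Bool) :
    RunIn (.push (some .count) a) (tapes i m l r c) (tapes i m l r (a :: c)) 1 := by
  simpa using RunIn.push (S := tapes i m l r c) (some .count) a

/-- The loop of `move`. -/
def moveLoop (w : Work) : Prog (Sym A) :=
  loop (some .count) fun _ => branch (some .main) fun
    | some true => seq (push (some w) true)
        (seq (push (some .count) true) (push (some .count) true))
    | some false => push (some w) false
    | none => skip

/-- Move the topmost tree of the main stack to another stack, reversing its code. -/
def move (w : Work) : Prog (Sym A) :=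
  seq (push (some .count) true) (moveLoop w)

/-- The counter holds in unary the number of trees still to be moved: each symbol read uses up one,
and a `cons` adds its two subtrees. The rest of the run enters as a hypothesis, so that the
induction can chain the two subtrees. -/
theorem moveLoop_left (x : Tree) : ∀ {i : List A} {m l r c : List Bool},
    RunIn (moveLoop .left) (tapes i m (x.code.reverse ++ l) r c) S T →
      RunIn (moveLoop .left) (tapes i (x.code ++ m) l r (true :: c)) S (5 * x.size + T) := by
  induction x generalizing T with
  | nil =>
    intro i m l r c h
    refine (RunIn.loop_cons (k := some .count) rfl (RunIn.branch ?_) h (T := 1 + 1)).mono ?_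
    · simpa [Tree.code] using RunIn.push_left false
    · simp only [Tree.size]; omega
  | cons a b iha ihb =>
    intro i m l r c h
    have h' : RunIn (moveLoop .left) (tapes i (a.code ++ (b.code ++ m)) (true :: l) r
        (true :: true :: c)) S (5 * a.size + (5 * b.size + T)) := by
      refine iha (ihb ?_)
      simpa [Tree.code] using h
    refine (RunIn.loop_cons (k := some .count) rfl (RunIn.branch ?_) h' (T := 1 + 3)).mono ?_
    · simpa [Tree.code] using (RunIn.push_left true).seq
        ((RunIn.push_count true).seq (RunIn.push_count true))
    · simp only [Tree.size]; omega

theorem moveLoop_right (x : Tree) : ∀ {i : List A} {m l r c : List Bool},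
    RunIn (moveLoop .right) (tapes i m l (x.code.reverse ++ r) c) S T →
      RunIn (moveLoop .right) (tapes i (x.code ++ m) l r (true :: c)) S (5 * x.size + T) := by
  induction x generalizing T with
  | nil =>
    intro i m l r c h
    refine (RunIn.loop_cons (k := some .count) rfl (RunIn.branch ?_) h (T := 1 + 1)).mono ?_
    · simpa [Tree.code] using RunIn.push_right false
    · simp only [Tree.size]; omega
  | cons a b iha ihb =>
    intro i m l r c h
    have h' : RunIn (moveLoop .right) (tapes i (a.code ++ (b.code ++ m)) l (true :: r)
        (true :: true :: c)) S (5 * a.size + (5 * b.size + T)) := by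
      refine iha (ihb ?_)
      simpa [Tree.code] using h
    refine (RunIn.loop_cons (k := some .count) rfl (RunIn.branch ?_) h' (T := 1 + 3)).mono ?_
    · simpa [Tree.code] using (RunIn.push_right true).seq
        ((RunIn.push_count true).seq (RunIn.push_count true))
    · simp only [Tree.size]; omega

theorem move_left (x : Tree) (i : List A) (m l r : List Bool) :
    RunIn (move .left) (tapes i (x.code ++ m) l r []) (tapes i m (x.code.reverse ++ l) r [])
      (5 * x.size + 2) :=
  ((RunIn.push_count true).seq (moveLoop_left x (RunIn.loop_nil rfl))).mono (by omega)

theorem move_right (x : Tree) (i : List A) (m l r : List Bool) :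
    RunIn (move .right) (tapes i (x.code ++ m) l r []) (tapes i m l (x.code.reverse ++ r) [])
      (5 * x.size + 2) :=
  ((RunIn.push_count true).seq (moveLoop_right x (RunIn.loop_nil rfl))).mono (by omega)

/-- Pour a stack onto another one. -/
def pour (v w : Work) : Prog (Sym A) := loop (some v) fun a => push (some w) a

/-- Empty a stack. -/
def clear (v : Work) : Prog (Sym A) := loop (some v) fun _ => skip

theorem pour_left_main (l : List Bool) : ∀ (i : List A) (m r c : List Bool),
    RunIn (pour .left .main) (tapes i m l r c) (tapes i (l.reverse ++ m) [] r c)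
      (2 * l.length + 1) := by
  induction l with
  | nil => intro i m r c; exact RunIn.loop_nil rfl
  | cons a l ih =>
    intro i m r c
    rw [List.reverse_cons, List.append_assoc]
    exact (RunIn.loop_cons (S' := tapes i (a :: m) l r c) rfl (by simpa using RunIn.push_main a)
      (ih i _ r c)).mono (by simp only [List.length_cons]; omega)

theorem pour_right_main (r : List Bool) : ∀ (i : List A) (m l c : List Bool),
    RunIn (pour .right .main) (tapes i m l r c) (tapes i (r.reverse ++ m) l [] c)
      (2 * r.length + 1) := by
  induction r with
  | nil => intro i m r c; exact RunIn.loop_nil rfl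
  | cons a r ih =>
    intro i m l c
    rw [List.reverse_cons, List.append_assoc]
    exact (RunIn.loop_cons (S' := tapes i (a :: m) l r c) rfl (by simpa using RunIn.push_main a)
      (ih i _ l c)).mono (by simp only [List.length_cons]; omega)

theorem pour_right_left (r : List Bool) : ∀ (i : List A) (m l c : List Bool),
    RunIn (pour .right .left) (tapes i m l r c) (tapes i m (r.reverse ++ l) [] c)
      (2 * r.length + 1) := by
  induction r with
  | nil => intro i m r c; exact RunIn.loop_nil rfl
  | cons a r ih =>
    intro i m l c
    rw [List.reverse_cons, List.append_assoc]
    exact (RunIn.loop_cons (S' := tapes i m (a :: l) r c) rfl (by simpa using RunIn.push_left a)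
      (ih i m _ c)).mono (by simp only [List.length_cons]; omega)

theorem clear_left (l : List Bool) : ∀ (i : List A) (m r c : List Bool),
    RunIn (clear .left) (tapes i m l r c) (tapes i m [] r c) (2 * l.length + 1) := by
  induction l with
  | nil => intro i m r c; exact RunIn.loop_nil rfl
  | cons a l ih =>
    intro i m r c
    refine (RunIn.loop_cons (S' := tapes i m l r c) rfl ?_ (ih i m r c) (T := 1)).mono ?_
    · simpa using RunIn.skip
    · simp only [List.length_cons]; omega

theorem clear_right (r : List Bool) : ∀ (i : List A) (m l c : List Bool),
    RunIn (clear .right) (tapes i m l r c) (tapes i m l [] c) (2 * r.length + 1) := by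
  induction r with
  | nil => intro i m r c; exact RunIn.loop_nil rfl
  | cons a r ih =>
    intro i m l c
    refine (RunIn.loop_cons (S' := tapes i m l r c) rfl ?_ (ih i m l c) (T := 1)).mono ?_
    · simpa using RunIn.skip
    · simp only [List.length_cons]; omega

theorem clear_count (c : List Bool) : ∀ (i : List A) (m l r : List Bool),
    RunIn (clear .count) (tapes i m l r c) (tapes i m l r []) (2 * c.length + 1) := by
  induction c with
  | nil => intro i m r c; exact RunIn.loop_nil rfl
  | cons a c ih =>
    intro i m l r
    refine (RunIn.loop_cons (S' := tapes i m l r c) rfl ?_ (ih i m l r) (T := 1)).mono ?_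
    · simpa using RunIn.skip
    · simp only [List.length_cons]; omega

/-- The program leads from the stack `s` of trees to the stack `s'` in time at most `T`. -/
def Does (p : Prog (Sym A)) (s s' : List Tree) (T : ℕ) : Prop :=
  RunIn p (tapes [] (s.flatMap Tree.code) [] [] []) (tapes [] (s'.flatMap Tree.code) [] [] []) T

variable {s s' s'' : List Tree} {x y : Tree}

theorem Does.mono (h : Does p s s' T) (hT : T ≤ T') : Does p s s' T' := RunIn.mono h hT

theorem Does.seq (h : Does p s s' T) (h' : Does q s' s'' T') : Does (seq p q) s s'' (T + T') :=
  RunIn.seq h h'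

theorem does_skip : Does (A := A) skip s s 1 := RunIn.skip

theorem does_mkCons : Does (A := A) (push (some .main) true) (x :: y :: s) (.cons x y :: s) 1 := by
  simpa [Does, Tree.code] using RunIn.push_main (A := A) true (i := [])

def uncons : Prog (Sym A) := branch (some .main) fun _ => skip

theorem does_uncons : Does (A := A) uncons (.cons x y :: s) (x :: y :: s) 2 := by
  refine RunIn.branch (T := 1) ?_
  simpa [Tree.code] using RunIn.skip

def drop : Prog (Sym A) := seq (move .left) (clear .left)

theorem does_drop : Does (A := A) drop (x :: s) s (7 * x.size + 3) := by
  refine ((move_left x _ _ _ _).seq (clear_left _ _ _ _ _)).mono ?_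
  simp; omega

/-- Moving reverses a code and pouring reverses it back; `left` is poured first, so its tree ends up
below. -/
def swap : Prog (Sym A) :=
  seq (move .left) (seq (move .right) (seq (pour .left .main) (pour .right .main)))

theorem does_swap : Does (A := A) swap (x :: y :: s) (y :: x :: s) (7 * x.size + 7 * y.size + 6) := by
  have h := (move_left x ([] : List A) (y.code ++ s.flatMap Tree.code) [] []).seq
    ((move_right y _ _ _ _).seq
    ((pour_left_main _ _ _ _ _).seq (pour_right_main _ _ _ _ _)))
  simp only [List.append_nil, List.reverse_reverse] at h
  exact RunIn.mono h (by simp; omega)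

def dupLoop : Prog (Sym A) :=
  loop (some .left) fun a => seq (push (some .main) a) (push (some .right) a)

theorem dupLoop_run (l : List Bool) : ∀ (i : List A) (m r c : List Bool),
    RunIn dupLoop (tapes i m l r c) (tapes i (l.reverse ++ m) [] (l.reverse ++ r) c)
      (3 * l.length + 1) := by
  induction l with
  | nil => intro i m r c; exact RunIn.loop_nil rfl
  | cons a l ih =>
    intro i m r c
    rw [List.reverse_cons, List.append_assoc, List.append_assoc]
    exact (RunIn.loop_cons (S' := tapes i (a :: m) l (a :: r) c) rfl
      (by simpa using (RunIn.push_main a).seq (RunIn.push_right a)) (ih i _ _ c)).mono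
      (by simp only [List.length_cons]; omega)

/-- The copy that `dupLoop` leaves on `right` already reads forwards, so it takes two pourings to
reach `main` in this orientation. -/
def dup : Prog (Sym A) :=
  seq (move .left) (seq dupLoop (seq (pour .right .left) (pour .left .main)))

theorem does_dup : Does (A := A) dup (x :: s) (x :: x :: s) (12 * x.size + 5) := by
  have h := (move_left x ([] : List A) (s.flatMap Tree.code) [] []).seq
    ((dupLoop_run _ _ _ _ _).seq
    ((pour_right_left _ _ _ _ _).seq (pour_left_main _ _ _ _ _)))
  simp only [List.append_nil, List.reverse_reverse] at h
  exact RunIn.mono h (by simp; omega)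

def pushCode : List Bool → Prog (Sym A)
  | [] => skip
  | a :: l => seq (pushCode l) (push (some .main) a)

theorem pushCode_run (l : List Bool) (i : List A) (m : List Bool) :
    RunIn (pushCode l) (tapes i m [] [] []) (tapes i (l ++ m) [] [] []) (l.length + 1) := by
  induction l with
  | nil => exact RunIn.skip
  | cons a l ih => exact (ih.seq (RunIn.push_main a)).mono (by simp)

theorem does_pushCode (x : Tree) :
    Does (A := A) (pushCode x.code) s (x :: s) (x.size + 1) := by
  simpa [Does] using pushCode_run (A := A) x.code [] (s.flatMap Tree.code)

/-- Do `p` or `q` if the topmost tree is `nil` respectively not `nil`. -/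
def ifNil (p q : Prog (Sym A)) : Prog (Sym A) :=
  branch (some .main) fun
    | some true => seq (push (some .main) true) q
    | _ => seq (push (some .main) false) p

theorem Does.ifNil_nil (h : Does p (.nil :: s) s' T) : Does (ifNil p q) (.nil :: s) s' (T + 2) := by
  refine (RunIn.branch (T := 1 + T) ?_).mono (by omega)
  simp only [tapes_main, List.flatMap_cons, Tree.code, List.cons_append, List.head?_cons,
    List.tail_cons, update_main]
  exact (RunIn.push_main false).seq h

theorem Does.ifNil_cons (h : Does q (.cons x y :: s) s' T) :
    Does (ifNil p q) (.cons x y :: s) s' (T + 2) := by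
  refine (RunIn.branch (T := 1 + T) ?_).mono (by omega)
  simp only [tapes_main, List.flatMap_cons, Tree.code, List.cons_append, List.head?_cons,
    List.tail_cons, update_main]
  exact (RunIn.push_main true).seq h

/-- The counter is the control flag: popping it enters the body, and the body pushes it again after
the next test. It is empty while `p` and `q` run, so these may use it themselves. -/
def whileLoop (p q : Prog (Sym A)) : Prog (Sym A) :=
  loop (some .count) fun _ => branch (some .main) fun
    | some true => seq (push (some .main) true)
        (seq drop (seq q (seq dup (seq p (push (some .count) true)))))
    | _ => skip

/-- As long as `p` computes something different from `nil` from the topmost tree, do `q`. -/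
def while' (p q : Prog (Sym A)) : Prog (Sym A) :=
  seq dup (seq p (seq (push (some .count) true) (whileLoop p q)))

theorem whileLoop_run (Z : ℕ) : ∀ (N : ℕ) (y c : ℕ → Tree),
    (∀ i ≤ N, Does p (y i :: y i :: s) (c i :: y i :: s) T) →
    (∀ i < N, Does q (y i :: s) (y (i + 1) :: s) T) →
    (∀ i < N, c i ≠ .nil) → c N = .nil → (∀ i ≤ N, (y i).size ≤ Z ∧ (c i).size ≤ Z) →
    RunIn (whileLoop p q) (tapes [] ((c 0 :: y 0 :: s).flatMap Tree.code) [] [] [true])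
      (tapes [] ((y N :: s).flatMap Tree.code) [] [] []) (N * (2 * T + 19 * Z + 12) + 4) := by
  intro N
  induction N with
  | zero =>
    intro y c hp hq hc hcN hZ
    refine (RunIn.loop_cons (k := some .count) rfl (RunIn.branch (T := 1) ?_)
      (RunIn.loop_nil rfl)).mono (by omega)
    simpa [hcN, Tree.code] using RunIn.skip
  | succ N ih =>
    intro y c hp hq hc hcN hZ
    have h' := ih (fun i => y (i + 1)) (fun i => c (i + 1)) (fun i hi => hp _ (by omega))
      (fun i hi => hq _ (by omega)) (fun i hi => hc _ (by omega)) hcN (fun i hi => hZ _ (by omega))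
    obtain ⟨a, b, hab⟩ : ∃ a b, c 0 = .cons a b := by
      have := hc 0 (by omega)
      cases h : c 0 with
      | nil => exact absurd h this
      | cons a b => exact ⟨a, b, rfl⟩
    have hd : Does (A := A) drop (c 0 :: y 0 :: s) (y 0 :: s) (7 * Z + 3) :=
      does_drop.mono (by have := (hZ 0 (by omega)).2; omega)
    have hu : Does (A := A) dup (y 1 :: s) (y 1 :: y 1 :: s) (12 * Z + 5) :=
      does_dup.mono (by have := (hZ 1 (by omega)).1; omega)
    refine (RunIn.loop_cons (k := some .count) rfl (RunIn.branch ?_) h'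
      (T := 1 + (1 + ((7 * Z + 3) + (T + (12 * Z + 5 + (T + 1))))))).mono ?_
    · have h₁ : RunIn p _ (tapes [] ((c 1 :: y 1 :: s).flatMap Tree.code) [] [] []) T :=
        hp 1 (by omega)
      have := RunIn.seq hd (RunIn.seq (hq 0 (by omega)) (RunIn.seq hu (h₁.seq
        (RunIn.push_count true))))
      rw [hab] at this ⊢
      simp only [tapes_main, List.flatMap_cons, Tree.code, List.cons_append, List.head?_cons,
        List.tail_cons, update_main, update_count]
      exact (RunIn.push_main true).seq this
    · ring_nf; omega

theorem does_while (Z N : ℕ) (y c : ℕ → Tree)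
    (hp : ∀ i ≤ N, Does p (y i :: y i :: s) (c i :: y i :: s) T)
    (hq : ∀ i < N, Does q (y i :: s) (y (i + 1) :: s) T)
    (hc : ∀ i < N, c i ≠ .nil) (hcN : c N = .nil)
    (hZ : ∀ i ≤ N, (y i).size ≤ Z ∧ (c i).size ≤ Z) :
    Does (while' p q) (y 0 :: s) (y N :: s) ((N + 1) * (2 * T + 19 * Z + 12)) := by
  have hu : Does (A := A) dup (y 0 :: s) (y 0 :: y 0 :: s) (12 * Z + 5) :=
    does_dup.mono (by have := (hZ 0 (by omega)).1; omega)
  refine RunIn.mono (RunIn.seq hu ((hp 0 (by omega)).seq ((RunIn.push_count true).seq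
    (whileLoop_run Z N y c hp hq hc hcN hZ)))) ?_
  ring_nf; omega

def cmpLoop : Prog (Sym A) :=
  loop (some .left) fun a => branch (some .right) fun o =>
    if o = some a then skip else push (some .count) true

/-- The counter records mismatches: each one pushes a symbol, and a stack `r` that is too short also
mismatches. What is left over of `r` has to be tested afterwards. -/
theorem cmpLoop_run (l : List Bool) : ∀ (i : List A) (m r c : List Bool),
    ∃ c' : List Bool, (c' = [] ↔ c = [] ∧ r.take l.length = l) ∧ c'.length ≤ c.length + l.length ∧
    RunIn cmpLoop (tapes i m l r c) (tapes i m [] (r.drop l.length) c') (3 * l.length + 1) := by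
  induction l with
  | nil => intro i m r c; exact ⟨c, by simp, by simp, RunIn.loop_nil rfl⟩
  | cons a l ih =>
    intro i m r c
    by_cases h : r.head? = some a
    · obtain ⟨c', h₁, h₂, h₃⟩ := ih i m r.tail c
      obtain ⟨r', rfl⟩ : ∃ r', r = a :: r' := by
        cases r with
        | nil => simp at h
        | cons b r => simp at h; exact ⟨r, by rw [h]⟩
      refine ⟨c', by simpa using h₁, by simp; omega, ?_⟩
      refine (RunIn.loop_cons (k := some .left) rfl (RunIn.branch (T := 1) ?_) h₃).mono
        (by simp; omega)
      simpa using RunIn.skip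
    · obtain ⟨c', h₁, h₂, h₃⟩ := ih i m r.tail (true :: c)
      refine ⟨c', ?_, by simp at h₂ ⊢; omega, ?_⟩
      · have : c' ≠ [] := by simp [h₁]
        simp only [this, false_iff, not_and]
        rintro - h'
        cases r <;> simp_all
      · have h₄ : r.drop (a :: l).length = r.tail.drop l.length := by simp
        rw [h₄]
        refine (RunIn.loop_cons (k := some .left) rfl (RunIn.branch (T := 1) ?_) h₃).mono
          (by simp; omega)
        simpa [h] using RunIn.push_count true

/-- Compare the two topmost trees. -/
def eqTest : Prog (Sym A) :=
  seq (move .left) <| seq (move .right) <| seq cmpLoop <|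
    seq (branch (some .right) fun o => o.elim skip fun _ => push (some .count) true) <|
    seq (clear .right) <|
    seq (branch (some .count) fun o => o.elim (pushCode (Tree.cons .nil .nil).code)
      fun _ => push (some .main) false) (clear .count)

open Classical in
theorem does_eqTest : Does (A := A) eqTest (x :: y :: s)
    ((if x = y then Tree.cons .nil .nil else .nil) :: s) (20 * (x.size + y.size + 1)) := by
  set m := s.flatMap Tree.code with hm
  obtain ⟨c, h₁, h₂, h₃⟩ := cmpLoop_run x.code.reverse ([] : List A) m y.code.reverse []
  set r := y.code.reverse.drop x.code.reverse.length with hr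
  have hrl : r.length ≤ y.size := by rw [hr]; simp
  have h₄ : ∃ c' : List Bool, (c' = [] ↔ c = [] ∧ r = []) ∧ c'.length ≤ c.length + 1 ∧
      RunIn (branch (some .right) fun o => o.elim skip fun _ => push (some .count) true)
        (tapes ([] : List A) m [] r c) (tapes [] m [] r.tail c') 2 := by
    cases hr' : r with
    | nil =>
      refine ⟨c, by simp, by simp, RunIn.branch (T := 1) ?_⟩
      simpa using RunIn.skip
    | cons a r' =>
      refine ⟨true :: c, by simp, by simp, RunIn.branch (T := 1) ?_⟩
      simpa using RunIn.push_count true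
  obtain ⟨c', h₅, h₆, h₇⟩ := h₄
  have key : c' = [] ↔ x = y := by
    rw [h₅, h₁, hr]
    simp only [true_and]
    constructor
    · rintro ⟨h, h'⟩
      have := List.take_append_drop x.code.reverse.length y.code.reverse
      rw [h, h', List.append_nil] at this
      exact Tree.code_injective (List.reverse_injective this)
    · rintro rfl
      simp
  have h₈ : RunIn (branch (some .count) fun o => o.elim (pushCode (Tree.cons .nil .nil).code)
      fun _ => push (some .main) false) (tapes ([] : List A) m [] [] c')
      (tapes [] (((if x = y then Tree.cons .nil .nil else .nil) :: s).flatMap Tree.code) [] []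
        c'.tail) 5 := by
    cases hc' : c' with
    | nil =>
      rw [if_pos (key.1 hc')]
      refine RunIn.branch (T := 4) ?_
      simpa [Tree.code] using pushCode_run (A := A) (Tree.cons .nil .nil).code [] m
    | cons a l =>
      rw [if_neg (fun h => by simp [key.2 h] at hc')]
      refine (RunIn.branch (T := 1) ?_).mono (by omega)
      simpa [Tree.code] using RunIn.push_main false
  have h₉ := (move_left x ([] : List A) (y.code ++ m) [] []).seq
    ((move_right y _ _ _ _).seq ((List.append_nil x.code.reverse ▸
      List.append_nil y.code.reverse ▸ h₃).seq (h₇.seq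
      ((clear_right _ _ _ _ _).seq (h₈.seq (clear_count _ _ _ _ _))))))
  refine RunIn.mono h₉ ?_
  simp at h₂ ⊢
  omega

end Prog

end

section

/-! ### Polynomial-time functions -/

/-- Types with an encoding by binary trees. -/
class Enc (α : Type) where
  enc : α → Tree
  enc_injective : Function.Injective enc

open Enc (enc enc_injective)

/-- The size of the encoding. -/
def sz {α : Type} [Enc α] (x : α) : ℕ := (enc x).size

section instances

/-- Unary: polynomial time in a number means polynomial in its value. Numbers of the input that may
be exponentially large are therefore kept as lists of binary digits. -/
def encNat : ℕ → Tree
  | 0 => .nil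
  | n + 1 => .cons .nil (encNat n)

instance : Enc ℕ where
  enc := encNat
  enc_injective := by
    intro m
    induction m with
    | zero => rintro (_ | n) h <;> simp_all [encNat]
    | succ m ih =>
      rintro (_ | n) h
      · simp [encNat] at h
      · simp only [encNat, Tree.cons.injEq, true_and] at h
        rw [ih h]

instance : Enc Bool where
  enc b := if b then .cons .nil .nil else .nil
  enc_injective := by rintro (_ | _) (_ | _) <;> simp

variable {α β : Type} [Enc α] [Enc β]

instance : Enc (α × β) where
  enc p := .cons (enc p.1) (enc p.2)
  enc_injective := by
    rintro ⟨a, b⟩ ⟨c, d⟩ h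
    simp only [Tree.cons.injEq] at h
    rw [enc_injective h.1, enc_injective h.2]

/-- The same tree as for a list of at most one element. Such coincidences make conversions between
types free of cost. -/
instance : Enc (Option α) where
  enc o := o.elim .nil fun a => .cons (enc a) .nil
  enc_injective := by
    rintro (_ | a) (_ | b) h <;> simp_all
    exact enc_injective h

def encList : List α → Tree
  | [] => .nil
  | a :: l => .cons (enc a) (encList l)

instance : Enc (List α) where
  enc := encList
  enc_injective := by
    intro l
    induction l with
    | nil => rintro (_ | ⟨b, m⟩) h <;> simp_all [encList]
    | cons a l ih =>
      rintro (_ | ⟨b, m⟩) h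
      · simp [encList] at h
      · simp only [encList, Tree.cons.injEq] at h
        rw [ih h.2, enc_injective h.1]

instance : Enc (α ⊕ β) where
  enc s := s.elim (fun a => .cons .nil (enc a)) fun b => .cons (.cons .nil .nil) (enc b)
  enc_injective := by
    rintro (a | a) (b | b) h <;> simp at h
    · rw [enc_injective h]
    · rw [enc_injective h]

instance : Enc Γ' where
  enc
    | .blank => encNat 0
    | .bit false => encNat 1
    | .bit true => encNat 2
    | .bra => encNat 3
    | .ket => encNat 4
    | .comma => encNat 5
  enc_injective := by
    rintro (_ | (_ | _) | _ | _ | _) (_ | (_ | _) | _ | _ | _) h <;> simp_all [encNat]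

theorem sz_pos (x : α) : 1 ≤ sz x := Tree.size_pos _
theorem sz_pair (p : α × β) : sz p = sz p.1 + sz p.2 + 1 := rfl
theorem sz_nil : sz ([] : List α) = 1 := rfl
theorem sz_cons (a : α) (l : List α) : sz (a :: l) = sz a + sz l + 1 := rfl
theorem sz_none : sz (none : Option α) = 1 := rfl
theorem sz_some (a : α) : sz (some a) = sz a + 2 := rfl
theorem sz_nat (n : ℕ) : sz n = 2 * n + 1 := by
  induction n with
  | zero => rfl
  | succ n ih =>
    have : sz (n + 1) = 1 + sz n + 1 := rfl
    omega
theorem sz_bool (b : Bool) : sz b ≤ 3 := by cases b <;> simp [sz, enc, Tree.size]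
theorem length_le_sz (l : List α) : 2 * l.length + 1 ≤ sz l := by
  induction l with
  | nil => simp [sz_nil]
  | cons a l ih => have := sz_pos a; simp [sz_cons]; omega
theorem sz_list (l : List α) : sz l = (l.map sz).sum + l.length + 1 := by
  induction l with
  | nil => rfl
  | cons a l ih => simp [sz_cons, ih]; omega
theorem sz_list_le {l : List α} {Z : ℕ} (h : ∀ a ∈ l, sz a ≤ Z) : sz l ≤ l.length * (Z + 1) + 1 := by
  induction l with
  | nil => simp [sz_nil]
  | cons a l ih =>
    have h₁ := h a (by simp)
    have h₂ := ih fun a ha => h a (by simp [ha])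
    simp only [sz_cons, List.length_cons]
    linarith [Nat.succ_mul l.length (Z + 1)]
theorem sz_mem_le {l : List α} {a : α} (h : a ∈ l) : sz a ≤ sz l := by
  rw [sz_list]
  have := List.single_le_sum (l := l.map sz) (by simp) _ (List.mem_map_of_mem h)
  omega

end instances

theorem _root_.Polynomial.eval_mono_nat (P : Polynomial ℕ) : Monotone fun n => P.eval n := by
  intro m n h
  simp only [Polynomial.eval_eq_sum_range]
  gcongr

variable {α β γ δ ξ : Type} [Enc α] [Enc β] [Enc γ] [Enc δ] [Enc ξ]

/-- Functions bounded by a polynomial in the size of the argument. -/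
def PolyBounded (g : α → ℕ) : Prop := ∃ P : Polynomial ℕ, ∀ x, g x ≤ P.eval (sz x)

namespace PolyBounded

variable {g h : α → ℕ}

theorem mono (hh : PolyBounded h) (H : ∀ x, g x ≤ h x) : PolyBounded g :=
  let ⟨P, hP⟩ := hh; ⟨P, fun x => (H x).trans (hP x)⟩

theorem const (n : ℕ) : PolyBounded fun _ : α => n := ⟨.C n, fun x => by simp⟩

theorem size : PolyBounded fun x : α => sz x := ⟨.X, fun x => by simp⟩

theorem add (hg : PolyBounded g) (hh : PolyBounded h) : PolyBounded fun x => g x + h x :=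
  let ⟨P, hP⟩ := hg; let ⟨Q, hQ⟩ := hh
  ⟨P + Q, fun x => by simpa using add_le_add (hP x) (hQ x)⟩

theorem mul (hg : PolyBounded g) (hh : PolyBounded h) : PolyBounded fun x => g x * h x :=
  let ⟨P, hP⟩ := hg; let ⟨Q, hQ⟩ := hh
  ⟨P * Q, fun x => by simpa using Nat.mul_le_mul (hP x) (hQ x)⟩

theorem eval (hg : PolyBounded g) (P : Polynomial ℕ) : PolyBounded fun x => P.eval (g x) :=
  let ⟨Q, hQ⟩ := hg
  ⟨P.comp Q, fun x => by simpa using P.eval_mono_nat (hQ x)⟩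

theorem comp {g : β → ℕ} (hg : PolyBounded g) {f : α → β} (hf : PolyBounded fun x => sz (f x)) :
    PolyBounded fun x => g (f x) :=
  let ⟨P, hP⟩ := hg; (hf.eval P).mono fun x => hP (f x)

theorem exists_add {g : α × β → ℕ} (hg : PolyBounded g) :
    ∃ P : Polynomial ℕ, ∀ x y, g (x, y) ≤ P.eval (sz x + sz y + 1) :=
  let ⟨P, hP⟩ := hg; ⟨P, fun x y => hP (x, y)⟩

end PolyBounded

/-- Functions computed in polynomial time by a stack program. -/
@[fun_prop]
def PolyTime (f : α → β) : Prop :=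
  ∃ (p : Prog (Sym (Γ' ⊕ Bool))) (T : α → ℕ), PolyBounded T ∧ PolyBounded (fun x => sz (f x)) ∧
    ∀ x s, p.Does (enc x :: s) (enc (f x) :: s) (T x)

namespace PolyTime
open Prog

theorem bounded {f : α → β} (hf : PolyTime f) : PolyBounded fun x => sz (f x) :=
  let ⟨_, _, _, h, _⟩ := hf; h

theorem of_enc_eq {f : α → β} (h : ∀ x, enc (f x) = enc x) : PolyTime f := by
  refine ⟨skip, fun _ => 1, .const _, ?_, fun x s => ?_⟩
  · exact PolyBounded.size.mono fun x => by simp [sz, h]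
  · rw [h]; exact does_skip

@[fun_prop]
theorem id' : PolyTime fun x : α => x := of_enc_eq fun _ => rfl

@[fun_prop]
theorem const (b : β) : PolyTime fun _ : α => b :=
  ⟨seq drop (pushCode (enc b).code), fun x => (7 * sz x + 3) + (sz b + 1),
    (((PolyBounded.const 7).mul .size).add (.const _)).add (.const _), .const _,
    fun _ _ => does_drop.seq (does_pushCode _)⟩

-- The second program runs on `f x`; the polynomial bound on the size of `f x`, part of `PolyTime`,
-- keeps its time polynomial in the size of `x`.
@[fun_prop]
theorem comp {g : β → γ} {f : α → β} (hg : PolyTime g) (hf : PolyTime f) :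
    PolyTime fun x => g (f x) := by
  obtain ⟨p, T, hT, hb, hp⟩ := hf
  obtain ⟨q, U, hU, hc, hq⟩ := hg
  exact ⟨seq p q, fun x => T x + U (f x), hT.add (hU.comp hb), hc.comp hb,
    fun x s => (hp x s).seq (hq _ s)⟩

@[fun_prop]
theorem prodMk {f : α → β} {g : α → γ} (hf : PolyTime f) (hg : PolyTime g) :
    PolyTime fun x => (f x, g x) := by
  obtain ⟨p, T, hT, hb, hp⟩ := hf
  obtain ⟨q, U, hU, hc, hq⟩ := hg
  refine ⟨seq dup (seq q (seq swap (seq p (push (some .main) true)))),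
    fun x => (12 * sz x + 5) + (U x + ((7 * sz (g x) + 7 * sz x + 6) + (T x + 1))), ?_, ?_, ?_⟩
  · exact (((PolyBounded.const _).mul .size).add (.const _)).add (hU.add
      (((((PolyBounded.const _).mul hc).add ((PolyBounded.const _).mul .size)).add
        (.const _)).add (hT.add (.const _))))
  · exact (hb.add hc).add (.const 1)
  · intro x s
    exact does_dup.seq ((hq x _).seq (does_swap.seq ((hp x _).seq does_mkCons)))

@[fun_prop]
theorem fst {f : α → β × γ} (hf : PolyTime f) : PolyTime fun x => (f x).1 := by
  refine comp (g := Prod.fst) ⟨seq uncons (seq swap drop), fun x =>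
    2 + ((7 * sz x + 7 * sz x + 6) + (7 * sz x + 3)), ?_, ?_, ?_⟩ hf
  · have := (PolyBounded.const 7).mul (PolyBounded.size (α := β × γ))
    exact (PolyBounded.const _).add (((this.add this).add (.const _)).add (this.add (.const _)))
  · exact PolyBounded.size.mono fun x => by rw [sz_pair x]; omega
  · rintro ⟨a, b⟩ s
    have h : sz (a, b) = (enc a).size + (enc b).size + 1 := rfl
    refine Does.seq does_uncons (Does.seq (does_swap.mono ?_) (does_drop.mono ?_)) <;>
    · dsimp only
      omega

@[fun_prop]
theorem snd {f : α → β × γ} (hf : PolyTime f) : PolyTime fun x => (f x).2 := by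
  refine comp (g := Prod.snd) ⟨seq uncons drop, fun x => 2 + (7 * sz x + 3), ?_, ?_, ?_⟩ hf
  · exact (PolyBounded.const _).add (((PolyBounded.const 7).mul .size).add (.const _))
  · exact PolyBounded.size.mono fun x => by rw [sz_pair x]; omega
  · rintro ⟨a, b⟩ s
    have h : sz (a, b) = (enc a).size + (enc b).size + 1 := rfl
    refine Does.seq does_uncons (does_drop.mono ?_)
    dsimp only
    omega

/-- Case distinction on whether a value is encoded by `nil`. -/
theorem cases {l : α → β} {f : α → δ} {g : α × γ → δ} {r : α → δ} (hl : PolyTime l)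
    (hf : PolyTime f) (hg : PolyTime g)
    (h : ∀ x, (enc (l x) = .nil ∧ r x = f x) ∨
      ∃ y : γ, enc (l x) = enc y ∧ enc y ≠ .nil ∧ r x = g (x, y)) : PolyTime r := by
  obtain ⟨p, T, hT, hb, hp⟩ := hl
  obtain ⟨q, U, hU, hc, hq⟩ := hf
  obtain ⟨q', U', hU', hc', hq'⟩ := hg
  obtain ⟨P, hP⟩ := hU'.exists_add
  obtain ⟨Q, hQ⟩ := hc'.exists_add
  have hs : PolyBounded fun x => sz x + sz (l x) + 1 := (PolyBounded.size.add hb).add (.const 1)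
  -- After `swap`, one more symbol `true` turns the two topmost trees into the encoding of the pair
  -- `(x, y)`.
  refine ⟨seq dup (seq p (ifNil (seq drop q) (seq swap (seq (push (some .main) true) q')))),
    fun x => (12 * sz x + 5) + (T x + (((7 * sz (l x) + 7 * sz x + 6) + (1 + (U x +
      P.eval (sz x + sz (l x) + 1)))) + 2)), ?_, ?_, ?_⟩
  · exact (((PolyBounded.const _).mul .size).add (.const _)).add (hT.add
      ((((((PolyBounded.const _).mul hb).add ((PolyBounded.const _).mul .size)).add
        (.const _)).add ((PolyBounded.const _).add (hU.add (hs.eval P)))).add (.const _)))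
  · refine (hc.add (hs.eval Q)).mono fun x => ?_
    rcases h x with ⟨_, h₂⟩ | ⟨y, h₁, _, h₂⟩
    · rw [h₂]; omega
    · have := hQ x y
      rw [show sz (l x) = sz y by simp [sz, h₁], h₂]; omega
  · intro x s
    refine Does.seq does_dup ((hp x _).seq ?_)
    rcases h x with ⟨h₁, h₂⟩ | ⟨y, h₁, h₃, h₂⟩
    · rw [h₁, h₂]
      refine (Does.ifNil_nil (does_drop.seq (hq x s))).mono ?_
      have := sz_pos (l x)
      simp only [Tree.size]
      omega
    · have h₄ : sz (l x) = sz y := by simp [sz, h₁]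
      obtain ⟨a, b, hab⟩ : ∃ a b, enc y = .cons a b := by
        cases hy : enc y with
        | nil => exact absurd hy h₃
        | cons a b => exact ⟨a, b, rfl⟩
      have h₅ := hP x y
      have h₆ : Does _ (enc x :: enc y :: s) (enc (r x) :: s) (1 + U' (x, y)) :=
        does_mkCons.seq (h₂ ▸ hq' (x, y) s)
      have h₇ := (does_swap (x := enc y)).seq h₆
      rw [h₁, hab]
      rw [hab] at h₇
      refine (Does.ifNil_cons h₇).mono ?_
      rw [← hab, h₄]
      simp only [sz] at h₅ ⊢
      omega

/-- Iteration of a function as long as a test is positive. -/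
theorem iterate {c : ξ → Bool} {b : ξ → ξ} {i : α → ξ} {N Z : α → ℕ} (hc : PolyTime c)
    (hb : PolyTime b) (hi : PolyTime i) (hN : PolyBounded N)
    (h₁ : ∀ x, ∀ k < N x, c (b^[k] (i x)) = true) (h₂ : ∀ x, c (b^[N x] (i x)) = false)
    (hZ : PolyBounded Z) (h : ∀ x, ∀ k ≤ N x, sz (b^[k] (i x)) ≤ Z x) :
    PolyTime fun x => b^[N x] (i x) := by
  obtain ⟨p, T, ⟨T', hT⟩, -, hp⟩ := hc
  obtain ⟨q, U, ⟨U', hU⟩, -, hq⟩ := hb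
  obtain ⟨r, V, hV, -, hr⟩ := hi
  refine ⟨seq r (while' p q), fun x => V x + ((N x + 1) *
    (2 * (T'.eval (Z x) + U'.eval (Z x)) + 19 * (Z x + 3) + 12)), ?_,
    hZ.mono fun x => h x _ le_rfl, ?_⟩
  · exact hV.add ((hN.add (.const _)).mul ((((PolyBounded.const _).mul
      ((hZ.eval _).add (hZ.eval _))).add ((PolyBounded.const _).mul (hZ.add (.const _)))).add
        (.const _)))
  · intro x s
    refine (hr x s).seq ?_
    -- The summand 3 leaves room for the encoded Boolean result of the test.
    refine does_while (Z x + 3) (N x) (fun k => enc (b^[k] (i x)))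
      (fun k => enc (c (b^[k] (i x)))) ?_ ?_ ?_ ?_ ?_
    · intro k hk
      refine (hp _ _).mono (((hT _).trans (T'.eval_mono_nat (h x k hk))).trans ?_)
      simp
    · intro k hk
      simp only [Function.iterate_succ_apply']
      refine (hq _ _).mono (((hU _).trans (U'.eval_mono_nat (h x k hk.le))).trans ?_)
      simp
    · intro k hk
      simp only [h₁ x k hk]
      simp [enc]
    · simp only [h₂ x]
      simp [enc]
    · intro k hk
      exact ⟨(h x k hk).trans (by omega), (sz_bool _).trans (by omega)⟩

open Classical in
@[fun_prop]
theorem eq_test {f g : α → β} [DecidableEq β] (hf : PolyTime f) (hg : PolyTime g) :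
    PolyTime fun x => decide (f x = g x) := by
  refine comp (g := fun p : β × β => decide (p.1 = p.2)) (f := fun x => (f x, g x)) ?_
    (hf.prodMk hg)
  refine ⟨seq uncons eqTest, fun x => 2 + 20 * sz x, ?_, ?_, ?_⟩
  · exact (PolyBounded.const _).add ((PolyBounded.const _).mul .size)
  · exact (PolyBounded.const 3).mono fun x => sz_bool _
  · rintro ⟨a, b⟩ s
    have h : Does _ (enc a :: enc b :: s) _ _ := does_eqTest (A := Γ' ⊕ Bool)
    have h' : enc (decide (a = b)) = if enc a = enc b then Tree.cons .nil .nil else .nil := by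
      by_cases hab : a = b
      · simp [hab, enc]
      · rw [if_neg fun h => hab (enc_injective h)]; simp [hab, enc]
    rw [h']
    exact does_uncons.seq h

theorem cond {c : α → Bool} {f g : α → β} (hc : PolyTime c) (hf : PolyTime f)
    (hg : PolyTime g) : PolyTime fun x => bif c x then f x else g x := by
  refine cases (γ := Bool) (g := fun p => f p.1) hc hg (by fun_prop) fun x => ?_
  cases hx : c x
  · left; exact ⟨rfl, rfl⟩
  · right; exact ⟨true, rfl, by simp [enc], rfl⟩

@[fun_prop]
theorem ite {c : α → Prop} [DecidablePred c] {f g : α → β} (hc : PolyTime fun x => decide (c x))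
    (hf : PolyTime f) (hg : PolyTime g) : PolyTime fun x => if c x then f x else g x := by
  have := cond hc hf hg
  simpa [Bool.cond_decide] using this

end PolyTime

end

section
open Enc (enc enc_injective)

variable {α β γ δ ξ : Type} [Enc α] [Enc β] [Enc γ] [Enc δ] [Enc ξ]

namespace PolyTime

/-- A program sees only trees, so it computes every function with the same encoded values. This
transports programs between types whose encodings agree. -/
theorem of_enc {f : α → β} {g : α → δ} (hg : PolyTime g) (h : ∀ x, enc (f x) = enc (g x)) :
    PolyTime f := by
  obtain ⟨p, T, hT, hb, hp⟩ := hg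
  refine ⟨p, T, hT, ?_, fun x s => ?_⟩
  · simpa [sz, h] using hb
  · rw [h]; exact hp x s

/-! #### Booleans, options and lists -/

@[fun_prop]
theorem and {f g : α → Bool} (hf : PolyTime f) (hg : PolyTime g) :
    PolyTime fun x => f x && g x := by
  simpa only [Bool.cond_false_right] using cond hf hg (const false)

@[fun_prop]
theorem not {f : α → Bool} (hf : PolyTime f) : PolyTime fun x => !f x := by
  refine (cond hf (const false) (const true)).of_enc fun x => ?_
  cases f x <;> rfl

@[fun_prop]
theorem or {f g : α → Bool} (hf : PolyTime f) (hg : PolyTime g) :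
    PolyTime fun x => f x || g x := by
  simpa only [Bool.cond_true_left] using cond hf (const true) hg

@[fun_prop]
theorem decide_and {p q : α → Prop} [DecidablePred p] [DecidablePred q]
    (hp : PolyTime fun x => decide (p x)) (hq : PolyTime fun x => decide (q x)) :
    PolyTime fun x => decide (p x ∧ q x) := by
  simpa only [Bool.decide_and] using hp.and hq

@[fun_prop]
theorem decide_or {p q : α → Prop} [DecidablePred p] [DecidablePred q]
    (hp : PolyTime fun x => decide (p x)) (hq : PolyTime fun x => decide (q x)) :
    PolyTime fun x => decide (p x ∨ q x) := by
  simpa only [Bool.decide_or] using hp.or hq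

@[fun_prop]
theorem cons {f : α → β} {l : α → List β} (hf : PolyTime f) (hl : PolyTime l) :
    PolyTime fun x => f x :: l x :=
  of_enc (hf.prodMk hl) fun _ => rfl

@[fun_prop]
theorem some {f : α → β} (hf : PolyTime f) : PolyTime fun x => Option.some (f x) :=
  of_enc (hf.prodMk (const ([] : List ℕ))) fun _ => rfl

@[fun_prop]
theorem toList {f : α → Option β} (hf : PolyTime f) : PolyTime fun x => (f x).toList :=
  of_enc hf fun x => by cases f x <;> rfl

@[fun_prop]
theorem head? {l : α → List β} (hl : PolyTime l) : PolyTime fun x => (l x).head? := by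
  refine cases (γ := β × List β) (f := fun _ => none) (g := fun p => Option.some p.2.1) hl
    (by fun_prop) (by fun_prop) fun x => ?_
  cases l x with
  | nil => exact .inl ⟨rfl, rfl⟩
  | cons a l => exact .inr ⟨(a, l), rfl, by simp [enc], rfl⟩

@[fun_prop]
theorem tail {l : α → List β} (hl : PolyTime l) : PolyTime fun x => (l x).tail := by
  refine cases (γ := β × List β) (f := fun _ => []) (g := fun p => p.2.2) hl
    (by fun_prop) (by fun_prop) fun x => ?_
  cases l x with
  | nil => exact .inl ⟨rfl, rfl⟩
  | cons a l => exact .inr ⟨(a, l), rfl, by simp [enc], rfl⟩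

@[fun_prop]
theorem isEmpty {l : α → List β} (hl : PolyTime l) : PolyTime fun x => (l x).isEmpty := by
  refine cases (γ := β × List β) (f := fun _ => true) (g := fun p => false) hl
    (by fun_prop) (by fun_prop) fun x => ?_
  cases l x with
  | nil => exact .inl ⟨rfl, rfl⟩
  | cons a l => exact .inr ⟨(a, l), rfl, by simp [enc], rfl⟩

theorem option_elim {o : α → Option β} {f : α → γ} {g : α → β → γ} (ho : PolyTime o)
    (hf : PolyTime f) (hg : PolyTime fun p : α × β => g p.1 p.2) :
    PolyTime fun x => (o x).elim (f x) (g x) := by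
  refine cases (γ := β × List ℕ) (f := f) (g := fun p => g p.1 p.2.1) ho
    (by fun_prop) (hg.comp (f := fun p : α × β × List ℕ => (p.1, p.2.1)) (by fun_prop))
    fun x => ?_
  cases o x with
  | none => exact .inl ⟨rfl, rfl⟩
  | some a => exact .inr ⟨(a, []), rfl, by simp [enc], rfl⟩

@[fun_prop]
theorem getD {o : α → Option β} {f : α → β} (ho : PolyTime o) (hf : PolyTime f) :
    PolyTime fun x => (o x).getD (f x) := by
  have := option_elim (g := fun _ a => a) ho hf (by fun_prop)
  exact this.of_enc fun x => by cases o x <;> rfl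

/-- A polynomial-time step repeated along a list may blow up the accumulator exponentially. Hence
the bound `Z` on all partial results is required; with it, the fold is an instance of `iterate`. -/
theorem foldl {f : α → β → γ → β} {l : α → List γ} {i : α → β} {Z : α → ℕ}
    (hf : PolyTime fun p : α × β × γ => f p.1 p.2.1 p.2.2) (hl : PolyTime l) (hi : PolyTime i)
    (hZ : PolyBounded Z) (h : ∀ x m, m <+: l x → sz (m.foldl (f x) (i x)) ≤ Z x) :
    PolyTime fun x => (l x).foldl (f x) (i x) := by
  -- The state is the rest of the list, the accumulator and the argument `x`, which the step
  -- function needs.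
  let b : List γ × β × α → List γ × β × α := fun s =>
    s.1.head?.elim s fun c => (s.1.tail, f s.2.2 s.2.1 c, s.2.2)
  have hb : PolyTime b := by
    refine option_elim (by fun_prop) (by fun_prop) ?_
    refine prodMk (by fun_prop) (prodMk ?_ (by fun_prop))
    exact hf.comp (f := fun p : (List γ × β × α) × γ => (p.1.2.2, p.1.2.1, p.2)) (by fun_prop)
  have key : ∀ k x, b^[k] (l x, i x, x) =
      ((l x).drop k, ((l x).take k).foldl (f x) (i x), x) := by
    intro k x
    induction k with
    | zero => simp
    | succ k ih =>
      rw [Function.iterate_succ_apply', ih]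
      simp only [b]
      cases hk : (l x).drop k with
      | nil =>
        have hk' := List.drop_eq_nil_iff.1 hk
        simp [List.take_of_length_le hk', List.take_of_length_le (hk'.trans (Nat.le_succ k)),
          hk'.trans (Nat.le_succ k)]
      | cons c m =>
        have hlt : k < (l x).length := by
          by_contra hlt
          simp [List.drop_eq_nil_of_le (not_lt.1 hlt)] at hk
        have hc : (l x)[k] = c := by
          have := List.drop_eq_getElem_cons hlt
          rw [hk] at this; exact (List.cons.inj this).1.symm
        have hm : (l x).drop (k + 1) = m := by
          rw [← List.tail_drop, hk, List.tail_cons]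
        simp only [List.head?_cons, Option.elim_some, List.tail_cons, hm, Prod.mk.injEq, and_true,
          true_and]
        rw [List.take_add_one, List.foldl_append, List.getElem?_eq_getElem hlt, hc]
        rfl
  have := iterate (c := fun s : List γ × β × α => !s.1.isEmpty) (b := b)
    (i := fun x => (l x, i x, x)) (N := fun x => (l x).length)
    (Z := fun x => sz (l x) + (Z x + sz x + 1) + 1) (by fun_prop) hb (by fun_prop)
    (hl.bounded.mono fun x => by have := length_le_sz (l x); omega) ?_ ?_ ?_ ?_
  · refine (snd this).fst.of_enc fun x => ?_
    rw [key]
    simp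
  · intro x k hk
    rw [key]
    simpa using hk
  · intro x
    rw [key]
    simp
  · exact (hl.bounded.add ((hZ.add .size).add (.const _))).add (.const _)
  · intro x k hk
    rw [key]
    have h₁ := h x _ (List.take_prefix k (l x))
    have h₂ : sz ((l x).drop k) ≤ sz (l x) := by
      have h₃ := congrArg sz (List.take_append_drop k (l x))
      rw [sz_list, List.map_append, List.sum_append, List.length_append] at h₃
      rw [sz_list]; omega
    simp only [sz_pair]
    omega

/-- If a step adds an amount that does not depend on the accumulator, the partial results grow by at
most the length of the list times a polynomial. -/
theorem foldl_of_le {f : α → β → γ → β} {l : α → List γ} {i : α → β} {g : α × γ → ℕ}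
    (hf : PolyTime fun p : α × β × γ => f p.1 p.2.1 p.2.2) (hl : PolyTime l) (hi : PolyTime i)
    (hg : PolyBounded g) (h : ∀ x b c, sz (f x b c) ≤ sz b + g (x, c)) :
    PolyTime fun x => (l x).foldl (f x) (i x) := by
  obtain ⟨P, hP⟩ := hg.exists_add
  refine foldl (Z := fun x => sz (i x) + sz (l x) * P.eval (sz x + sz (l x) + 1)) hf hl hi
    (hi.bounded.add (hl.bounded.mul (((PolyBounded.size.add hl.bounded).add (.const 1)).eval P)))
    fun x m hm => ?_
  have key : ∀ m : List γ, (∀ c ∈ m, c ∈ l x) → ∀ b,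
      sz (m.foldl (f x) b) ≤ sz b + m.length * P.eval (sz x + sz (l x) + 1) := by
    intro m
    induction m with
    | nil => intro _ b; simp
    | cons c m ih =>
      intro hc b
      have h₁ := ih (fun c hc' => hc c (by simp [hc'])) (f x b c)
      have h₂ := h x b c
      have h₃ := (hP x c).trans (P.eval_mono_nat (show sz x + sz c + 1 ≤ sz x + sz (l x) + 1 by
        have := sz_mem_le (hc c (by simp)); omega))
      simp only [List.foldl_cons, List.length_cons, Nat.succ_mul] at h₁ h₃ ⊢
      omega
  refine (key m (fun c hc => hm.subset hc) _).trans ?_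
  have h₁ := hm.length_le
  have h₂ := length_le_sz (l x)
  gcongr
  omega

@[fun_prop]
theorem reverse {l : α → List β} (hl : PolyTime l) : PolyTime fun x => (l x).reverse := by
  have := foldl_of_le (f := fun _ b c => c :: b) (i := fun _ => [])
    (g := fun p : α × β => sz p.2 + 1) (by fun_prop) hl (by fun_prop)
    ((PolyTime.snd id').bounded.add (.const 1)) fun x b c => by
      rw [sz_cons]; dsimp only; omega
  exact this.of_enc fun x => by simp

@[fun_prop]
theorem append {l m : α → List β} (hl : PolyTime l) (hm : PolyTime m) :
    PolyTime fun x => l x ++ m x := by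
  have := foldl_of_le (f := fun _ b c => c :: b) (g := fun p : α × β => sz p.2 + 1)
    (by fun_prop) hl.reverse hm ((PolyTime.snd id').bounded.add (.const 1)) fun x b c => by
      rw [sz_cons]; dsimp only; omega
  exact this.of_enc fun x => by simp

@[fun_prop]
theorem map {f : α → β → γ} {l : α → List β} (hf : PolyTime fun p : α × β => f p.1 p.2)
    (hl : PolyTime l) : PolyTime fun x => (l x).map (f x) := by
  have := (foldl_of_le (f := fun x b c => f x c :: b) (i := fun _ => [])
    (g := fun p => sz (f p.1 p.2) + 1) (cons (hf.comp (f := fun p : α × List γ × β => (p.1, p.2.2))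
      (by fun_prop)) (by fun_prop)) hl (by fun_prop) (hf.bounded.add (.const 1)) fun x b c => by
      simp only [sz_cons]; omega).reverse
  exact this.of_enc fun x => by simp

@[fun_prop]
theorem flatten {l : α → List (List β)} (hl : PolyTime l) : PolyTime fun x => (l x).flatten := by
  have := foldl_of_le (f := fun _ b c => b ++ c) (i := fun _ => []) (g := fun p => sz p.2)
    (by fun_prop) hl (by fun_prop) ((PolyTime.snd id').bounded) fun x b c => by
      simp only [sz_list, List.map_append, List.sum_append, List.length_append]; omega
  refine this.of_enc fun x => congrArg enc ?_
  have key : ∀ (m : List (List β)) (b : List β), m.foldl (fun b c => b ++ c) b = b ++ m.flatten := by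
    intro m
    induction m with
    | nil => simp
    | cons c m ih => intro b; simp [ih]
  rw [key, List.nil_append]

@[fun_prop]
theorem flatMap {f : α → β → List γ} {l : α → List β} (hf : PolyTime fun p : α × β => f p.1 p.2)
    (hl : PolyTime l) : PolyTime fun x => (l x).flatMap (f x) :=
  (map hf hl).flatten

@[fun_prop]
theorem filter {f : α → β → Bool} {l : α → List β} (hf : PolyTime fun p : α × β => f p.1 p.2)
    (hl : PolyTime l) : PolyTime fun x => (l x).filter (f x) := by
  have := flatMap (f := fun x b => if f x b = true then [b] else []) (by
    refine ite ?_ (by fun_prop) (by fun_prop)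
    simpa only [Bool.decide_eq_true] using hf) hl
  refine this.of_enc fun x => congrArg enc ?_
  induction l x with
  | nil => rfl
  | cons b m ih => rw [List.flatMap_cons, ← ih, List.filter_cons]; split <;> rfl

@[fun_prop]
theorem all {f : α → β → Bool} {l : α → List β} (hf : PolyTime fun p : α × β => f p.1 p.2)
    (hl : PolyTime l) : PolyTime fun x => (l x).all (f x) := by
  refine (isEmpty (filter (f := fun x b => !f x b) hf.not hl)).of_enc fun x => congrArg enc ?_
  rw [Bool.eq_iff_iff]
  simp

@[fun_prop]
theorem any {f : α → β → Bool} {l : α → List β} (hf : PolyTime fun p : α × β => f p.1 p.2)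
    (hl : PolyTime l) : PolyTime fun x => (l x).any (f x) := by
  refine (isEmpty (filter hf hl)).not.of_enc fun x => congrArg enc ?_
  rw [Bool.eq_iff_iff]
  simp

@[fun_prop]
theorem reduceOption {l : α → List (Option β)} (hl : PolyTime l) :
    PolyTime fun x => (l x).reduceOption := by
  refine (flatMap (f := fun _ o => Option.toList o) (by fun_prop) hl).of_enc fun x =>
    congrArg enc ?_
  induction l x with
  | nil => rfl
  | cons o l ih => cases o <;> simp_all [List.flatMap_cons]

/-! #### Natural numbers -/

@[fun_prop]
theorem succ {f : α → ℕ} (hf : PolyTime f) : PolyTime fun x => f x + 1 :=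
  of_enc ((const false).prodMk hf) fun _ => rfl

/-- Since `false` is encoded by `nil`, a number and a list of that many `false` are the same tree;
arithmetic reduces to list operations. -/
theorem enc_replicate (n : ℕ) : enc (List.replicate n false) = enc n := by
  induction n with
  | zero => rfl
  | succ n ih =>
    change Tree.cons (enc false) (enc (List.replicate n false)) = _
    rw [ih]
    rfl

theorem replicate_false {f : α → ℕ} (hf : PolyTime f) :
    PolyTime fun x => List.replicate (f x) false :=
  of_enc hf fun _ => enc_replicate _

@[fun_prop]
theorem pred {f : α → ℕ} (hf : PolyTime f) : PolyTime fun x => f x - 1 :=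
  (replicate_false hf).tail.of_enc fun x => by rw [List.tail_replicate, enc_replicate]

@[fun_prop]
theorem length {l : α → List β} (hl : PolyTime l) : PolyTime fun x => (l x).length :=
  (map (f := fun _ _ => false) (by fun_prop) hl).of_enc fun x => by
    rw [List.map_const', enc_replicate]

@[fun_prop]
theorem add {f g : α → ℕ} (hf : PolyTime f) (hg : PolyTime g) : PolyTime fun x => f x + g x :=
  ((replicate_false hf).append (replicate_false hg)).of_enc fun x => by
    rw [List.replicate_append_replicate, enc_replicate]

theorem iterate_of_le {f : α → β → β} {n : α → ℕ} {i : α → β} {g : α → ℕ}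
    (hf : PolyTime fun p : α × β => f p.1 p.2) (hn : PolyTime n) (hi : PolyTime i)
    (hg : PolyBounded g) (h : ∀ x b, sz (f x b) ≤ sz b + g x) :
    PolyTime fun x => (f x)^[n x] (i x) := by
  refine (foldl_of_le (f := fun x b _ => f x b) (g := fun p => g p.1)
    (hf.comp (f := fun p : α × β × Bool => (p.1, p.2.1)) (by fun_prop)) (replicate_false hn) hi
    (hg.comp (PolyTime.fst id').bounded) fun x b c => h x b).of_enc fun x => congrArg enc ?_
  generalize i x = b
  induction n x generalizing b with
  | zero => rfl
  | succ k ih => rw [Function.iterate_succ_apply, ih, List.replicate_succ, List.foldl_cons]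

@[fun_prop]
theorem sub {f g : α → ℕ} (hf : PolyTime f) (hg : PolyTime g) : PolyTime fun x => f x - g x := by
  refine (iterate_of_le (f := fun _ n => n - 1) (g := fun _ => 0) (by fun_prop) hg hf (.const _)
    fun x b => by simp only [sz_nat]; omega).of_enc fun x => congrArg enc ?_
  induction g x with
  | zero => rfl
  | succ k ih => rw [Function.iterate_succ_apply', ← ih, Nat.sub_add_eq]

@[fun_prop]
theorem mul {f g : α → ℕ} (hf : PolyTime f) (hg : PolyTime g) : PolyTime fun x => f x * g x := by
  refine (iterate_of_le (f := fun x n => n + f x) (g := fun x => sz (f x)) (by fun_prop) hg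
    (const 0) hf.bounded fun x b => by simp only [sz_nat]; omega).of_enc fun x => congrArg enc ?_
  induction g x with
  | zero => rfl
  | succ k ih => rw [Function.iterate_succ_apply', ← ih, Nat.mul_succ]

@[fun_prop]
theorem decide_le {f g : α → ℕ} (hf : PolyTime f) (hg : PolyTime g) :
    PolyTime fun x => decide (f x ≤ g x) := by
  simpa only [Nat.sub_eq_zero_iff_le] using (sub hf hg).eq_test (const 0)

@[fun_prop]
theorem decide_lt {f g : α → ℕ} (hf : PolyTime f) (hg : PolyTime g) :
    PolyTime fun x => decide (f x < g x) :=
  decide_le (succ hf) hg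

@[fun_prop]
theorem drop {n : α → ℕ} {l : α → List β} (hn : PolyTime n) (hl : PolyTime l) :
    PolyTime fun x => (l x).drop (n x) := by
  refine (iterate_of_le (f := fun _ l => l.tail) (g := fun _ => 0) (by fun_prop) hn hl (.const _)
    fun x b => ?_).of_enc fun x => congrArg enc ?_
  · cases b with
    | nil => rfl
    | cons a b => simp only [List.tail_cons, sz_cons]; omega
  · induction n x with
    | zero => rfl
    | succ k ih => rw [Function.iterate_succ_apply', ← ih, List.tail_drop]

@[fun_prop]
theorem getElem? {n : α → ℕ} {l : α → List β} (hn : PolyTime n) (hl : PolyTime l) :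
    PolyTime fun x => (l x)[n x]? := by
  simpa using (drop hn hl).head?

-- Each step appends the current length. The growth depends on the accumulator, so `foldl` is used
-- with an explicit bound.
@[fun_prop]
theorem range {n : α → ℕ} (hn : PolyTime n) : PolyTime fun x => List.range (n x) := by
  refine (foldl (f := fun _ (m : List ℕ) (_ : Bool) => m ++ [m.length]) (i := fun _ => [])
    (Z := fun x => sz (n x) * (2 * sz (n x) + 1 + 1) + 1) (by fun_prop) (replicate_false hn)
    (by fun_prop) ?_ fun x m hm => ?_).of_enc fun x => congrArg enc ?_
  · exact ((hn.bounded).mul ((((PolyBounded.const _).mul hn.bounded).add (.const _)).add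
      (.const _))).add (.const _)
  all_goals
    have key : ∀ m : List Bool, m.foldl (fun m _ => m ++ [m.length]) [] = List.range m.length := by
      intro m
      induction m using List.reverseRecOn with
      | nil => rfl
      | append_singleton m a ih => simp [ih, List.range_succ]
  · have h := hm.length_le
    rw [List.length_replicate] at h
    have h' : m.length ≤ sz (n x) := by rw [sz_nat]; omega
    rw [key]
    refine (sz_list_le (Z := 2 * sz (n x) + 1) fun a ha => ?_).trans ?_
    · rw [List.mem_range] at ha
      rw [sz_nat a]; omega
    · rw [List.length_range]
      gcongr
  · rw [key, List.length_replicate]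

end PolyTime

end

section
open Enc (enc enc_injective)

/-! ### From polynomial-time functions to Turing machines -/

namespace Prog

variable {A : Type}

/-- Replace the encoding of a Boolean value by its symbol. -/
def writeBool : Prog (Sym A) :=
  branch (some .main) fun
    | some true => branch (some .main) fun _ => branch (some .main) fun _ =>
        push (some .main) true
    | _ => push (some .main) false

theorem writeBool_run (b : Bool) :
    RunIn writeBool (tapes ([] : List A) (enc b).code [] [] []) (tapes [] [b] [] [] []) 4 := by
  cases b
  · refine (RunIn.branch (T := 1) ?_).mono (by omega)
    simpa [enc, Tree.code] using RunIn.push_main false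
  · refine RunIn.branch (T := 1 + (1 + 1)) ?_
    refine RunIn.branch (T := 1 + 1) ?_
    refine RunIn.branch (T := 1) ?_
    simpa [enc, Tree.code] using RunIn.push_main true

variable [Enc A] [Fintype A]

/-- Move the input word to the main stack, as the encoding of the reversed list. -/
def readInput : Prog (Sym A) :=
  loop none fun a => seq (pushCode (enc a).code) (push (some .main) true)

theorem readInput_run (i : List A) : ∀ acc : List A,
    RunIn readInput (tapes i (enc acc).code [] [] [])
      (tapes [] (enc (i.reverse ++ acc)).code [] [] []) (i.length * (∑ a : A, sz a + 3) + 1) := by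
  induction i with
  | nil => exact fun acc => (RunIn.loop_nil rfl).mono (by simp)
  | cons a i ih =>
    intro acc
    have h := ih (a :: acc)
    rw [List.reverse_cons, List.append_assoc]
    have h₁ : RunIn (seq (pushCode (enc a).code) (push (some .main) true))
        (tapes i (enc acc).code [] [] []) (tapes i (enc (a :: acc)).code [] [] [])
        (sz a + 1 + 1) := by
      refine RunIn.mono ((pushCode_run _ _ _).seq (RunIn.push_main true)) ?_
      simp [sz]
    have h₂ : sz a ≤ ∑ a : A, sz a :=
      Finset.single_le_sum (f := fun a : A => sz a) (fun _ _ => Nat.zero_le _) (Finset.mem_univ a)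
    refine (RunIn.loop_cons rfl ?_ h (T := sz a + 1 + 1)).mono ?_
    · simpa using h₁
    · rw [List.length_cons, Nat.succ_mul]
      omega

end Prog

-- Loading the input from its stack reverses it, so the program is the one for `f` after `reverse`.
-- The initial `false` is the empty list onto which the letters are put, and the size of the loaded
-- list is linear in the length of the word.
open Prog in
theorem computable_of_polyTime {f : List (Γ' ⊕ Bool) → Bool} (hf : PolyTime f) :
    Nonempty (Turing.TM2ComputableInPolyTime
      (encodingProd (encodingList Γ') (encodingList Bool)).encode encodeBool
      fun p => f (p.1.map .inl ++ p.2.map .inr)) := by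
  obtain ⟨p, T, ⟨P, hP⟩, -, hp⟩ := hf.comp (PolyTime.reverse PolyTime.id')
  let q := seq (push (some .main) false) (seq readInput (seq p writeBool))
  let M := ∑ a : Γ' ⊕ Bool, sz a
  have key : ∀ z : List (Γ' ⊕ Bool), Nonempty (Turing.TM2OutputsInTime
      (q.machine none (some .main)) z (some [f z])
      ((Polynomial.C (M + 3) * .X + P.comp (.C (M + 1) * .X + .C 1) + .C 7).eval z.length)) := by
    intro z
    have h₀ : RunIn (push (some .main) false) (tapes z [] [] [] [])
        (tapes z (enc ([] : List (Γ' ⊕ Bool))).code [] [] []) 1 := RunIn.push_main false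
    have h₁ := readInput_run z []
    rw [List.append_nil] at h₁
    have h₂ := hp z.reverse []
    simp only [List.reverse_reverse] at h₂
    have h₂' : RunIn p (tapes [] (enc z.reverse).code [] [] []) (tapes [] (enc (f z)).code [] [] [])
      (T z.reverse) := by simpa [Does] using h₂
    obtain ⟨t, ht, h⟩ := h₀.seq (h₁.seq (h₂'.seq (writeBool_run (f z))))
    have e₀ : tapes z [] [] [] [] =
        Function.update (fun _ => [] : ∀ k, List (Sym (Γ' ⊕ Bool) k)) none z := by
      funext k; rcases k with _ | (_ | _ | _ | _) <;> simp [tapes]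
    have e₁ : tapes ([] : List (Γ' ⊕ Bool)) [f z] [] [] [] =
        Function.update (fun _ => [] : ∀ k, List (Sym (Γ' ⊕ Bool) k)) (some .main) [f z] := by
      funext k; rcases k with _ | (_ | _ | _ | _) <;> simp [tapes]
    rw [e₀, e₁] at h
    refine machine_outputs q none (some .main) h ?_
    have h₃ : T z.reverse ≤ P.eval ((M + 1) * z.length + 1) := by
      refine (hP _).trans (P.eval_mono_nat ?_)
      refine (sz_list_le (Z := M) fun a _ => ?_).trans ?_
      · exact Finset.single_le_sum (f := fun a : Γ' ⊕ Bool => sz a) (fun _ _ => Nat.zero_le _)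
          (Finset.mem_univ a)
      · rw [List.length_reverse, mul_comm]
    simp only [Polynomial.eval_add, Polynomial.eval_mul, Polynomial.eval_C, Polynomial.eval_X,
      Polynomial.eval_comp]
    have h₄ : z.length * (∑ a : Γ' ⊕ Bool, sz a + 3) = (M + 3) * z.length := mul_comm _ _
    omega
  let C : Turing.TM2ComputableAux (Γ' ⊕ Bool) Bool :=
    ⟨q.machine none (some .main), Equiv.refl _, Equiv.refl _⟩
  refine ⟨⟨C, Polynomial.C (M + 3) * .X + P.comp (.C (M + 1) * .X + .C 1) + .C 7, fun a => ?_⟩⟩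
  have h := (key (a.1.map .inl ++ a.2.map .inr)).some
  have e : List.map C.inputAlphabet.invFun
      ((encodingProd (encodingList Γ') (encodingList Bool)).encode a) =
      a.1.map .inl ++ a.2.map .inr := List.map_id _
  rw [e]
  exact h

end

section

/-! ### The game on boards of exponents -/

/-- One step of merging a line; the state consists of the tiles already settled, in reverse order,
and of a tile that may still merge. -/
def mergeStep (s : List ℕ × Option ℕ) (a : ℕ) : List ℕ × Option ℕ :=
  s.2.elim (s.1, some a) fun p => if p = a then ((p + 1) :: s.1, none) else (p :: s.1, some a)

/-- The effect of `mergeTiles` on the exponents of powers of two. -/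
def mergeExps (l : List ℕ) : List ℕ :=
  ((l.foldl mergeStep ([], none)).2.toList ++ (l.foldl mergeStep ([], none)).1).reverse

/-- Boards of exponents, as lists of columns. -/
abbrev ExpBoard : Type := List (List (Option ℕ))

def cellOf (E : ExpBoard) (x y : ℕ) : Option ℕ := ((E[x]?.getD [])[y]?).getD none

def tabulate {γ : Type} (b : ℕ) (g : ℕ → ℕ → γ) : List (List γ) :=
  (List.range b).map fun x => (List.range b).map fun y => g x y

def mirror (b : ℕ) (r : Bool) (i : ℕ) : ℕ := if r = true then b - 1 - i else i

/-- The effect of a move. A direction is given by whether it is vertical, and by whether the wall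
is on the far side. -/
def slideExps (b : ℕ) (d : Bool × Bool) (E : ExpBoard) : ExpBoard :=
  tabulate b fun x y =>
    (mergeExps ((List.range b).map fun i => if d.1 = true then cellOf E x (mirror b d.2 i)
      else cellOf E (mirror b d.2 i) y).reduceOption)[mirror b d.2 (if d.1 = true then y else x)]?

/-- The first empty cell from the cell `a` on. -/
def firstEmpty (b : ℕ) (a : ℕ × ℕ) (E : ExpBoard) : Option (ℕ × ℕ) :=
  let l := (tabulate b fun x y => (x, y)).flatten.filter fun p => decide (cellOf E p.1 p.2 = none)
  ((l.filter fun p => decide (a.1 < p.1 ∨ a.1 = p.1 ∧ a.2 ≤ p.2)) ++ l).head?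

def turnExps (b : ℕ) (d : Bool × Bool) (s : ExpBoard × List (ℕ × ℕ)) : ExpBoard × List (ℕ × ℕ) :=
  if slideExps b d s.1 = s.1 then s
  else (firstEmpty b (s.2.head?.getD (0, 0)) (slideExps b d s.1)).elim s fun p =>
    (tabulate b fun x y => if x = p.1 ∧ y = p.2 then some 1 else cellOf (slideExps b d s.1) x y,
      s.2.tail)

/-- The directions in cyclic order. -/
def rotate (d : Bool × Bool) : Bool × Bool := if d.2 = true then (!d.1, false) else (d.1, true)

/-- Rotate the current direction, or move in the current direction. -/
def simStep (b : ℕ) (s : (Bool × Bool) × ExpBoard × List (ℕ × ℕ)) (c : Bool) :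
    (Bool × Bool) × ExpBoard × List (ℕ × ℕ) :=
  if c = true then (s.1, turnExps b s.1 s.2) else (rotate s.1, s.2)

def simulate (b : ℕ) (s : ExpBoard × List (ℕ × ℕ)) (w : List Bool) : ExpBoard × List (ℕ × ℕ) :=
  (w.foldl (simStep b) ((false, false), s)).2

/-! ### Polynomial time of a single turn -/

section polytime

variable {α β γ : Type} [Enc α] [Enc β] [Enc γ]

attribute [fun_prop] PolyTime.option_elim

theorem polyTime_mergeStep :
    PolyTime fun p : (List ℕ × Option ℕ) × ℕ => mergeStep p.1 p.2 := by
  unfold mergeStep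
  fun_prop

@[fun_prop]
theorem PolyTime.mergeExps {l : α → List ℕ} (hl : PolyTime l) :
    PolyTime fun x => mergeExps (l x) := by
  have := PolyTime.foldl_of_le (f := fun _ s a => mergeStep s a) (i := fun _ => ([], none))
    (g := fun p : α × ℕ => sz p.2 + 10)
    (polyTime_mergeStep.comp (f := fun p : α × (List ℕ × Option ℕ) × ℕ => p.2) (by fun_prop)) hl
    (by fun_prop) ((PolyTime.snd PolyTime.id').bounded.add (.const _)) fun x s a => by
      rcases s with ⟨s, _ | p⟩
      · simp only [mergeStep, sz_pair, Option.elim, sz_none, sz_some]; omega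
      · simp only [mergeStep, Option.elim]
        split <;> simp only [sz_pair, sz_none, sz_some, sz_cons, sz_nat] <;> omega
  unfold Make2048.mergeExps
  fun_prop

@[fun_prop]
theorem PolyTime.cellOf {E : α → ExpBoard} {f g : α → ℕ} (hE : PolyTime E) (hf : PolyTime f)
    (hg : PolyTime g) : PolyTime fun x => cellOf (E x) (f x) (g x) := by
  unfold Make2048.cellOf
  fun_prop

@[fun_prop]
theorem PolyTime.mirror {r : α → Bool} {f g : α → ℕ} (hf : PolyTime f) (hr : PolyTime r)
    (hg : PolyTime g) : PolyTime fun x => mirror (f x) (r x) (g x) := by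
  unfold Make2048.mirror
  fun_prop

@[fun_prop]
theorem PolyTime.tabulate {b : α → ℕ} {g : α → ℕ → ℕ → γ} (hb : PolyTime b)
    (hg : PolyTime fun p : α × ℕ × ℕ => g p.1 p.2.1 p.2.2) :
    PolyTime fun x => tabulate (b x) (g x) := by
  refine PolyTime.map (PolyTime.map ?_ (by fun_prop)) (by fun_prop)
  exact hg.comp (f := fun p : (α × ℕ) × ℕ => (p.1.1, p.1.2, p.2)) (by fun_prop)

@[fun_prop]
theorem PolyTime.slideExps {b : α → ℕ} {d : α → Bool × Bool} {E : α → ExpBoard}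
    (hb : PolyTime b) (hd : PolyTime d) (hE : PolyTime E) :
    PolyTime fun x => slideExps (b x) (d x) (E x) := by
  unfold Make2048.slideExps
  fun_prop

@[fun_prop]
theorem PolyTime.firstEmpty {b : α → ℕ} {d : α → ℕ × ℕ} {E : α → ExpBoard}
    (hb : PolyTime b) (hd : PolyTime d) (hE : PolyTime E) :
    PolyTime fun x => firstEmpty (b x) (d x) (E x) := by
  unfold Make2048.firstEmpty
  fun_prop

@[fun_prop]
theorem PolyTime.turnExps {b : α → ℕ} {d : α → Bool × Bool} {s : α → ExpBoard × List (ℕ × ℕ)}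
    (hb : PolyTime b) (hd : PolyTime d) (hs : PolyTime s) :
    PolyTime fun x => turnExps (b x) (d x) (s x) := by
  unfold Make2048.turnExps
  fun_prop

end polytime

end

section

/-! ### Polynomial time of a whole play -/

section simulate

variable {α : Type} [Enc α]

/-- The board has at most `Z` columns of at most `Z` cells, and no exponent exceeds `M`. -/
def BoardLE (Z M : ℕ) (E : ExpBoard) : Prop :=
  E.length ≤ Z ∧ ∀ r ∈ E, r.length ≤ Z ∧ ∀ o ∈ r, ∀ v ∈ o, v ≤ M

theorem BoardLE.mono {Z M M' : ℕ} {E : ExpBoard} (h : BoardLE Z M E) (hM : M ≤ M') :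
    BoardLE Z M' E :=
  ⟨h.1, fun r hr => ⟨(h.2 r hr).1, fun o ho v hv => ((h.2 r hr).2 o ho v hv).trans hM⟩⟩

theorem BoardLE.sz_le {Z M : ℕ} {E : ExpBoard} (h : BoardLE Z M E) :
    sz E ≤ Z * (Z * (2 * M + 4) + 2) + 1 := by
  refine (sz_list_le (Z := Z * (2 * M + 4) + 1) fun r hr => ?_).trans ?_
  · refine (sz_list_le (Z := 2 * M + 3) fun o ho => ?_).trans ?_
    · cases o with
      | none => simp [sz_none]
      | some v =>
        have := (h.2 r hr).2 _ ho v rfl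
        rw [sz_some, sz_nat]; omega
    · gcongr
      exact (h.2 r hr).1
  · gcongr
    exact h.1

theorem boardLE_sz (E : ExpBoard) : BoardLE (sz E) (sz E) E := by
  refine ⟨?_, fun r hr => ⟨?_, fun o ho v hv => ?_⟩⟩
  · have := length_le_sz E; omega
  · have := length_le_sz r; have := sz_mem_le hr; omega
  · have h₁ := sz_mem_le hr
    have h₂ := sz_mem_le ho
    obtain rfl : o = some v := hv
    rw [sz_some, sz_nat] at h₂
    omega

theorem BoardLE.cellOf_le {Z M : ℕ} {E : ExpBoard} (h : BoardLE Z M E) {x y v : ℕ}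
    (hv : cellOf E x y = some v) : v ≤ M := by
  unfold cellOf at hv
  cases hr : E[x]? with
  | none => simp [hr] at hv
  | some r =>
    simp only [hr, Option.getD_some] at hv
    cases ho : r[y]? with
    | none => simp [ho] at hv
    | some o =>
      simp only [ho, Option.getD_some] at hv
      exact (h.2 r (List.mem_of_getElem? hr)).2 o (List.mem_of_getElem? ho) v hv

theorem mergeExps_le {M : ℕ} {l : List ℕ} (h : ∀ a ∈ l, a ≤ M) : ∀ v ∈ mergeExps l, v ≤ M + 1 := by
  -- The pending tile has not merged yet, so it still satisfies the bound `M`; only settled tiles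
  -- may reach `M + 1`.
  have key : ∀ (l : List ℕ) (s : List ℕ × Option ℕ), (∀ a ∈ l, a ≤ M) → (∀ v ∈ s.1, v ≤ M + 1) →
      (∀ v ∈ s.2, v ≤ M) → (∀ v ∈ (l.foldl mergeStep s).1, v ≤ M + 1) ∧
        ∀ v ∈ (l.foldl mergeStep s).2, v ≤ M := by
    intro l
    induction l with
    | nil => intro s _ h₁ h₂; exact ⟨h₁, h₂⟩
    | cons a l ih =>
      intro s h h₁ h₂
      have ha := h a (by simp)
      refine ih _ (fun a ha => h a (by simp [ha])) ?_ ?_ <;>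
      · rcases s with ⟨s, _ | p⟩
        · simpa [mergeStep] using by first | exact h₁ | exact ha
        · have hp := h₂ p rfl
          simp only [mergeStep, Option.elim]
          split <;> simp <;> grind
  obtain ⟨h₁, h₂⟩ := key l ([], none) h (by simp) (by simp)
  intro v hv
  simp only [mergeExps, List.mem_reverse, List.mem_append, Option.mem_toList] at hv
  rcases hv with hv | hv
  · exact (h₂ v hv).trans (Nat.le_succ _)
  · exact h₁ v hv

theorem boardLE_tabulate {b Z M : ℕ} (hb : b ≤ Z) {g : ℕ → ℕ → Option ℕ}
    (hg : ∀ x y v, g x y = some v → v ≤ M) : BoardLE Z M (tabulate b g) := by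
  refine ⟨by simpa [tabulate] using hb, fun r hr => ?_⟩
  simp only [tabulate, List.mem_map] at hr
  obtain ⟨x, -, rfl⟩ := hr
  refine ⟨by simpa using hb, fun o ho v hv => ?_⟩
  simp only [List.mem_map] at ho
  obtain ⟨y, -, rfl⟩ := ho
  exact hg x y v hv

theorem BoardLE.slideExps {b Z M : ℕ} (hb : b ≤ Z) {E : ExpBoard} (h : BoardLE Z M E)
    (d : Bool × Bool) : BoardLE Z (M + 1) (slideExps b d E) := by
  refine boardLE_tabulate hb fun x y v hv => ?_
  refine mergeExps_le (fun a ha => ?_) v (List.mem_of_getElem? hv)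
  rw [List.reduceOption_mem_iff, List.mem_map] at ha
  obtain ⟨i, -, hi⟩ := ha
  split at hi
  · exact h.cellOf_le hi
  · exact h.cellOf_le hi

theorem BoardLE.turnExps {b Z M : ℕ} (hb : b ≤ Z) {s : ExpBoard × List (ℕ × ℕ)}
    (h : BoardLE Z M s.1) (d : Bool × Bool) :
    BoardLE Z (M + 1) (turnExps b d s).1 ∧ sz (turnExps b d s).2 ≤ sz s.2 := by
  unfold Make2048.turnExps
  split
  · exact ⟨h.mono (Nat.le_succ _), le_rfl⟩
  · cases firstEmpty b (s.2.head?.getD (0, 0)) (Make2048.slideExps b d s.1) with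
    | none => exact ⟨h.mono (Nat.le_succ _), le_rfl⟩
    | some p =>
      refine ⟨boardLE_tabulate hb fun x y v hv => ?_, ?_⟩
      · split at hv
        · simp at hv; omega
        · exact (h.slideExps hb d).cellOf_le hv
      · rcases s with ⟨E, _ | ⟨a, S⟩⟩
        · exact le_rfl
        · simp only [Option.elim, List.tail_cons, sz_cons]; omega

/-- A turn raises the largest exponent by at most one, although it may double the value. This is why
the simulated board stores exponents, which stay small even in unary. -/
theorem simStep_foldl_le {b Z : ℕ} (hb : b ≤ Z) (w : List Bool)
    (s : (Bool × Bool) × ExpBoard × List (ℕ × ℕ)) {M : ℕ} (h : BoardLE Z M s.2.1) :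
    BoardLE Z (M + w.length) (w.foldl (simStep b) s).2.1 ∧
      sz (w.foldl (simStep b) s).2.2 ≤ sz s.2.2 := by
  induction w generalizing s M with
  | nil => exact ⟨h, le_rfl⟩
  | cons c w ih =>
    have h₁ : BoardLE Z (M + 1) (simStep b s c).2.1 ∧ sz (simStep b s c).2.2 ≤ sz s.2.2 := by
      unfold simStep
      split
      · exact h.turnExps hb _
      · exact ⟨h.mono (Nat.le_succ _), le_rfl⟩
    have h₂ := ih _ h₁.1
    rw [List.length_cons, List.foldl_cons]
    refine ⟨h₂.1.mono (by omega), h₂.2.trans h₁.2⟩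

theorem polyTime_simStep :
    PolyTime fun p : ℕ × ((Bool × Bool) × ExpBoard × List (ℕ × ℕ)) × Bool =>
      simStep p.1 p.2.1 p.2.2 := by
  unfold simStep rotate
  fun_prop

-- A turn rewrites the entire board, so `foldl_of_le` does not apply directly; the partial results
-- are bounded through the dimensions of the board and its exponents, which are at most the initial
-- size plus the number of steps.
@[fun_prop]
theorem PolyTime.simulate {b : α → ℕ} {s : α → ExpBoard × List (ℕ × ℕ)} {w : α → List Bool}
    (hb : PolyTime b) (hs : PolyTime s) (hw : PolyTime w) :
    PolyTime fun x => simulate (b x) (s x) (w x) := by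
  have h : PolyBounded fun x => sz (b x) + sz (s x).1 + sz (w x) :=
    (hb.bounded.add hs.fst.bounded).add hw.bounded
  refine PolyTime.snd (PolyTime.foldl (f := fun x s c => simStep (b x) s c)
    (i := fun x => ((false, false), s x))
    (Z := fun x => 7 + ((sz (b x) + sz (s x).1 + sz (w x)) *
      ((sz (b x) + sz (s x).1 + sz (w x)) * (2 * (sz (b x) + sz (s x).1 + sz (w x)) + 4) + 2) + 1 +
      sz (s x).2 + 1) + 1) ?_ hw (by fun_prop) ?_ fun x m hm => ?_)
  · exact polyTime_simStep.comp (f := fun p : α × ((Bool × Bool) × ExpBoard × List (ℕ × ℕ)) × Bool =>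
      (b p.1, p.2.1, p.2.2)) (by fun_prop)
  · exact ((PolyBounded.const 7).add ((((h.mul ((h.mul (((PolyBounded.const 2).mul h).add
      (.const 4))).add (.const 2))).add (.const 1)).add hs.snd.bounded).add (.const 1))).add
      (.const 1)
  · have hbz : b x ≤ sz (b x) := by rw [sz_nat]; omega
    have hE := boardLE_sz (s x).1
    have h₀ : BoardLE (sz (b x) + sz (s x).1 + sz (w x)) (sz (s x).1) (s x).1 :=
      ⟨hE.1.trans (by omega), fun r hr => ⟨(hE.2 r hr).1.trans (by omega), (hE.2 r hr).2⟩⟩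
    obtain ⟨h₁, h₂⟩ := simStep_foldl_le (b := b x) (by omega) m ((false, false), s x) h₀
    have h₃ := hm.length_le
    have h₄ := length_le_sz (w x)
    have h₅ := (h₁.mono (M' := sz (b x) + sz (s x).1 + sz (w x)) (by omega)).sz_le
    have h₆ : ∀ d : Bool × Bool, sz d ≤ 7 := fun d => by
      have h₇ := sz_bool d.1
      have h₈ := sz_bool d.2
      rw [sz_pair]; omega
    have h₉ := h₆ (m.foldl (fun s c => simStep (b x) s c) ((false, false), s x)).1
    rw [sz_pair]
    exact Nat.succ_le_succ (add_le_add h₉ (Nat.succ_le_succ (add_le_add h₅ h₂)))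

end simulate

end

section

/-! ### Binary numbers -/

/-- The number with the given binary digits, starting with the least significant one. -/
def bitsVal : List Bool → ℕ
  | [] => 0
  | c :: l => 2 * bitsVal l + c.toNat

/-- There is no leading zero. -/
def canonical (l : List Bool) : Bool := decide (l = []) || decide (l.reverse.head? = some true)

/-- Comparison of binary numbers. -/
def ltBits (l m : List Bool) : Bool :=
  (List.range (l.length + m.length)).foldl
    (fun r i => if l[i]?.getD false = m[i]?.getD false then r else m[i]?.getD false) false

/-- The number with the given binary digits, or `M` if it is smaller. -/
def clamp (M : ℕ) (l : List Bool) : ℕ :=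
  l.reverse.foldl (fun v c => if 2 * v + (if c = true then 1 else 0) ≤ M then
    2 * v + (if c = true then 1 else 0) else M) 0

/-- The number is a power of two other than `1`. -/
def isPow (l : List Bool) : Bool :=
  decide (l.reverse.head? = some true) && l.reverse.tail.all (fun c => !c) && decide (2 ≤ l.length)

theorem canonical_of_cons {c : Bool} {l : List Bool} (h : canonical (c :: l) = true) :
    canonical l = true := by
  rcases l.eq_nil_or_concat with rfl | ⟨l, d, rfl⟩
  · rfl
  · simpa [canonical] using h

theorem eq_nil_of_bitsVal : ∀ {l : List Bool}, canonical l = true → bitsVal l = 0 → l = []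
  | [], _, _ => rfl
  | c :: l, h, h₀ => by
    simp only [bitsVal] at h₀
    have h₁ := eq_nil_of_bitsVal (canonical_of_cons h) (by omega)
    subst h₁
    cases c
    · simp [canonical] at h
    · simp at h₀

theorem bitsVal_inj : ∀ {l m : List Bool}, canonical l = true → canonical m = true →
    bitsVal l = bitsVal m → l = m
  | [], m, _, hm, h => (eq_nil_of_bitsVal hm h.symm).symm
  | c :: l, [], hl, _, h => eq_nil_of_bitsVal hl h
  | c :: l, d :: m, hl, hm, h => by
    simp only [bitsVal] at h
    have h₁ : bitsVal l = bitsVal m := by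
      have := c.toNat_le; have := d.toNat_le; omega
    have h₂ : c = d := by
      rw [h₁] at h; cases c <;> cases d <;> simp_all
    rw [h₂, bitsVal_inj (canonical_of_cons hl) (canonical_of_cons hm) h₁]

theorem bitsVal_encodeNat (n : ℕ) : bitsVal (encodeNat n) = n := by
  have h : ∀ p : PosNum, bitsVal (encodePosNum p) = p := by
    intro p
    induction p with
    | one => rfl
    | bit0 p ih => simp [encodePosNum, bitsVal, ih]; omega
    | bit1 p ih => simp [encodePosNum, bitsVal, ih]; omega
  have h' : ∀ m : Num, bitsVal (encodeNum m) = m := by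
    rintro (_ | p)
    · rfl
    · exact h p
  rw [encodeNat, h', Num.to_of_nat]

theorem canonical_encodeNat (n : ℕ) : canonical (encodeNat n) = true := by
  have h : ∀ p : PosNum, (encodePosNum p).reverse.head? = some true := by
    intro p
    induction p with
    | one => rfl
    | bit0 p ih => simp only [encodePosNum, List.reverse_cons, List.head?_append, ih]; rfl
    | bit1 p ih => simp only [encodePosNum, List.reverse_cons, List.head?_append, ih]; rfl
  have h' : ∀ m : Num, canonical (encodeNum m) = true := by
    rintro (_ | p)
    · rfl
    · simp [canonical, encodeNum, h p]
  exact h' _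

theorem encodeNat_bitsVal {l : List Bool} (h : canonical l = true) : encodeNat (bitsVal l) = l :=
  bitsVal_inj (canonical_encodeNat _) h (bitsVal_encodeNat _)

theorem testBit_bitsVal (l : List Bool) (i : ℕ) : (bitsVal l).testBit i = l[i]?.getD false := by
  induction l generalizing i with
  | nil => simp [bitsVal]
  | cons c l ih =>
    have h : bitsVal (c :: l) = Nat.bit c (bitsVal l) := by
      cases c <;> simp [bitsVal, Nat.bit]
    cases i with
    | zero => rw [h, Nat.testBit_bit_zero]; rfl
    | succ i => rw [h, Nat.testBit_bit_succ, ih]; rfl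

theorem bitsVal_lt (l : List Bool) : bitsVal l < 2 ^ l.length := by
  induction l with
  | nil => simp [bitsVal]
  | cons c l ih =>
    have := c.toNat_le
    simp only [bitsVal, List.length_cons, pow_succ]
    omega

/-- The digits are scanned from the least significant one, and a later difference overrides the
earlier verdict. After `k` positions the residues modulo `2 ^ k` have been compared. -/
theorem ltBits_eq (l m : List Bool) : ltBits l m = decide (bitsVal l < bitsVal m) := by
  have key : ∀ k, (List.range k).foldl
      (fun r i => if l[i]?.getD false = m[i]?.getD false then r else m[i]?.getD false) false =
        decide (bitsVal l % 2 ^ k < bitsVal m % 2 ^ k) := by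
    intro k
    induction k with
    | zero => simp [Nat.mod_one]
    | succ k ih =>
      rw [List.range_succ, List.foldl_append, ih]
      simp only [List.foldl_cons, List.foldl_nil, ← testBit_bitsVal]
      have h₀ (n : ℕ) : n % 2 ^ (k + 1) = 2 ^ k * (n.testBit k).toNat + n % 2 ^ k := by
        rw [Nat.mod_pow_succ, Nat.add_comm, Nat.toNat_testBit]
      have h₁ := h₀ (bitsVal l)
      have h₂ := h₀ (bitsVal m)
      have h₃ := Nat.mod_lt (bitsVal l) (Nat.two_pow_pos k)
      have h₄ := Nat.mod_lt (bitsVal m) (Nat.two_pow_pos k)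
      rw [h₁, h₂]
      cases (bitsVal l).testBit k <;> cases (bitsVal m).testBit k <;> simp <;> omega
  rw [ltBits, key]
  have h : ∀ {n : List Bool}, n.length ≤ l.length + m.length →
      bitsVal n % 2 ^ (l.length + m.length) = bitsVal n := fun {n} hn =>
    Nat.mod_eq_of_lt ((bitsVal_lt n).trans_le (Nat.pow_le_pow_right (by omega) hn))
  rw [h (by omega), h (by omega)]

/-- Truncation in every Horner step does no harm, since a value that has reached `M` never falls
below `M` again. It keeps the intermediate unary numbers small. -/
theorem clamp_eq (M : ℕ) (l : List Bool) : clamp M l = min (bitsVal l) M := by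
  rw [clamp, List.foldl_reverse]
  induction l with
  | nil => simp [bitsVal]
  | cons c l ih =>
    rw [List.foldr_cons, ih, bitsVal]
    cases c <;> simp <;> split <;> omega

theorem isPow_iff (l : List Bool) :
    isPow l = true ↔ ∃ k, 1 ≤ k ∧ l = List.replicate k false ++ [true] := by
  constructor
  · intro h
    simp only [isPow, Bool.and_eq_true, decide_eq_true_eq, List.all_eq_true,
      Bool.not_eq_eq_eq_not, Bool.not_true] at h
    obtain ⟨⟨h₁, h₂⟩, h₃⟩ := h
    rcases l.eq_nil_or_concat with rfl | ⟨m, d, rfl⟩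
    · simp at h₁
    · simp only [List.concat_eq_append, List.reverse_append, List.reverse_cons, List.reverse_nil,
        List.nil_append, List.singleton_append, List.head?_cons, Option.some.injEq, List.tail_cons,
        List.mem_reverse, List.length_append, List.length_singleton] at h₁ h₂ h₃
      exact ⟨m.length, by omega, by rw [h₁, ← List.eq_replicate_of_mem h₂]; simp⟩
  · rintro ⟨k, hk, rfl⟩
    simp [isPow, hk]

theorem bitsVal_pow (k : ℕ) : bitsVal (List.replicate k false ++ [true]) = 2 ^ k := by
  induction k with
  | zero => rfl
  | succ k ih => simp [List.replicate_succ, bitsVal, ih, pow_succ, mul_comm]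

theorem encodeNat_two_pow (k : ℕ) : encodeNat (2 ^ k) = List.replicate k false ++ [true] := by
  refine bitsVal_inj (canonical_encodeNat _) ?_ (by rw [bitsVal_encodeNat, bitsVal_pow])
  simp [canonical]

/-! ### The verifier -/

/-- The word of an entry, given by the digits of its numbers. -/
def entryWord (e : List (List Bool)) : List Γ' :=
  Γ'.bra :: ((e.flatMap fun n => Γ'.comma :: n.map Γ'.bit).tail ++ [Γ'.ket])

/-- The word of a board side and a list of entries. -/
def inputWord (p : List Bool) (es : List (List (List Bool))) : List Γ' :=
  p.map Γ'.bit ++ es.flatMap entryWord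

/-- The state consists of the digits of the current number, of the later numbers of the current
entry, and of the later entries. -/
def parseStep (s : List Bool × List (List Bool) × List (List (List Bool))) (a : Γ') :
    List Bool × List (List Bool) × List (List (List Bool)) :=
  if a = .bit true then (true :: s.1, s.2)
  else if a = .bit false then (false :: s.1, s.2)
  else if a = .ket then ([], [], s.2.2)
  else if a = .comma then ([], s.1 :: s.2.1, s.2.2)
  else if a = .bra then ([], [], (s.1 :: s.2.1) :: s.2.2)
  else s

/-- Read a word from the right. -/
def parse (u : List Γ') : List Bool × List (List Bool) × List (List (List Bool)) :=
  u.reverse.foldl parseStep ([], [], [])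

def entriesOfLength (k : ℕ) (es : List (List (List Bool))) : List (List (List Bool)) :=
  es.filter fun e => decide (e.length = k)

/-- A number of an entry. -/
def digits (e : List (List Bool)) (i : ℕ) : List Bool := e[i]?.getD []

/-- The parsed word is that of a valid input. -/
def wellFormed (loc : Bool) (u : List Γ') (p : List Bool) (es : List (List (List Bool))) : Bool :=
  decide (inputWord p es = u) && decide (es = entriesOfLength 3 es ++ entriesOfLength 2 es) &&
  canonical p && (es.all fun e => e.all canonical) &&
  (es.all fun e => ltBits (digits e 0) p && ltBits (digits e 1) p) &&
  ((entriesOfLength 3 es).all fun e => isPow (digits e 2)) &&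
  ((List.range (entriesOfLength 3 es).length).all fun i =>
    ((entriesOfLength 3 es).drop (i + 1)).all fun e =>
      !decide (((entriesOfLength 3 es)[i]?.getD []).take 2 = e.take 2)) &&
  (loc || decide (entriesOfLength 2 es = []))

def initialBoard (M b : ℕ) (L : List (List (List Bool))) : ExpBoard :=
  tabulate b fun x y => ((L.filter fun e => decide (clamp M (digits e 0) = x) &&
    decide (clamp M (digits e 1) = y)).map fun e => (digits e 2).length - 1).head?

def hasExp (c b : ℕ) (E : ExpBoard) : Bool :=
  (tabulate b fun x y => cellOf E x y).flatten.any fun o => decide (o = some c)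

/-- On a large board accept if there is a tile at all; otherwise play the moves given by the
certificate. -/
def accepts (c M : ℕ) (p : List Bool) (es : List (List (List Bool))) (w : List Bool) : Bool :=
  if clamp M p = M then !(entriesOfLength 3 es).isEmpty
  else hasExp c (clamp M p) (simulate (clamp M p)
    (initialBoard M (clamp M p) (entriesOfLength 3 es),
      (entriesOfLength 2 es).map fun e => (clamp M (digits e 0), clamp M (digits e 1))) w).1

def verify (loc : Bool) (c : ℕ) (u : List Γ') (w : List Bool) : Bool :=
  wellFormed loc u (parse u).1 (parse u).2.2 &&
    accepts c (u.length + 2 * c + 8) (parse u).1 (parse u).2.2 w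

/-! ### Polynomial time of the verifier -/

section polytime

variable {α β γ : Type} [Enc α] [Enc β] [Enc γ]

/-- A nested case distinction over the finitely many arguments. -/
theorem PolyTime.of_finite [Fintype α] [Inhabited β] (f : α → β) : PolyTime f := by
  classical
  have h : ∀ l : List α, ∃ g : α → β, PolyTime g ∧ ∀ x ∈ l, g x = f x := by
    intro l
    induction l with
    | nil => exact ⟨fun _ => default, const _, by simp⟩
    | cons a l ih =>
      obtain ⟨g, hg, h⟩ := ih
      refine ⟨fun x => if x = a then f a else g x, by fun_prop, fun x hx => ?_⟩
      dsimp only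
      split_ifs with hxa
      · rw [hxa]
      · exact h x ((List.mem_cons.1 hx).resolve_left hxa)
  obtain ⟨g, hg, h⟩ := h Finset.univ.toList
  rwa [show f = g from funext fun x => (h x (by simp)).symm]

@[fun_prop]
theorem PolyTime.bit {f : α → Bool} (hf : PolyTime f) : PolyTime fun x => Γ'.bit (f x) :=
  (of_finite Γ'.bit).comp hf

@[fun_prop]
theorem PolyTime.take_two {l : α → List β} (hl : PolyTime l) : PolyTime fun x => (l x).take 2 := by
  have : PolyTime fun x => (l x).head?.toList ++ (l x).tail.head?.toList := by fun_prop
  exact this.of_enc fun x => by rcases l x with _ | ⟨a, _ | ⟨b, m⟩⟩ <;> rfl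

@[fun_prop]
theorem PolyTime.canonical {l : α → List Bool} (hl : PolyTime l) :
    PolyTime fun x => canonical (l x) := by
  unfold Make2048.canonical
  fun_prop

@[fun_prop]
theorem PolyTime.ltBits {l m : α → List Bool} (hl : PolyTime l) (hm : PolyTime m) :
    PolyTime fun x => ltBits (l x) (m x) := by
  refine PolyTime.foldl_of_le (f := fun x r i => if (l x)[i]?.getD false = (m x)[i]?.getD false
    then r else (m x)[i]?.getD false) (i := fun _ => false) (g := fun _ => 3) (by fun_prop)
    (by fun_prop) (by fun_prop) (.const _) fun x r i => ?_
  exact (sz_bool _).trans (by omega)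

@[fun_prop]
theorem PolyTime.clamp {M : α → ℕ} {l : α → List Bool} (hM : PolyTime M) (hl : PolyTime l) :
    PolyTime fun x => clamp (M x) (l x) := by
  refine PolyTime.foldl_of_le (f := fun x v (c : Bool) =>
    if 2 * v + (if c = true then 1 else 0) ≤ M x then 2 * v + (if c = true then 1 else 0) else M x)
    (i := fun _ => 0) (g := fun p => sz (M p.1)) (by fun_prop)
    (by fun_prop) (by fun_prop) ((hM.comp (PolyTime.fst id')).bounded) fun x r i => ?_
  simp only [sz_nat]
  split_ifs <;> omega

@[fun_prop]
theorem PolyTime.isPow {l : α → List Bool} (hl : PolyTime l) : PolyTime fun x => isPow (l x) := by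
  unfold Make2048.isPow
  fun_prop

@[fun_prop]
theorem PolyTime.inputWord {p : α → List Bool} {es : α → List (List (List Bool))}
    (hp : PolyTime p) (hes : PolyTime es) : PolyTime fun x => inputWord (p x) (es x) := by
  unfold Make2048.inputWord entryWord
  fun_prop

theorem polyTime_parseStep : PolyTime fun p : (List Bool × List (List Bool) ×
    List (List (List Bool))) × Γ' => parseStep p.1 p.2 := by
  unfold parseStep
  fun_prop

@[fun_prop]
theorem PolyTime.parse {u : α → List Γ'} (hu : PolyTime u) : PolyTime fun x => parse (u x) := by
  refine PolyTime.foldl_of_le (f := fun _ s a => parseStep s a) (i := fun _ => ([], [], []))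
    (g := fun _ => 10)
    (polyTime_parseStep.comp (f := fun p : α × (List Bool × List (List Bool) ×
      List (List (List Bool))) × Γ' => p.2) (by fun_prop)) (by fun_prop) (by fun_prop)
    (.const _) fun x s a => ?_
  have h₁ : ∀ b : Bool, sz b ≤ 3 := sz_bool
  have h₂ := sz_pos s.1
  have h₃ := sz_pos s.2.1
  unfold parseStep
  split_ifs <;> simp only [sz_pair, sz_cons, sz_nil] <;>
    first | omega | (have := h₁ true; omega) | (have := h₁ false; omega)

@[fun_prop]
theorem PolyTime.entriesOfLength {k : ℕ} {es : α → List (List (List Bool))} (hes : PolyTime es) :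
    PolyTime fun x => entriesOfLength k (es x) := by
  unfold Make2048.entriesOfLength
  fun_prop

@[fun_prop]
theorem PolyTime.digits {e : α → List (List Bool)} {i : ℕ} (he : PolyTime e) :
    PolyTime fun x => digits (e x) i := by
  unfold Make2048.digits
  fun_prop

@[fun_prop]
theorem PolyTime.wellFormed {loc : Bool} {u : α → List Γ'} {p : α → List Bool}
    {es : α → List (List (List Bool))} (hu : PolyTime u) (hp : PolyTime p) (hes : PolyTime es) :
    PolyTime fun x => wellFormed loc (u x) (p x) (es x) := by
  unfold Make2048.wellFormed
  fun_prop

@[fun_prop]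
theorem PolyTime.initialBoard {M b : α → ℕ} {L : α → List (List (List Bool))} (hM : PolyTime M)
    (hb : PolyTime b) (hL : PolyTime L) :
    PolyTime fun x => initialBoard (M x) (b x) (L x) := by
  unfold Make2048.initialBoard
  fun_prop

@[fun_prop]
theorem PolyTime.hasExp {c : ℕ} {b : α → ℕ} {E : α → ExpBoard} (hb : PolyTime b)
    (hE : PolyTime E) : PolyTime fun x => hasExp c (b x) (E x) := by
  unfold Make2048.hasExp
  fun_prop

@[fun_prop]
theorem PolyTime.accepts {c : ℕ} {M : α → ℕ} {p w : α → List Bool}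
    {es : α → List (List (List Bool))} (hM : PolyTime M) (hp : PolyTime p) (hes : PolyTime es)
    (hw : PolyTime w) : PolyTime fun x => accepts c (M x) (p x) (es x) (w x) := by
  unfold Make2048.accepts
  fun_prop

/-- Instance and certificate arrive as one word over the disjoint union of their alphabets and are
separated by filtering the letters. -/
theorem polyTime_verify (loc : Bool) (c : ℕ) : PolyTime fun z : List (Γ' ⊕ Bool) =>
    verify loc c (z.map Sum.getLeft?).reduceOption (z.map Sum.getRight?).reduceOption := by
  have h₁ : PolyTime fun z : List (Γ' ⊕ Bool) => (z.map Sum.getLeft?).reduceOption :=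
    (PolyTime.map (f := fun _ => Sum.getLeft?)
      ((PolyTime.of_finite Sum.getLeft?).comp (.snd .id')) .id').reduceOption
  have h₂ : PolyTime fun z : List (Γ' ⊕ Bool) => (z.map Sum.getRight?).reduceOption :=
    (PolyTime.map (f := fun _ => Sum.getRight?)
      ((PolyTime.of_finite Sum.getRight?).comp (.snd .id')) .id').reduceOption
  unfold verify
  fun_prop

theorem computable_verify (loc : Bool) (c : ℕ) : Nonempty (Turing.TM2ComputableInPolyTime
    (encodingProd (encodingList Γ') (encodingList Bool)).encode encodeBool
      fun p => verify loc c p.1 p.2) := by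
  convert computable_of_polyTime (polyTime_verify loc c) using 3 with p
  all_goals
    rw [List.map_append, List.reduceOption_append]
    simp [List.reduceOption, List.filterMap_map, Function.comp_def]

end polytime

end

section

/-! ### Merging and weights -/

/-- The tiles of a line, from the wall outwards. -/
def tiles {b : ℕ} (f : Fin b → Option ℕ) : List ℕ := (List.ofFn f).reduceOption

theorem slideLine_eq {b : ℕ} (f : Fin b → Option ℕ) (i : Fin b) :
    slideLine f i = (mergeTiles (tiles f))[(i : ℕ)]? := rfl

theorem mem_tiles {b : ℕ} {f : Fin b → Option ℕ} {v : ℕ} : v ∈ tiles f ↔ ∃ i, f i = some v := by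
  simp [tiles, List.reduceOption_mem_iff, List.mem_ofFn]

theorem length_tiles_le {b : ℕ} (f : Fin b → Option ℕ) : (tiles f).length ≤ b := by
  simpa [tiles] using List.reduceOption_length_le (List.ofFn f)

theorem length_mergeTiles_le (l : List ℕ) : (mergeTiles l).length ≤ l.length := by
  induction l using mergeTiles.induct with
  | case1 => simp [mergeTiles]
  | case2 a => simp [mergeTiles]
  | case3 a l ih => simp [mergeTiles]; omega
  | case4 a a' l h ih => simp [mergeTiles, h] at ih ⊢; omega

theorem mergeTiles_ne_nil {l : List ℕ} (h : l ≠ []) : mergeTiles l ≠ [] := by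
  match l, h with
  | [a], _ => simp [mergeTiles]
  | a :: a' :: l, _ => rw [mergeTiles]; split <;> simp

theorem mem_mergeTiles {l : List ℕ} {v : ℕ} (h : v ∈ mergeTiles l) : ∃ a ∈ l, v = a ∨ v = a + a := by
  induction l using mergeTiles.induct with
  | case1 => simp [mergeTiles] at h
  | case2 a => exact ⟨a, by simp, .inl (by simpa [mergeTiles] using h)⟩
  | case3 a l ih =>
    rw [mergeTiles, if_pos rfl, List.mem_cons] at h
    rcases h with rfl | h
    · exact ⟨a, by simp, .inr rfl⟩
    · obtain ⟨a', h₁, h₂⟩ := ih h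
      exact ⟨a', by simp [h₁], h₂⟩
  | case4 a a' l hne ih =>
    rw [mergeTiles, if_neg hne, List.mem_cons] at h
    rcases h with rfl | h
    · exact ⟨v, by simp, .inl rfl⟩
    · obtain ⟨a', h₁, h₂⟩ := ih h
      exact ⟨a', List.mem_cons_of_mem _ h₁, h₂⟩

/-- The weight of a tile, not counting the tiles beyond the target. -/
def weight (T v : ℕ) : ℕ := if v < T then v else 0

/-- Two tiles `2 ^ k` below the target merge to at most the target, and the target itself is
excluded, so the sum still counts. Tiles from the target on weigh 0 before and after a merge. -/
theorem sum_weight_mergeTiles {c : ℕ} {l : List ℕ} (hl : ∀ v ∈ l, ∃ k, v = 2 ^ k)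
    (h : 2 ^ c ∉ mergeTiles l) :
    ((mergeTiles l).map (weight (2 ^ c))).sum = (l.map (weight (2 ^ c))).sum := by
  induction l using mergeTiles.induct with
  | case1 => simp [mergeTiles]
  | case2 a => simp [mergeTiles]
  | case3 a l ih =>
    rw [mergeTiles, if_pos rfl, List.mem_cons, not_or] at h
    rw [mergeTiles, if_pos rfl, List.map_cons, List.sum_cons,
      ih (fun v hv => hl v (by simp [hv])) h.2]
    simp only [List.map_cons, List.sum_cons]
    obtain ⟨k, rfl⟩ := hl a (by simp)
    have h₁ : weight (2 ^ c) (2 ^ k + 2 ^ k) = weight (2 ^ c) (2 ^ k) + weight (2 ^ c) (2 ^ k) := by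
      unfold weight
      rw [← two_mul, ← pow_succ'] at h ⊢
      by_cases hk : k < c
      · have h₂ : k + 1 < c := by
          rcases Nat.lt_or_ge (k + 1) c with h₂ | h₂
          · exact h₂
          · exact absurd (by rw [show c = k + 1 by omega]) h.1
        rw [if_pos (Nat.pow_lt_pow_right (by omega) h₂), if_pos (Nat.pow_lt_pow_right (by omega) hk),
          pow_succ]
        ring
      · rw [if_neg, if_neg]
        · exact not_lt.2 (Nat.pow_le_pow_right (by omega) (by omega))
        · exact not_lt.2 (Nat.pow_le_pow_right (by omega) (by omega))
    rw [h₁, add_assoc]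
  | case4 a a' l hne ih =>
    rw [mergeTiles, if_neg hne, List.mem_cons, not_or] at h
    rw [mergeTiles, if_neg hne, List.map_cons, List.sum_cons,
      ih (fun v hv => hl v (List.mem_cons_of_mem _ hv)) h.2]
    simp

/-- The weight of a cell. -/
def cellSum (w : ℕ → ℕ) (o : Option ℕ) : ℕ := o.elim 0 w

theorem sum_getElem? (w : ℕ → ℕ) : ∀ {n : ℕ} {m : List ℕ}, m.length ≤ n →
    ∑ i : Fin n, cellSum w m[(i : ℕ)]? = (m.map w).sum
  | 0, m, h => by simp_all
  | n + 1, [], _ => by simp [cellSum]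
  | n + 1, a :: m, h => by
    rw [Fin.sum_univ_succ]
    simp only [List.map_cons, List.sum_cons, Fin.val_zero, Fin.val_succ, List.getElem?_cons_zero,
      List.getElem?_cons_succ]
    rw [sum_getElem? w (by simpa using h)]
    rfl

theorem sum_cells_eq (w : ℕ → ℕ) {n : ℕ} (f : Fin n → Option ℕ) :
    ∑ i, cellSum w (f i) = ((tiles f).map w).sum := by
  induction n with
  | zero => simp [tiles]
  | succ n ih =>
    rw [Fin.sum_univ_succ, ih]
    cases h : f 0 <;> simp [tiles, List.ofFn_succ, h, cellSum]

theorem sum_slideLine (w : ℕ → ℕ) {n : ℕ} (f : Fin n → Option ℕ) :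
    ∑ i, cellSum w (slideLine f i) = ((mergeTiles (tiles f)).map w).sum :=
  sum_getElem? w ((length_mergeTiles_le _).trans (length_tiles_le f))

theorem mem_mergeTiles_tiles {b : ℕ} {f : Fin b → Option ℕ} {v : ℕ} :
    v ∈ mergeTiles (tiles f) ↔ ∃ i, slideLine f i = some v := by
  constructor
  · intro h
    obtain ⟨i, hi, rfl⟩ := List.mem_iff_getElem.1 h
    exact ⟨⟨i, hi.trans_le ((length_mergeTiles_le _).trans (length_tiles_le f))⟩, by
      rw [slideLine_eq, List.getElem?_eq_getElem hi]⟩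
  · rintro ⟨i, hi⟩
    exact List.mem_of_getElem? hi

/-! ### Weights of boards and the bound on the number of moves -/

variable {b : ℕ}

/-- The total weight of a board. -/
def total (w : ℕ → ℕ) (B : Board b) : ℕ := ∑ x, ∑ y, cellSum w (B x y)

/-- The lines in which a move slides the tiles. -/
theorem exists_lines (B : Board b) (d : Dir) : ∃ F : Fin b → Fin b → Option ℕ,
    (∀ w, total w B = ∑ j, ∑ i, cellSum w (F j i)) ∧
    (∀ w, total w (slide B d) = ∑ j, ∑ i, cellSum w (slideLine (F j) i)) ∧
    (∀ v, (∃ j i, F j i = some v) ↔ HasTile v B) ∧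
    (∀ v, (∃ j i, slideLine (F j) i = some v) ↔ HasTile v (slide B d)) := by
  have hrev : ∀ g : Fin b → ℕ, ∑ i : Fin b, g i.rev = ∑ i, g i := fun g =>
    Equiv.sum_comp Fin.revPerm g
  have hex : ∀ p : Fin b → Prop, (∃ i : Fin b, p i.rev) ↔ ∃ i, p i := fun p =>
    (Fin.revPerm.surjective.exists (p := p)).symm
  cases d with
  | up => exact ⟨B, fun _ => rfl, fun _ => rfl, fun _ => Iff.rfl, fun _ => Iff.rfl⟩
  | down =>
    refine ⟨fun x i => B x i.rev, fun w => ?_, fun w => ?_, fun v => ?_, fun v => ?_⟩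
    · exact Finset.sum_congr rfl fun x _ => (hrev fun i => cellSum w (B x i)).symm
    · exact Finset.sum_congr rfl fun x _ => hrev fun i => cellSum w (slideLine _ i)
    · exact exists_congr fun x => hex fun i => B x i = some v
    · exact exists_congr fun x =>
        (hex fun i => slideLine (fun i => B x i.rev) i = some v).symm
  | left =>
    refine ⟨fun y i => B i y, fun w => Finset.sum_comm, fun w => Finset.sum_comm, fun v => ?_,
      fun v => ?_⟩
    · exact exists_comm
    · exact exists_comm
  | right =>
    refine ⟨fun y i => B i.rev y, fun w => ?_, fun w => ?_, fun v => ?_, fun v => ?_⟩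
    · exact Finset.sum_comm.trans
        (Finset.sum_congr rfl fun y _ => (hrev fun i => cellSum w (B i y)).symm)
    · exact Finset.sum_comm.trans
        (Finset.sum_congr rfl fun y _ => hrev fun i => cellSum w (slideLine _ i))
    · rw [HasTile, exists_comm (p := fun x y => B x y = some v)]
      exact exists_congr fun y => hex fun i => B i y = some v
    · rw [HasTile, exists_comm (p := fun x y => slide B Dir.right x y = some v)]
      exact exists_congr fun y =>
        (hex fun i => slideLine (fun i => B i.rev y) i = some v).symm

/-- All tiles are powers of two. -/
def PowBoard (B : Board b) : Prop := ∀ v, HasTile v B → ∃ k, v = 2 ^ k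

theorem PowBoard.slide {B : Board b} (hB : PowBoard B) (d : Dir) : PowBoard (slide B d) := by
  obtain ⟨F, -, -, h₁, h₂⟩ := exists_lines B d
  intro v hv
  obtain ⟨j, i, hi⟩ := (h₂ v).2 hv
  obtain ⟨a, ha, h⟩ := mem_mergeTiles (mem_mergeTiles_tiles.2 ⟨i, hi⟩)
  obtain ⟨k, rfl⟩ := hB a ((h₁ a).1 ⟨j, mem_tiles.1 ha⟩)
  rcases h with rfl | rfl
  · exact ⟨k, rfl⟩
  · exact ⟨k + 1, by ring⟩

theorem total_slide {c : ℕ} {B : Board b} (hB : PowBoard B) {d : Dir}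
    (h : ¬ HasTile (2 ^ c) (slide B d)) :
    total (weight (2 ^ c)) (slide B d) = total (weight (2 ^ c)) B := by
  obtain ⟨F, h₁, h₂, h₃, h₄⟩ := exists_lines B d
  rw [h₁, h₂]
  refine Finset.sum_congr rfl fun j _ => ?_
  rw [sum_slideLine, sum_cells_eq]
  refine sum_weight_mergeTiles (fun v hv => hB v ((h₃ v).1 ⟨j, mem_tiles.1 hv⟩)) fun hc => h ?_
  exact (h₄ _).1 ⟨j, mem_mergeTiles_tiles.1 hc⟩

/-- The number of tiles. -/
def count (B : Board b) : ℕ := total (fun _ => 1) B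

theorem count_slide_le (B : Board b) (d : Dir) : count (slide B d) ≤ count B := by
  obtain ⟨F, h₁, h₂, -, -⟩ := exists_lines B d
  rw [count, count, h₁, h₂]
  refine Finset.sum_le_sum fun j _ => ?_
  rw [sum_slideLine, sum_cells_eq]
  simpa using length_mergeTiles_le _

/-- The board with a new tile of value 2. -/
def addTile (B : Board b) (x y : Fin b) : Board b :=
  fun i j => if i = x ∧ j = y then some 2 else B i j

theorem total_addTile (w : ℕ → ℕ) {B : Board b} {x y : Fin b} (h : B x y = none) :
    total w (addTile B x y) = total w B + w 2 := by
  have h₁ : ∀ i j, cellSum w (addTile B x y i j) =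
      cellSum w (B i j) + if i = x then if j = y then w 2 else 0 else 0 := by
    intro i j
    unfold addTile
    by_cases hi : i = x <;> by_cases hj : j = y <;> simp [hi, hj]
    simp [h, cellSum]
  simp only [total, h₁, Finset.sum_add_distrib]
  congr 1
  rw [Finset.sum_eq_single x] <;> simp +contextual

theorem hasTile_addTile {B : Board b} {x y : Fin b} (h : B x y = none) {v : ℕ} :
    HasTile v (addTile B x y) ↔ v = 2 ∨ HasTile v B := by
  constructor
  · rintro ⟨i, j, hij⟩
    unfold addTile at hij
    split at hij
    · exact .inl (Option.some.inj hij).symm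
    · exact .inr ⟨i, j, hij⟩
  · rintro (rfl | ⟨i, j, hij⟩)
    · exact ⟨x, y, by simp [addTile]⟩
    · refine ⟨i, j, ?_⟩
      rw [addTile, if_neg, hij]
      rintro ⟨rfl, rfl⟩
      simp [h] at hij

theorem PowBoard.addTile {B : Board b} (hB : PowBoard B) {x y : Fin b} (h : B x y = none) :
    PowBoard (addTile B x y) := by
  intro v hv
  rcases (hasTile_addTile h).1 hv with rfl | hv
  · exact ⟨1, rfl⟩
  · exact hB v hv

theorem turn_total {c : ℕ} {P Q : Position b} (hP : PowBoard P.board) (h : Turn P Q)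
    (hc : 1 ≤ c) (hQ : ¬ HasTile (2 ^ c) Q.board) :
    total (weight (2 ^ c)) Q.board = total (weight (2 ^ c)) P.board + 2 := by
  obtain ⟨d, -, x, y, hxy, hb, -⟩ := h
  change Q.board = addTile _ x y at hb
  rw [hb, hasTile_addTile hxy.1, not_or] at hQ
  rw [hb, total_addTile _ hxy.1, total_slide hP hQ.2]
  congr 1
  -- For `c = 1` the new tile would itself be the target.
  have : 1 < c := lt_of_le_of_ne hc fun h => hQ.1 (by rw [← h]; rfl)
  have h₂ : (2 : ℕ) < 2 ^ c := by
    calc (2 : ℕ) = 2 ^ 1 := rfl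
    _ < 2 ^ c := Nat.pow_lt_pow_right (by omega) this
  simp [weight, h₂]

theorem turn_powBoard {P Q : Position b} (hP : PowBoard P.board) (h : Turn P Q) :
    PowBoard Q.board := by
  obtain ⟨d, -, x, y, hxy, hb, -⟩ := h
  change Q.board = addTile _ x y at hb
  rw [hb]
  exact (hP.slide d).addTile hxy.1

theorem turn_count_le {P Q : Position b} (h : Turn P Q) :
    count Q.board ≤ count P.board + 1 := by
  obtain ⟨d, -, x, y, hxy, hb, -⟩ := h
  change Q.board = addTile _ x y at hb
  rw [hb, count, total_addTile _ hxy.1]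
  exact Nat.succ_le_succ (count_slide_le _ _)

/-- A power of two below `2 ^ c` is at most half of it. This factor 2, with the increment 2 per
turn, gives the denominator 4. -/
theorem two_mul_total_le {c : ℕ} {B : Board b} (hB : PowBoard B) :
    2 * total (weight (2 ^ c)) B ≤ b * (b * 2 ^ c) := by
  have h : ∀ x y, 2 * cellSum (weight (2 ^ c)) (B x y) ≤ 2 ^ c := by
    intro x y
    cases hv : B x y with
    | none => simp [cellSum]
    | some v =>
      obtain ⟨k, rfl⟩ := hB v ⟨x, y, hv⟩
      simp only [cellSum, Option.elim, weight]
      split_ifs with hlt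
      · rw [← pow_succ']
        exact Nat.pow_le_pow_right (by omega) ((Nat.pow_lt_pow_iff_right (by omega)).1 hlt)
      · simp
  rw [total, Finset.mul_sum]
  refine (Finset.sum_le_card_nsmul _ _ (b * 2 ^ c) fun x _ => ?_).trans (by simp)
  rw [Finset.mul_sum]
  exact (Finset.sum_le_card_nsmul _ _ (2 ^ c) fun y _ => h x y).trans (by simp)

/-- The potential starts at 0 or more, rises by 2 per turn and is capped by `two_mul_total_le`. -/
theorem moves_bound {c : ℕ} (hc : 1 ≤ c) {k : ℕ} {P : ℕ → Position b} (h₀ : PowBoard (P 0).board)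
    (hT : ∀ i < k, Turn (P i) (P (i + 1))) (hN : ∀ i ≤ k, ¬ HasTile (2 ^ c) (P i).board) :
    4 * k ≤ b * (b * 2 ^ c) := by
  have key : ∀ i ≤ k, PowBoard (P i).board ∧ 2 * i ≤ total (weight (2 ^ c)) (P i).board := by
    intro i
    induction i with
    | zero => intro _; exact ⟨h₀, by simp⟩
    | succ i ih =>
      intro hi
      obtain ⟨h₁, h₂⟩ := ih (by omega)
      have h₃ := turn_total h₁ (hT i (by omega)) hc (hN _ hi)
      exact ⟨turn_powBoard h₁ (hT i (by omega)), by omega⟩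
  have h₁ := (key k le_rfl).2
  have h₂ := two_mul_total_le (c := c) (key k le_rfl).1
  omega

theorem powBoard_boardOf {L : List Tile} (h : ValidTiles b L) : PowBoard (boardOf b L) := by
  rintro v ⟨x, y, hv⟩
  simp only [boardOf, Option.map_eq_some_iff] at hv
  obtain ⟨t, ht, rfl⟩ := hv
  obtain ⟨-, -, k, -, hk⟩ := h.1 t (List.mem_of_find?_eq_some ht)
  exact ⟨k, hk⟩

end

section

/-! ### The first empty cell -/

variable {b : ℕ}

theorem IsFirstEmptyFrom.unique {B : Board b} {a : ℕ × ℕ} {x y x' y' : Fin b}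
    (h : IsFirstEmptyFrom B a x y) (h' : IsFirstEmptyFrom B a x' y') : x = x' ∧ y = y' := by
  have h₁ := h.2 x' y' h'.1
  have h₂ := h'.2 x y h.1
  have key : toLex ((x : ℕ), (y : ℕ)) = toLex ((x' : ℕ), (y' : ℕ)) := by
    rcases h₁ with ⟨h₁, h₃⟩ | ⟨h₁, h₃⟩ <;> rcases h₂ with ⟨h₂, h₄⟩ | ⟨h₂, h₄⟩
    · exact absurd h₁ (not_le.2 h₄)
    · exact absurd (h₂.2 h₁) (not_le.2 h₃)
    · exact absurd (h₁.2 h₂) (not_le.2 h₄)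
    · exact le_antisymm h₃ h₄
  have := toLex.injective key
  simp only [Prod.mk.injEq] at this
  exact ⟨Fin.ext this.1, Fin.ext this.2⟩

theorem mem_cells {x y : ℕ} : (x, y) ∈ (tabulate b fun x y => (x, y)).flatten ↔ x < b ∧ y < b := by
  simp [tabulate, List.mem_flatten]

theorem pairwise_cells :
    (tabulate b fun x y => (x, y)).flatten.Pairwise fun p q => toLex p ≤ toLex q := by
  rw [List.pairwise_flatten]
  constructor
  · intro l hl
    simp only [tabulate, List.mem_map] at hl
    obtain ⟨x, -, rfl⟩ := hl
    rw [List.pairwise_map]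
    exact List.pairwise_lt_range.imp fun {y y'} h =>
      (Prod.Lex.toLex_le_toLex (x := (x, y)) (y := (x, y'))).2 (.inr ⟨rfl, h.le⟩)
  · rw [tabulate, List.pairwise_map]
    refine List.pairwise_lt_range.imp fun {x x'} h => ?_
    simp only [List.mem_map]
    rintro _ ⟨y, -, rfl⟩ _ ⟨y', -, rfl⟩
    exact Prod.Lex.toLex_le_toLex.2 (.inl h)

/-- Both lists of empty cells are in lexicographic order: the cells from `a` on, followed by all of
them. The head of the concatenation is thus the cyclically first empty cell, and it is missing only
on a full board. -/
theorem firstEmpty_spec {B : Board b} {E : ExpBoard}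
    (h : ∀ x y : Fin b, cellOf E x y = none ↔ B x y = none) (a : ℕ × ℕ) :
    (firstEmpty b a E = none ∧ ∀ x y, B x y ≠ none) ∨
    ∃ x y : Fin b, firstEmpty b a E = some ((x : ℕ), (y : ℕ)) ∧ IsFirstEmptyFrom B a x y := by
  set l := (tabulate b fun x y => (x, y)).flatten.filter
    fun p => decide (cellOf E p.1 p.2 = none) with hl
  set m := l.filter fun p => decide (a.1 < p.1 ∨ a.1 = p.1 ∧ a.2 ≤ p.2) with hm
  have hf : firstEmpty b a E = (m ++ l).head? := rfl
  have hmem : ∀ x y : Fin b, ((x : ℕ), (y : ℕ)) ∈ l ↔ B x y = none := by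
    intro x y
    rw [hl, List.mem_filter, mem_cells]
    simp [h]
  have hmem' : ∀ p ∈ l, ∃ x y : Fin b, p = ((x : ℕ), (y : ℕ)) ∧ B x y = none := by
    rintro ⟨x, y⟩ hp
    obtain ⟨hx, hy⟩ := mem_cells.1 (List.mem_of_mem_filter hp)
    exact ⟨⟨x, hx⟩, ⟨y, hy⟩, rfl, (hmem ⟨x, hx⟩ ⟨y, hy⟩).1 hp⟩
  have hle : ∀ p : ℕ × ℕ, (a.1 < p.1 ∨ a.1 = p.1 ∧ a.2 ≤ p.2) ↔ toLex a ≤ toLex p := fun p =>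
    Prod.Lex.toLex_le_toLex.symm
  have hmm : ∀ p, p ∈ m ↔ p ∈ l ∧ toLex a ≤ toLex p := by
    intro p
    rw [hm, List.mem_filter, decide_eq_true_eq, hle]
  have hpl : l.Pairwise fun p q => toLex p ≤ toLex q := pairwise_cells.filter _
  have hpm : m.Pairwise fun p q => toLex p ≤ toLex q := hpl.filter _
  have hhead : ∀ (n : List (ℕ × ℕ)) p, n.Pairwise (fun p q => toLex p ≤ toLex q) →
      n.head? = some p → p ∈ n ∧ ∀ q ∈ n, toLex p ≤ toLex q := by
    rintro (_ | ⟨p', n⟩) p hn hp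
    · simp at hp
    · obtain rfl : p' = p := by simpa using hp
      refine ⟨by simp, fun q hq => ?_⟩
      rcases List.mem_cons.1 hq with rfl | hq
      · exact le_rfl
      · exact List.rel_of_pairwise_cons hn hq
  rw [hf]
  cases hm' : m.head? with
  | some p =>
    right
    obtain ⟨hp, hp'⟩ := hhead m p hpm hm'
    obtain ⟨hp₁, hp₂⟩ := (hmm p).1 hp
    obtain ⟨x, y, rfl, hxy⟩ := hmem' p hp₁
    refine ⟨x, y, by rw [List.head?_append, hm']; rfl, hxy, fun x' y' h' => ?_⟩
    by_cases ha : toLex a ≤ toLex ((x' : ℕ), (y' : ℕ))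
    · exact .inr ⟨by simp [hp₂, ha], hp' _ ((hmm _).2 ⟨(hmem _ _).2 h', ha⟩)⟩
    · exact .inl ⟨hp₂, not_le.1 ha⟩
  | none =>
    have hnil : m = [] := List.head?_eq_none_iff.1 hm'
    have hna : ∀ p ∈ l, ¬ toLex a ≤ toLex p := fun p hp ha => by
      have := (hmm p).2 ⟨hp, ha⟩
      rw [hnil] at this
      simp at this
    rw [hnil, List.nil_append]
    cases hl' : l.head? with
    | none =>
      left
      refine ⟨rfl, fun x y hxy => ?_⟩
      have := (hmem x y).2 hxy
      rw [List.head?_eq_none_iff.1 hl'] at this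
      simp at this
    | some p =>
      right
      obtain ⟨hp, hp'⟩ := hhead l p hpl hl'
      obtain ⟨x, y, rfl, hxy⟩ := hmem' p hp
      refine ⟨x, y, rfl, hxy, fun x' y' h' => .inr ⟨?_, hp' _ ((hmem _ _).2 h')⟩⟩
      simp [hna _ hp, hna _ ((hmem _ _).2 h')]

/-- Existence is read off from the algorithm, run on the table of the board itself. -/
theorem exists_isFirstEmptyFrom {B : Board b} (h : ∃ x y, B x y = none) (a : ℕ × ℕ) :
    ∃ x y, IsFirstEmptyFrom B a x y := by
  rcases firstEmpty_spec (B := B) (E := List.ofFn fun x => List.ofFn (B x))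
    (fun x y => by simp [cellOf]) a with h' | ⟨x, y, -, h'⟩
  · obtain ⟨x, y, hxy⟩ := h
    exact absurd hxy (h'.2 x y)
  · exact ⟨x, y, h'⟩

/-! ### Large boards -/

theorem exists_eq_none {B : Board b} (h : count B < b * b) : ∃ x y, B x y = none := by
  by_contra! hB
  refine h.ne ?_
  have : ∀ x y, cellSum (fun _ => 1) (B x y) = 1 := by
    intro x y
    cases hv : B x y with
    | none => exact absurd hv (hB x y)
    | some v => rfl
  simp [count, total, this]

theorem turn_of_slide_ne {P : Position b} {d : Dir} (h : slide P.board d ≠ P.board)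
    (hc : count P.board < b) : ∃ x y, slide P.board d x y = none ∧
      Turn P ⟨addTile (slide P.board d) x y, P.locations.tail⟩ := by
  have h₁ : count (slide P.board d) < b * b :=
    ((count_slide_le _ _).trans_lt hc).trans_le (Nat.le_mul_self b)
  obtain ⟨x, y, hxy⟩ := exists_isFirstEmptyFrom (exists_eq_none h₁) (P.locations.headD (0, 0))
  exact ⟨x, y, hxy.1, d, h, x, y, hxy, rfl, rfl⟩

/-- The tiles of a row, from the right. -/
def rowTiles (B : Board b) (y : Fin b) : List ℕ := tiles fun i => B i.rev y

theorem length_rowTiles_le (B : Board b) (y : Fin b) : (rowTiles B y).length ≤ count B := by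
  have h := sum_cells_eq (fun _ => 1) fun i => B i.rev y
  have h₁ : ∑ i : Fin b, cellSum (fun _ => 1) (B i.rev y) = ∑ i, cellSum (fun _ => 1) (B i y) :=
    Equiv.sum_comp Fin.revPerm fun i => cellSum (fun _ => 1) (B i y)
  have h₂ : (rowTiles B y).length = ∑ i, cellSum (fun _ => 1) (B i y) := by
    rw [← h₁, h]; simp [rowTiles]
  rw [h₂, count, total, Finset.sum_comm]
  exact Finset.single_le_sum (f := fun y => ∑ i, cellSum (fun _ => 1) (B i y))
    (fun _ _ => Nat.zero_le _) (Finset.mem_univ y)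

variable {n : ℕ}

/-- Merging never lengthens a row, so tiles pushed to the right reach the leftmost cell only if the
row was full. -/
theorem slide_right_zero {B : Board (n + 1)} {y : Fin (n + 1)} (h : (rowTiles B y).length ≤ n) :
    slide B .right 0 y = none := by
  change slideLine (fun i => B i.rev y) (Fin.rev 0) = none
  rw [slideLine_eq, List.getElem?_eq_none]
  simpa [rowTiles] using (length_mergeTiles_le _).trans h

theorem slide_right_ne {B : Board (n + 1)} {y : Fin (n + 1)} (h₀ : B 0 y ≠ none)
    (h : (rowTiles B y).length ≤ n) : slide B .right ≠ B := by
  intro h'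
  rw [← h', slide_right_zero h] at h₀
  exact h₀ rfl

theorem slide_left_zero {B : Board (n + 1)} {x y : Fin (n + 1)} (h : B x y ≠ none) :
    slide B .left 0 y ≠ none := by
  obtain ⟨v, hv⟩ := Option.ne_none_iff_exists'.1 h
  have h₁ : v ∈ tiles fun i => B i y := mem_tiles.2 ⟨x, hv⟩
  have h₂ := mergeTiles_ne_nil (List.ne_nil_of_mem h₁)
  change slideLine (fun i => B i y) 0 ≠ none
  rw [slideLine_eq, Fin.val_zero, List.getElem?_eq_getElem (List.length_pos_of_ne_nil h₂)]
  simp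

/-- If the move to the left changes nothing, the row of the given tile has a tile in column 0. That
row is not full, so the move to the right changes it. -/
theorem exists_slide_ne {B : Board (n + 1)} {x y : Fin (n + 1)} (h : B x y ≠ none)
    (hc : count B < n + 1) : ∃ d, slide B d ≠ B := by
  by_cases h' : slide B .left = B
  · refine ⟨.right, slide_right_ne (y := y) ?_ ?_⟩
    · rw [← h']; exact slide_left_zero h
    · exact (length_rowTiles_le B y).trans (by omega)
  · exact ⟨.left, h'⟩

/-- Any valid move consumes one location and adds at most one tile, so the board remains sparse
enough for `exists_slide_ne` to supply the next move. -/
theorem exists_locations_nil (m : ℕ) : ∀ P : Position (n + 1), P.locations.length = m →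
    (∃ x y, P.board x y ≠ none) → count P.board + m < n + 1 →
    ∃ Q, Relation.ReflTransGen Turn P Q ∧ Q.locations = [] ∧ (∃ x y, Q.board x y ≠ none) ∧
      count Q.board ≤ count P.board + m := by
  induction m with
  | zero => exact fun P hm h _ => ⟨P, .refl, List.length_eq_zero_iff.1 hm, h, le_rfl⟩
  | succ m ih =>
    rintro P hm ⟨x, y, h⟩ hc
    obtain ⟨d, hd⟩ := exists_slide_ne h (by omega)
    obtain ⟨x', y', -, hT⟩ := turn_of_slide_ne hd (by omega)
    have h₁ := turn_count_le hT
    obtain ⟨Q, hQ, h₂, h₃, h₄⟩ := ih ⟨addTile (slide P.board d) x' y', P.locations.tail⟩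
      (by simp [hm]) ⟨x', y', by simp [addTile]⟩ (by dsimp only at h₁ ⊢; omega)
    dsimp only at h₁ h₄
    exact ⟨Q, .head hT hQ, h₂, h₃, by omega⟩

/-- A tile in the first column is what makes a move to the right valid; at most one move to the left
provides it. -/
theorem exists_first_column {P : Position (n + 1)} (hP : P.locations = [])
    (h : ∃ x y, P.board x y ≠ none) (hc : count P.board < n + 1) :
    ∃ Q, Relation.ReflTransGen Turn P Q ∧ Q.locations = [] ∧ (∃ y, Q.board 0 y ≠ none) ∧
      count Q.board ≤ count P.board + 1 := by
  obtain ⟨x, y, h⟩ := h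
  by_cases h' : slide P.board .left = P.board
  · exact ⟨P, .refl, hP, ⟨y, by rw [← h']; exact slide_left_zero h⟩, Nat.le_succ _⟩
  · obtain ⟨x', y', -, hT⟩ := turn_of_slide_ne h' hc
    refine ⟨_, .single hT, by simp [hP], ⟨y, ?_⟩, turn_count_le hT⟩
    dsimp only [addTile]
    split
    · simp
    · exact slide_left_zero h

theorem tiles_getElem? : ∀ {n : ℕ} {m : List ℕ}, m.length ≤ n →
    tiles (fun i : Fin n => m[(i : ℕ)]?) = m
  | 0, m, h => by simp_all [tiles]
  | n + 1, [], _ => by simp [tiles, List.reduceOption]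
  | n + 1, a :: m, h => by
    have := tiles_getElem? (n := n) (m := m) (by simpa using h)
    simp only [tiles] at this
    simp [tiles, List.ofFn_succ, this]

/-! ### Moves to the right as a binary counter -/

/-- A move to the right when no tile location is prescribed any more. -/
theorem turn_right {P : Position (n + 1)} (hP : P.locations = []) {y : Fin (n + 1)}
    (h : P.board 0 y ≠ none) (hy : (rowTiles P.board y).length ≤ n)
    (h₀ : (rowTiles P.board 0).length ≤ n) :
    ∃ Q, Turn P Q ∧ Q.locations = [] ∧ Q.board 0 0 ≠ none ∧
      rowTiles Q.board 0 = mergeTiles (rowTiles P.board 0) ++ [2] := by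
  have h₁ := slide_right_zero h₀
  refine ⟨⟨addTile (slide P.board .right) 0 0, []⟩, ⟨.right, slide_right_ne h hy, 0, 0,
    -- No cell precedes `(0, 0)`, so it is the first empty cell as soon as it is empty.
    ⟨h₁, fun x' y' _ => .inr ?_⟩, rfl, by simp [hP]⟩, rfl, by simp [addTile], ?_⟩
  · have : ∀ x y : ℕ, toLex ((0 : ℕ), (0 : ℕ)) ≤ toLex (x, y) := fun x y => by
      rw [Prod.Lex.toLex_le_toLex]
      simp only
      omega
    simp [hP, this]
  · have h₂ := (length_mergeTiles_le _).trans h₀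
    -- Read from the right, the corner `(0, 0)` is the last cell of its row, so the new 2 is
    -- appended at the end.
    have h₃ : (fun i : Fin (n + 1) => addTile (slide P.board .right) 0 0 i.rev 0) =
        fun i : Fin (n + 1) => if i = Fin.last n then some 2
          else (mergeTiles (rowTiles P.board 0))[(i : ℕ)]? := by
      funext i
      simp only [addTile, and_true, Fin.rev_eq_iff, Fin.rev_zero]
      split_ifs
      · rfl
      · change slideLine _ i.rev.rev = _
        rw [Fin.rev_rev]
        rfl
    rw [rowTiles, h₃, tiles, List.ofFn_succ', List.concat_eq_append, List.reduceOption_append]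
    congr 1
    · refine Eq.trans ?_ (tiles_getElem? h₂)
      rw [tiles]
      congr 2
      funext i
      simp [Fin.castSucc_ne_last]
    · simp [List.reduceOption]

/-- The tiles are `2 ^ m`, ..., `4`, `2`, each at most twice. -/
def Descending : ℕ → List ℕ → Prop
  | 0, s => s = []
  | m + 1, s => ∃ j ≤ 2, ∃ t, Descending m t ∧ s = List.replicate j (2 ^ (m + 1)) ++ t

theorem Descending.length_le : ∀ {m : ℕ} {s : List ℕ}, Descending m s → s.length ≤ 2 * m
  | 0, s, h => by rw [show s = [] from h]; simp
  | m + 1, s, ⟨j, hj, t, ht, hs⟩ => by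
    have := ht.length_le
    rw [hs, List.length_append, List.length_replicate]; omega

theorem Descending.mem_le : ∀ {m : ℕ} {s : List ℕ}, Descending m s → ∀ v ∈ s, v ≤ 2 ^ m
  | 0, s, h, v, hv => by rw [show s = [] from h] at hv; simp at hv
  | m + 1, s, ⟨j, hj, t, ht, hs⟩, v, hv => by
    rw [hs, List.mem_append] at hv
    rcases hv with hv | hv
    · exact (List.eq_of_mem_replicate hv).le
    · exact (ht.mem_le v hv).trans (Nat.pow_le_pow_right (by omega) (by omega))

theorem Descending.tail : ∀ {m : ℕ} {s : List ℕ}, Descending m s → Descending m s.tail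
  | 0, s, h => by rw [show s = [] from h]; rfl
  | m + 1, s, ⟨0, hj, t, ht, hs⟩ => ⟨0, hj, t.tail, ht.tail, by rw [hs]; rfl⟩
  | m + 1, s, ⟨j + 1, hj, t, ht, hs⟩ => ⟨j, by omega, t, ht, by rw [hs]; rfl⟩

theorem mergeTiles_cons_of_lt {a : ℕ} {l : List ℕ} (h : ∀ v ∈ l, v < a) :
    mergeTiles (a :: l) = a :: mergeTiles l := by
  cases l with
  | nil => rfl
  | cons a' l => rw [mergeTiles, if_neg (h a' (by simp)).ne']

/-- One increment of a counter with digits 0, 1, 2; `e` is the carry out of the top digit, and the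
appended 2 is the carry into the lowest one. A digit 2 becomes 0 and sends a carry; a digit 0 or 1
stays. Adding the incoming carry gives at most 2, so digits and carries remain in range. -/
theorem Descending.mergeTiles_append : ∀ {m : ℕ} {s : List ℕ}, Descending m s →
    ∃ e ≤ 1, ∃ t, Descending m t ∧
      mergeTiles s ++ [2] = List.replicate e (2 ^ (m + 1)) ++ t
  | 0, s, h => ⟨1, le_rfl, [], rfl, by rw [show s = [] from h]; rfl⟩
  | m + 1, s, ⟨j, hj, s', hs', hs⟩ => by
    obtain ⟨e, he, t, ht, h⟩ := hs'.mergeTiles_append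
    have hlt : ∀ v ∈ s', v < 2 ^ (m + 1) := fun v hv =>
      (hs'.mem_le v hv).trans_lt (Nat.pow_lt_pow_right (by omega) (by omega))
    interval_cases j
    · exact ⟨0, by omega, _, ⟨e, by omega, t, ht, h⟩, by rw [hs]; rfl⟩
    · refine ⟨0, by omega, _, ⟨e + 1, by omega, t, ht, rfl⟩, ?_⟩
      rw [hs]
      simp only [mergeTiles_cons_of_lt hlt,
        List.cons_append, h, List.replicate_succ, List.replicate_zero, List.nil_append]
    · refine ⟨1, le_rfl, _, ⟨e, by omega, t, ht, rfl⟩, ?_⟩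
      rw [hs]
      simp only [List.replicate_succ, List.replicate_zero, List.cons_append, List.nil_append,
        mergeTiles, if_pos, h]
      rw [pow_succ 2 (m + 1), mul_two]

/-- The pairing that starts in `p` either stops at its end or takes just the first tile of `s`
along. The old tiles thus disturb the counter by removing at most its leading tile. -/
theorem mergeTiles_append (p s : List ℕ) : ∃ p' s', p'.length ≤ p.length ∧ (s' = s ∨ s' = s.tail) ∧
    mergeTiles (p ++ s) = p' ++ mergeTiles s' := by
  induction p using mergeTiles.induct with
  | case1 => exact ⟨[], s, by simp, .inl rfl, rfl⟩
  | case2 a =>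
    rcases s with _ | ⟨h, t⟩
    · exact ⟨[a], [], by simp, .inl rfl, rfl⟩
    · by_cases hah : a = h
      · exact ⟨[a + h], t, by simp, .inr rfl, by simp [mergeTiles, hah]⟩
      · exact ⟨[a], h :: t, by simp, .inl rfl, by simp [mergeTiles, hah]⟩
  | case3 a l ih =>
    obtain ⟨p', s', h₁, h₂, h₃⟩ := ih
    exact ⟨(a + a) :: p', s', by simp; omega, h₂, by simp [mergeTiles, h₃]⟩
  | case4 a a' l hne ih =>
    obtain ⟨p', s', h₁, h₂, h₃⟩ := ih
    refine ⟨a :: p', s', by simp at h₁ ⊢; omega, h₂, ?_⟩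
    rw [List.cons_append, List.cons_append, mergeTiles, if_neg hne, ← List.cons_append, h₃]
    rfl

/-- The invariant of a sequence of moves to the right. -/
def RightReady (m k : ℕ) (P : Position (n + 1)) : Prop :=
  P.locations = [] ∧ P.board 0 0 ≠ none ∧
    ∃ p s, p.length ≤ k ∧ Descending m s ∧ rowTiles P.board 0 = p ++ s

/-- The counter has at most `2 * m` tiles and the prefix at most `k`, so the row is not full and the
move is valid. A carry out of the counter is a tile `2 ^ (m + 1)`; without a carry the invariant
persists with the same `k`, as the prefix does not grow. -/
theorem RightReady.turn {m k : ℕ} (hn : k + 2 * m ≤ n) {P : Position (n + 1)}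
    (h : RightReady m k P) : ∃ Q, Turn P Q ∧ (HasTile (2 ^ (m + 1)) Q.board ∨ RightReady m k Q) := by
  obtain ⟨h₁, h₂, p, s, h₃, h₄, h₅⟩ := h
  have h₆ : (rowTiles P.board 0).length ≤ n := by
    rw [h₅, List.length_append]
    have := h₄.length_le
    omega
  obtain ⟨Q, hQ, h₇, h₈, h₉⟩ := turn_right h₁ h₂ h₆ h₆
  refine ⟨Q, hQ, or_iff_not_imp_left.2 fun hT => ?_⟩
  obtain ⟨p', s', hp', hs', hm⟩ := mergeTiles_append p s
  have h₁₀ : Descending m s' := by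
    rcases hs' with rfl | rfl
    · exact h₄
    · exact h₄.tail
  obtain ⟨e, he, t, ht, h⟩ := h₁₀.mergeTiles_append
  rw [h₅, hm, List.append_assoc, h] at h₉
  refine ⟨h₇, h₈, p', t, hp'.trans h₃, ht, ?_⟩
  interval_cases e
  · simpa using h₉
  · refine absurd ?_ hT
    have : 2 ^ (m + 1) ∈ rowTiles Q.board 0 := by rw [h₉]; simp
    obtain ⟨i, hi⟩ := mem_tiles.1 this
    exact ⟨_, _, hi⟩

/-- If the target were unreachable, moves to the right could be continued for ever without it,
contradicting `moves_bound`. The room on the board covers the tiles present before the first move to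
the right and the `2 * m` tiles of the counter. -/
theorem canMake_of_large {c : ℕ} (hc : 1 ≤ c) {b : ℕ} {P : Position b} (hP : PowBoard P.board)
    (h : ∃ x y, P.board x y ≠ none) (hb : count P.board + P.locations.length + 2 * c + 2 ≤ b) :
    CanMake (2 ^ c) P := by
  obtain ⟨n, rfl⟩ : ∃ n, b = n + 1 := ⟨b - 1, by omega⟩
  obtain ⟨m, rfl⟩ : ∃ m, c = m + 1 := ⟨c - 1, by omega⟩
  by_contra hno
  have hno' : ∀ Q, Relation.ReflTransGen Turn P Q → ¬ HasTile (2 ^ (m + 1)) Q.board :=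
    fun Q hQ hT => hno ⟨Q, hQ, hT⟩
  have hpow : ∀ Q, Relation.ReflTransGen Turn P Q → PowBoard Q.board := by
    intro Q hQ
    induction hQ with
    | refl => exact hP
    | tail _ hT ih => exact turn_powBoard ih hT
  obtain ⟨Q₁, hQ₁, h₁, h₂, h₃⟩ := exists_locations_nil _ P rfl h (by omega)
  obtain ⟨Q₂, hQ₂, h₄, ⟨y, h₅⟩, h₆⟩ := exists_first_column h₁ h₂ (by omega)
  have hlen : ∀ y, (rowTiles Q₂.board y).length ≤ count Q₂.board := length_rowTiles_le _
  obtain ⟨Q₃, hQ₃, h₇, h₈, h₉⟩ := turn_right h₄ h₅ ((hlen y).trans (by omega))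
    ((hlen 0).trans (by omega))
  have hr₃ : Relation.ReflTransGen Turn P Q₃ := (hQ₁.trans hQ₂).tail hQ₃
  have hready : RightReady m (count Q₂.board) Q₃ := by
    refine ⟨h₇, h₈, mergeTiles (rowTiles Q₂.board 0), [2],
      (length_mergeTiles_le _).trans (hlen 0), ?_, h₉⟩
    have key : ∀ j, Descending (j + 1) [2] := by
      intro j
      induction j with
      | zero => exact ⟨1, by omega, [], rfl, rfl⟩
      | succ j ih => exact ⟨0, by omega, [2], ih, rfl⟩
    -- For `m = 0` the target is 2, and the new tile already is one.
    cases m with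
    | zero =>
      refine absurd ?_ (hno' Q₃ hr₃)
      have : 2 ∈ rowTiles Q₃.board 0 := by rw [h₉]; simp
      obtain ⟨i, hi⟩ := mem_tiles.1 this
      exact ⟨_, _, hi⟩
    | succ m => exact key m
  -- As the target never appears, each ready position leads to another one; choosing successors
  -- yields an endless play.
  have step : ∀ Q : {Q : Position (n + 1) // Relation.ReflTransGen Turn P Q ∧
      RightReady m (count Q₂.board) Q}, ∃ Q' : {Q : Position (n + 1) //
        Relation.ReflTransGen Turn P Q ∧ RightReady m (count Q₂.board) Q}, Turn Q.1 Q'.1 := by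
    rintro ⟨Q, hQ, hQ'⟩
    obtain ⟨Q', hT, h'⟩ := hQ'.turn (by omega)
    exact ⟨⟨Q', hQ.tail hT, h'.resolve_left (hno' Q' (hQ.tail hT))⟩, hT⟩
  choose f hf using step
  let q : ℕ → {Q : Position (n + 1) // Relation.ReflTransGen Turn P Q ∧
      RightReady m (count Q₂.board) Q} := fun i => f^[i] ⟨Q₃, hr₃, hready⟩
  -- The number of moves is one more than the right-hand side of the bound, which is absurd.
  have hbound := moves_bound (c := m + 1) hc (k := (n + 1) * ((n + 1) * 2 ^ (m + 1)) + 1)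
    (P := fun i => (q i).1) (hpow _ (q 0).2.1)
    (fun i _ => by
      change Turn (q i).1 (f^[i + 1] ⟨Q₃, hr₃, hready⟩).1
      rw [Function.iterate_succ_apply']
      exact hf _) fun i _ => hno' _ (q i).2.1
  omega

end

section

/-! ### Correctness of the simulation -/

/-- The state of the fold stands for its settled tiles followed by the merge of the pending tile and
the rest of the line. Comparing exponents is comparing values, as `2 ^ ·` is injective. -/
theorem mergeTiles_map_pow (l : List ℕ) :
    mergeTiles (l.map (2 ^ ·)) = (mergeExps l).map (2 ^ ·) := by
  have key : ∀ (l : List ℕ) (s : List ℕ × Option ℕ),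
      (((l.foldl mergeStep s).2.toList ++ (l.foldl mergeStep s).1).reverse).map (2 ^ ·) =
        s.1.reverse.map (2 ^ ·) ++ mergeTiles ((s.2.toList ++ l).map (2 ^ ·)) := by
    intro l
    induction l with
    | nil =>
      rintro ⟨out, _ | p⟩
      · simp [mergeTiles]
      · simp [mergeTiles]
    | cons a l ih =>
      rintro ⟨out, _ | p⟩
      · rw [List.foldl_cons, ih]; rfl
      · rw [List.foldl_cons, ih]
        by_cases h : p = a
        · subst h
          simp [mergeStep, mergeTiles, pow_succ, mul_two]
        · have : 2 ^ p ≠ 2 ^ a := fun h' => h (Nat.pow_right_injective le_rfl h')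
          simp [mergeStep, mergeTiles, h]
  have := key l ([], none)
  simpa [mergeExps] using this.symm

theorem cellOf_tabulate {b : ℕ} (g : ℕ → ℕ → Option ℕ) {x y : ℕ} (hx : x < b) (hy : y < b) :
    cellOf (tabulate b g) x y = g x y := by
  simp [cellOf, tabulate, hx, hy]

theorem tabulate_congr {γ : Type} {b : ℕ} {g h : ℕ → ℕ → γ} :
    tabulate b g = tabulate b h ↔ ∀ x y : Fin b, g x y = h x y := by
  simp only [tabulate, List.map_inj_left, List.mem_range]
  exact ⟨fun H x y => H x x.2 y y.2, fun H x hx y hy => H ⟨x, hx⟩ ⟨y, hy⟩⟩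

variable {b : ℕ}

/-- The first clause forces `E` to be exactly a `b × b` table; this makes the representing table
unique, so validity of a move can be tested by equality of tables. -/
def Represents (E : ExpBoard) (B : Board b) : Prop :=
  E = tabulate b (cellOf E) ∧ ∀ x y : Fin b, B x y = (cellOf E x y).map (2 ^ ·)

theorem represents_tabulate {g : ℕ → ℕ → Option ℕ} {B : Board b}
    (h : ∀ x y : Fin b, B x y = (g x y).map (2 ^ ·)) : Represents (tabulate b g) B :=
  ⟨tabulate_congr.2 fun x y => (cellOf_tabulate g x.2 y.2).symm,
    fun x y => by rw [cellOf_tabulate g x.2 y.2, h]⟩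

theorem optionMap_pow_injective : Function.Injective (Option.map fun k : ℕ => 2 ^ k) :=
  Option.map_injective (Nat.pow_right_injective le_rfl)

theorem Represents.eq_iff {E E' : ExpBoard} {B B' : Board b} (h : Represents E B)
    (h' : Represents E' B') : E = E' ↔ B = B' := by
  constructor
  · rintro rfl
    funext x y
    rw [h.2, h'.2]
  · rintro rfl
    rw [h.1, h'.1, tabulate_congr]
    intro x y
    exact optionMap_pow_injective ((h.2 x y).symm.trans (h'.2 x y))

theorem slideLine_eq_map {f : Fin b → Option ℕ} {g : ℕ → Option ℕ}
    (h : ∀ i : Fin b, f i = (g i).map (2 ^ ·)) (i : Fin b) :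
    slideLine f i =
      ((mergeExps ((List.range b).map g).reduceOption)[(i : ℕ)]?).map (2 ^ ·) := by
  have h₁ : List.ofFn f = ((List.range b).map g).map (Option.map (2 ^ ·)) := by
    refine List.ext_getElem (by simp) fun j h₁ h₂ => ?_
    simp [h]
  rw [slideLine, h₁, List.reduceOption_map, mergeTiles_map_pow, List.getElem?_map]

/-- The direction with the given code. -/
def dirOf (d : Bool × Bool) : Dir :=
  if d.1 = true then (if d.2 = true then .down else .up)
  else if d.2 = true then .right else .left

theorem val_rev (i : Fin b) : ((i.rev : Fin b) : ℕ) = b - 1 - i := by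
  rw [Fin.val_rev]; omega

theorem Represents.slide {E : ExpBoard} {B : Board b} (h : Represents E B) (d : Bool × Bool) :
    Represents (slideExps b d E) (slide B (dirOf d)) := by
  refine represents_tabulate fun x y => ?_
  obtain ⟨_ | _, _ | _⟩ := d
  · exact slideLine_eq_map (fun i => h.2 i y) x
  · have := slideLine_eq_map (f := fun i => B i.rev y) (g := fun i => cellOf E (b - 1 - i) y)
      (fun i => by rw [h.2, val_rev]) x.rev
    rw [val_rev] at this
    exact this
  · exact slideLine_eq_map (fun i => h.2 x i) y
  · have := slideLine_eq_map (f := fun i => B x i.rev) (g := fun i => cellOf E x (b - 1 - i))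
      (fun i => by rw [h.2, val_rev]) y.rev
    rw [val_rev] at this
    exact this

def RepresentsPosition (s : ExpBoard × List (ℕ × ℕ)) (P : Position b) : Prop :=
  Represents s.1 P.board ∧ s.2 = P.locations

theorem RepresentsPosition.turn {s : ExpBoard × List (ℕ × ℕ)} {P : Position b}
    (h : RepresentsPosition s P) {d : Bool × Bool} (hd : Make2048.slide P.board (dirOf d) ≠ P.board)
    {x y : Fin b}
    (hxy : IsFirstEmptyFrom (Make2048.slide P.board (dirOf d)) (P.locations.headD (0, 0)) x y) :
    RepresentsPosition (turnExps b d s)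
      ⟨addTile (Make2048.slide P.board (dirOf d)) x y, P.locations.tail⟩ := by
  have h₁ := h.1.slide d
  have h₂ : slideExps b d s.1 ≠ s.1 := fun h' => hd ((h₁.eq_iff h.1).1 h')
  have h₃ : s.2.head?.getD (0, 0) = P.locations.headD (0, 0) := by
    rw [h.2, List.headD_eq_head?_getD]
  rw [turnExps, if_neg h₂, h₃]
  rcases firstEmpty_spec (B := Make2048.slide P.board (dirOf d)) (E := slideExps b d s.1)
        (fun x y => by rw [h₁.2 x y]; simp)
    (P.locations.headD (0, 0)) with h₄ | ⟨x', y', h₄, h₅⟩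
  · exact absurd hxy.1 (h₄.2 x y)
  · obtain ⟨rfl, rfl⟩ := hxy.unique h₅
    rw [h₄]
    refine ⟨represents_tabulate fun i j => ?_, by rw [← h.2]; rfl⟩
    dsimp only [addTile]
    simp only [Fin.val_inj]
    split_ifs
    · rfl
    · exact h₁.2 i j

/-- An invalid move leaves the simulated state as it is, so every certificate, however meaningless,
describes a legal play. -/
theorem RepresentsPosition.turnExps {s : ExpBoard × List (ℕ × ℕ)} {P : Position b}
    (h : RepresentsPosition s P) (d : Bool × Bool) :
    ∃ Q, Relation.ReflTransGen Turn P Q ∧ RepresentsPosition (turnExps b d s) Q := by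
  have h₁ := h.1.slide d
  by_cases hd : Make2048.slide P.board (dirOf d) = P.board
  · refine ⟨P, .refl, ?_⟩
    rwa [Make2048.turnExps, if_pos ((h₁.eq_iff h.1).2 hd)]
  · rcases firstEmpty_spec (B := Make2048.slide P.board (dirOf d)) (E := slideExps b d s.1)
      (fun x y => by rw [h₁.2 x y]; simp)
      (P.locations.headD (0, 0)) with h₄ | ⟨x, y, -, h₅⟩
    · have h₃ : s.2.head?.getD (0, 0) = P.locations.headD (0, 0) := by
        rw [h.2, List.headD_eq_head?_getD]
      refine ⟨P, .refl, ?_⟩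
      rw [Make2048.turnExps, h₃, h₄.1]
      split <;> exact h
    · exact ⟨_, .single ⟨_, hd, x, y, h₅, rfl, rfl⟩, h.turn hd h₅⟩

theorem RepresentsPosition.foldl_simStep {P : Position b} (w : List Bool)
    {s : (Bool × Bool) × ExpBoard × List (ℕ × ℕ)} (h : RepresentsPosition s.2 P) :
    ∃ Q, Relation.ReflTransGen Turn P Q ∧ RepresentsPosition (w.foldl (simStep b) s).2 Q := by
  induction w generalizing P s with
  | nil => exact ⟨P, .refl, h⟩
  | cons c w ih =>
    rw [List.foldl_cons]
    cases c
    · exact ih (s := simStep b s false) h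
    · obtain ⟨Q, hQ, h₁⟩ := h.turnExps s.1
      obtain ⟨R, hR, h₂⟩ := ih (s := simStep b s true) h₁
      exact ⟨R, hQ.trans hR, h₂⟩

theorem exists_rotations (d : Bool × Bool) (e : Dir) : ∃ j ≤ 3, dirOf (rotate^[j] d) = e := by
  obtain ⟨_ | _, _ | _⟩ := d <;> cases e <;>
    first
    | exact ⟨0, by omega, rfl⟩
    | exact ⟨1, by omega, rfl⟩
    | exact ⟨2, by omega, rfl⟩
    | exact ⟨3, by omega, rfl⟩

theorem foldl_simStep_replicate (s : (Bool × Bool) × ExpBoard × List (ℕ × ℕ)) (j : ℕ) :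
    (List.replicate j false).foldl (simStep b) s = (rotate^[j] s.1, s.2) := by
  induction j generalizing s with
  | zero => rfl
  | succ j ih => rw [List.replicate_succ, List.foldl_cons, ih]; rfl

/-- A turn costs at most three rotations to reach its direction and one symbol for the move, hence
the factor 4. -/
theorem exists_simulate {P : ℕ → Position b} {k : ℕ} (hT : ∀ i < k, Turn (P i) (P (i + 1)))
    {s : ExpBoard × List (ℕ × ℕ)} (h : RepresentsPosition s (P 0)) :
    ∃ w : List Bool, w.length ≤ 4 * k ∧ RepresentsPosition (simulate b s w) (P k) := by
  induction k with
  | zero => exact ⟨[], le_rfl, h⟩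
  | succ k ih =>
    obtain ⟨w, hw, h₁⟩ := ih fun i hi => hT i (by omega)
    obtain ⟨e, he, x, y, hxy, hb, hl⟩ := hT k (by omega)
    obtain ⟨j, hj, rfl⟩ := exists_rotations (w.foldl (simStep b) ((false, false), s)).1 e
    refine ⟨w ++ List.replicate j false ++ [true], ?_, ?_⟩
    · simp only [List.length_append, List.length_replicate, List.length_singleton]
      omega
    · have h₂ := h₁.turn he hxy
      have h₃ : P (k + 1) = ⟨(P (k + 1)).board, (P (k + 1)).locations⟩ := rfl
      rw [hb, hl] at h₃
      rw [h₃, simulate, List.foldl_append, List.foldl_append, foldl_simStep_replicate]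
      exact h₂

theorem Represents.hasExp_iff {E : ExpBoard} {B : Board b} (h : Represents E B) (c : ℕ) :
    hasExp c b E = true ↔ HasTile (2 ^ c) B := by
  have h₁ : ∀ x y : Fin b, B x y = some (2 ^ c) ↔ cellOf E x y = some c := fun x y => by
    rw [h.2 x y]
    exact optionMap_pow_injective.eq_iff (b := some c)
  simp only [HasTile, h₁, hasExp, tabulate, List.any_eq_true, List.mem_flatten, List.mem_map,
    List.mem_range, decide_eq_true_eq]
  constructor
  · rintro ⟨_, ⟨_, ⟨x, hx, rfl⟩, ho⟩, rfl⟩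
    obtain ⟨y, hy, hxy⟩ := List.mem_map.1 ho
    exact ⟨⟨x, hx⟩, ⟨y, List.mem_range.1 hy⟩, hxy⟩
  · rintro ⟨x, y, hxy⟩
    exact ⟨_, ⟨_, ⟨x, x.2, rfl⟩, List.mem_map.2 ⟨y, List.mem_range.2 y.2, hxy⟩⟩, rfl⟩

/-! ### Plays and certificates of bounded length -/

theorem exists_sequence {P Q : Position b} (h : Relation.ReflTransGen Turn P Q) :
    ∃ (k : ℕ) (R : ℕ → Position b), R 0 = P ∧ R k = Q ∧ ∀ i < k, Turn (R i) (R (i + 1)) := by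
  induction h using Relation.ReflTransGen.head_induction_on with
  | refl => exact ⟨0, fun _ => Q, rfl, rfl, by simp⟩
  | @head P P' hT _ ih =>
    obtain ⟨k, R, h₀, hk, hR⟩ := ih
    refine ⟨k + 1, fun i => Nat.casesOn i P R, rfl, hk, fun i hi => ?_⟩
    cases i with
    | zero => rw [← h₀] at hT; exact hT
    | succ i => exact hR i (by omega)

/-- The play is cut at the first appearance of the target. All positions before the last one avoid
it, so `moves_bound` applies to `k - 1` moves; the missing move is the `+ 4`. -/
theorem CanMake.exists_sequence {c : ℕ} (hc : 1 ≤ c) {P : Position b} (hP : PowBoard P.board)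
    (h : CanMake (2 ^ c) P) : ∃ (k : ℕ) (R : ℕ → Position b), R 0 = P ∧
      HasTile (2 ^ c) (R k).board ∧ (∀ i < k, Turn (R i) (R (i + 1))) ∧
      4 * k ≤ b * (b * 2 ^ c) + 4 := by
  classical
  obtain ⟨Q, hQ, hT⟩ := h
  obtain ⟨k, R, rfl, rfl, hR⟩ := Make2048.exists_sequence hQ
  have hex : ∃ i, HasTile (2 ^ c) (R i).board := ⟨k, hT⟩
  have hle := Nat.find_min' hex hT
  refine ⟨Nat.find hex, R, rfl, Nat.find_spec hex, fun i hi => hR i (by omega), ?_⟩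
  by_cases h₀ : Nat.find hex = 0
  · omega
  · have := moves_bound hc (k := Nat.find hex - 1) hP (fun i hi => hR i (by omega))
      fun i hi => Nat.find_min hex (by omega)
    omega

theorem canMake_iff_simulate {c : ℕ} (hc : 1 ≤ c) {P : Position b} (hP : PowBoard P.board)
    {s : ExpBoard × List (ℕ × ℕ)} (h : RepresentsPosition s P) {m : ℕ}
    (hm : b * (b * 2 ^ c) + 4 ≤ m) :
    CanMake (2 ^ c) P ↔
      ∃ w : List Bool, w.length ≤ m ∧ hasExp c b (simulate b s w).1 = true := by
  constructor
  · intro hcan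
    obtain ⟨k, R, rfl, hT, hR, hk⟩ := hcan.exists_sequence hc hP
    obtain ⟨w, hw, h₁⟩ := exists_simulate hR h
    exact ⟨w, by omega, (h₁.1.hasExp_iff c).2 hT⟩
  · rintro ⟨w, -, hw⟩
    obtain ⟨Q, hQ, h₁⟩ := RepresentsPosition.foldl_simStep w (s := ((false, false), s)) h
    exact ⟨Q, hQ, (h₁.1.hasExp_iff c).1 hw⟩

end

section

/-! ### Correctness of the verifier -/

/-- `parseStep` with its arguments exchanged: reading a word from the right is a `foldr`, which
splits along concatenations. -/
def stepOf (a : Γ') (s : List Bool × List (List Bool) × List (List (List Bool))) :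
    List Bool × List (List Bool) × List (List (List Bool)) := parseStep s a

theorem foldr_stepOf_bits (n q : List Bool) (r : List (List Bool)) (t : List (List (List Bool))) :
    (n.map Γ'.bit).foldr stepOf (q, r, t) = (n ++ q, r, t) := by
  induction n with
  | nil => rfl
  | cons c n ih =>
    rw [List.map_cons, List.foldr_cons, ih]
    cases c <;> simp [stepOf, parseStep]

theorem foldr_stepOf_numbers (ns : List (List Bool)) (r : List (List Bool))
    (t : List (List (List Bool))) :
    (ns.flatMap fun n => Γ'.comma :: n.map Γ'.bit).foldr stepOf ([], r, t) = ([], ns ++ r, t) := by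
  induction ns with
  | nil => rfl
  | cons n ns ih =>
    rw [List.flatMap_cons, List.foldr_append, ih, List.foldr_cons, foldr_stepOf_bits]
    simp [stepOf, parseStep]

theorem foldr_stepOf_entryWord {e : List (List Bool)} (he : e ≠ []) (t : List (List (List Bool))) :
    (entryWord e).foldr stepOf ([], [], t) = ([], [], e :: t) := by
  obtain ⟨n, ns, rfl⟩ := List.exists_cons_of_ne_nil he
  have h₁ : stepOf .ket ([], [], t) = ([], [], t) := by simp [stepOf, parseStep]
  rw [entryWord, List.foldr_cons, List.foldr_append, List.flatMap_cons, List.cons_append,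
    List.tail_cons, List.foldr_append, List.foldr_cons, List.foldr_nil, h₁, foldr_stepOf_numbers,
    foldr_stepOf_bits]
  simp [stepOf, parseStep]

/-- An opening bracket always contributes the number in front of which it stands, even an empty one,
so the parser cannot produce an entry without numbers. -/
theorem parse_inputWord (p : List Bool) {es : List (List (List Bool))} (h : ∀ e ∈ es, e ≠ []) :
    parse (inputWord p es) = (p, [], es) := by
  have key : (es.flatMap entryWord).foldr stepOf ([], [], []) = ([], [], es) := by
    induction es with
    | nil => rfl
    | cons e es ih =>
      rw [List.flatMap_cons, List.foldr_append, ih fun e' he' => h e' (by simp [he']),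
        foldr_stepOf_entryWord (h e (by simp))]
  rw [parse, List.foldl_reverse]
  change (inputWord p es).foldr stepOf _ = _
  rw [inputWord, List.foldr_append, key, foldr_stepOf_bits, List.append_nil]

def tileDigits (t : Tile) : List (List Bool) :=
  [encodeNat t.col, encodeNat t.row, encodeNat t.value]

def locationDigits (a : ℕ × ℕ) : List (List Bool) := [encodeNat a.1, encodeNat a.2]

/-- The entries of an input. -/
def entries (L : List Tile) (S : List (ℕ × ℕ)) : List (List (List Bool)) :=
  L.map tileDigits ++ S.map locationDigits

theorem inputWord_entries (b : ℕ) (L : List Tile) (S : List (ℕ × ℕ)) :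
    inputWord (encodeNat b) (entries L S) = encodeInput b L ++ S.flatMap encodeLocation := by
  have h₁ : ∀ t, entryWord (tileDigits t) = encodeTile t := fun t => by
    simp [entryWord, tileDigits, encodeTile, encodeNumber]
  have h₂ : ∀ a, entryWord (locationDigits a) = encodeLocation a := fun t => by
    simp [entryWord, locationDigits, encodeLocation, encodeNumber]
  simp [inputWord, entries, encodeInput, encodeNumber, List.flatMap_map, h₁, h₂]

theorem entriesOfLength_three (L : List Tile) (S : List (ℕ × ℕ)) :
    entriesOfLength 3 (entries L S) = L.map tileDigits := by
  simp [entriesOfLength, entries, List.filter_map, Function.comp_def, tileDigits, locationDigits]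

theorem entriesOfLength_two (L : List Tile) (S : List (ℕ × ℕ)) :
    entriesOfLength 2 (entries L S) = S.map locationDigits := by
  simp [entriesOfLength, entries, List.filter_map, Function.comp_def, tileDigits, locationDigits]

theorem isPow_encodeNat (v : ℕ) : isPow (encodeNat v) = true ↔ ∃ k, 1 ≤ k ∧ v = 2 ^ k := by
  rw [isPow_iff]
  refine exists_congr fun k => and_congr_right fun _ => ⟨fun h => ?_, fun h => ?_⟩
  · rw [← bitsVal_encodeNat v, h, bitsVal_pow]
  · rw [h, encodeNat_two_pow]

theorem nodup_map_iff {α β : Type} [DecidableEq β] (f : α → β) (a : α) (l : List α) :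
    ((List.range l.length).all fun i => (l.drop (i + 1)).all fun e =>
      !decide (f (l[i]?.getD a) = f e)) = true ↔ (l.map f).Nodup := by
  induction l with
  | nil => simp
  | cons e l ih =>
    rw [List.map_cons, List.nodup_cons, ← ih, List.length_cons, List.range_succ_eq_map,
      List.all_cons, List.all_map, Bool.and_eq_true]
    refine and_congr ?_ Iff.rfl
    simp only [zero_add, List.drop_succ_cons, List.drop_zero, List.all_eq_true,
      Bool.not_eq_true', decide_eq_false_iff_not, List.mem_map, not_exists, not_and]
    exact forall₂_congr fun _ _ => not_congr eq_comm

/-- The check rebuilds the word and compares it with `u`, so it does not matter what the parser does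
on malformed words. -/
theorem wellFormed_entries (loc : Bool) (u : List Γ') (b : ℕ) (L : List Tile) (S : List (ℕ × ℕ)) :
    wellFormed loc u (encodeNat b) (entries L S) = true ↔
      u = encodeInput b L ++ S.flatMap encodeLocation ∧ ValidTiles b L ∧ ValidLocations b S ∧
        (loc = true ∨ S = []) := by
  have h₁ : (List.map tileDigits L).map (List.take 2) =
      (L.map fun t => (t.col, t.row)).map locationDigits := by
    simp [tileDigits, locationDigits]
  have h₂ : Function.Injective locationDigits := by
    rintro ⟨x, y⟩ ⟨x', y'⟩ h
    simp only [locationDigits, List.cons.injEq, and_true] at h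
    rw [← bitsVal_encodeNat x, ← bitsVal_encodeNat y, h.1, h.2, bitsVal_encodeNat,
      bitsVal_encodeNat]
  have h₃ := nodup_map_iff (List.take 2) [] (L.map tileDigits)
  rw [h₁, List.nodup_map_iff h₂] at h₃
  simp only [wellFormed, Bool.and_eq_true, entriesOfLength_three, entriesOfLength_two, h₃,
    inputWord_entries, decide_eq_true_eq, canonical_encodeNat, Bool.or_eq_true, List.map_eq_nil_iff]
  simp only [entries, List.all_append, Bool.and_eq_true, List.all_eq_true, List.mem_map,
    forall_exists_index, and_imp, forall_apply_eq_imp_iff₂, tileDigits, locationDigits, digits,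
    List.getElem?_cons_zero, List.getElem?_cons_succ, Option.getD_some, ltBits_eq,
    bitsVal_encodeNat, decide_eq_true_eq, isPow_encodeNat, List.mem_cons, List.not_mem_nil,
    or_false, forall_eq_or_imp, forall_eq, canonical_encodeNat, ValidTiles, ValidLocations]
  constructor
  · rintro ⟨⟨⟨⟨⟨⟨⟨h, -⟩, -⟩, -⟩, h₁, h₂⟩, h₃⟩, h₄⟩, h₅⟩
    exact ⟨h.symm, ⟨fun t ht => ⟨(h₁ t ht).1, (h₁ t ht).2, h₃ t ht⟩, h₄⟩, fun a ha => h₂ a ha, h₅⟩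
  · rintro ⟨h, ⟨h₁, h₂⟩, h₃, h₄⟩
    exact ⟨⟨⟨⟨⟨⟨⟨h.symm, trivial⟩, trivial⟩, by simp⟩, fun t ht => ⟨(h₁ t ht).1, (h₁ t ht).2.1⟩,
      fun a ha => h₃ a ha⟩, fun t ht => (h₁ t ht).2.2⟩, h₂⟩, h₄⟩

/-- Digits without a leading zero are recovered by decoding and encoding again. Entries with three
numbers are tiles, entries with two are locations, and the check demands this order. -/
theorem eq_entries_of_wellFormed {loc : Bool} {u : List Γ'} {p : List Bool}
    {es : List (List (List Bool))} (h : wellFormed loc u p es = true) :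
    ∃ b L S, p = encodeNat b ∧ es = entries L S := by
  simp only [wellFormed, Bool.and_eq_true, decide_eq_true_eq, List.all_eq_true] at h
  obtain ⟨⟨⟨⟨⟨⟨⟨-, h₁⟩, h₂⟩, h₃⟩, -⟩, -⟩, -⟩, -⟩ := h
  have h₃' : ∀ {e n}, e ∈ es → n ∈ e → encodeNat (bitsVal n) = n := fun he hn =>
    encodeNat_bitsVal (h₃ _ he _ hn)
  refine ⟨bitsVal p, (entriesOfLength 3 es).map fun e =>
      ⟨bitsVal (digits e 0), bitsVal (digits e 1), bitsVal (digits e 2)⟩,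
    (entriesOfLength 2 es).map fun e => (bitsVal (digits e 0), bitsVal (digits e 1)),
    (encodeNat_bitsVal h₂).symm, h₁.trans ?_⟩
  rw [entries, List.map_map, List.map_map]
  congr 1
  · symm
    refine (List.map_congr_left fun e he => ?_).trans (List.map_id _)
    obtain ⟨he, hl⟩ := List.mem_filter.1 he
    obtain ⟨n₁, n₂, n₃, rfl⟩ := List.length_eq_three.1 (of_decide_eq_true hl)
    simp [tileDigits, digits, h₃' he (show n₁ ∈ [n₁, n₂, n₃] by simp),
      h₃' he (show n₂ ∈ [n₁, n₂, n₃] by simp), h₃' he (show n₃ ∈ [n₁, n₂, n₃] by simp)]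
  · symm
    refine (List.map_congr_left fun e he => ?_).trans (List.map_id _)
    obtain ⟨he, hl⟩ := List.mem_filter.1 he
    obtain ⟨n₁, n₂, rfl⟩ := List.length_eq_two.1 (of_decide_eq_true hl)
    simp [locationDigits, digits, h₃' he (show n₁ ∈ [n₁, n₂] by simp),
      h₃' he (show n₂ ∈ [n₁, n₂] by simp)]

theorem clamp_encodeNat {M n : ℕ} (h : n ≤ M) : clamp M (encodeNat n) = n := by
  rw [clamp_eq, bitsVal_encodeNat, min_eq_left h]

theorem represents_initialBoard {M b : ℕ} (hb : b ≤ M) {L : List Tile} (h : ValidTiles b L) :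
    Represents (initialBoard M b (L.map tileDigits)) (boardOf b L) := by
  refine represents_tabulate fun x y => ?_
  replace h := h.1
  induction L with
  | nil => rfl
  | cons t L ih =>
    replace ih := ih fun t' ht' => h t' (by simp [ht'])
    obtain ⟨h₁, h₂, k, -, hk⟩ := h t (by simp)
    have h₃ : clamp M (digits (tileDigits t) 0) = t.col := clamp_encodeNat (by omega)
    have h₄ : clamp M (digits (tileDigits t) 1) = t.row := clamp_encodeNat (by omega)
    -- The exponent of a power of two is one less than its number of binary digits, so the possibly
    -- huge value is never formed.
    have h₅ : (digits (tileDigits t) 2).length - 1 = k := by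
      change (encodeNat t.value).length - 1 = k
      rw [hk, encodeNat_two_pow]; simp
    rw [List.map_cons, List.filter_cons, h₃, h₄, boardOf, List.find?_cons]
    by_cases hxy : t.col = x ∧ t.row = y
    · simp [hxy.1, hxy.2, h₅, hk]
    · have h₆ : (t.col == (x : ℕ) && t.row == (y : ℕ)) = false := by
        rw [Bool.eq_false_iff]; simpa using hxy
      have h₇ : (decide (t.col = (x : ℕ)) && decide (t.row = (y : ℕ))) = false := by
        rw [Bool.eq_false_iff]; simpa using hxy
      rw [h₆, h₇]
      exact ih

/-- Each nonempty cell is the position of some tile of the list. -/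
theorem count_boardOf_le (b : ℕ) (L : List Tile) : count (boardOf b L) ≤ L.length := by
  classical
  have h₁ : count (boardOf b L) =
      (Finset.univ.filter fun p : Fin b × Fin b => boardOf b L p.1 p.2 ≠ none).card := by
    rw [Finset.card_filter, count, total, Fintype.sum_prod_type]
    refine Finset.sum_congr rfl fun x _ => Finset.sum_congr rfl fun y _ => ?_
    cases boardOf b L x y <;> simp [cellSum]
  have h₂ : (L.map fun t => (t.col, t.row)).toFinset.card ≤ L.length :=
    (List.toFinset_card_le _).trans (by simp)
  refine h₁.trans_le (le_trans ?_ h₂)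
  refine Finset.card_le_card_of_injOn (fun p => ((p.1 : ℕ), (p.2 : ℕ))) (fun p hp => ?_)
    fun p _ q _ h => ?_
  · obtain ⟨v, hv⟩ := Option.ne_none_iff_exists'.1 (Finset.mem_filter.1 hp).2
    obtain ⟨t, ht, -⟩ := Option.map_eq_some_iff.1 hv
    have h₃ := List.find?_some ht
    simp only [Bool.and_eq_true, beq_iff_eq] at h₃
    simp only [List.coe_toFinset, List.mem_map, Set.mem_ofPred_eq]
    exact ⟨t, List.mem_of_find?_eq_some ht, by rw [h₃.1, h₃.2]⟩
  · simp only [Prod.mk.injEq, Fin.val_inj] at h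
    exact Prod.ext h.1 h.2

theorem boardOf_ne_none {b : ℕ} {L : List Tile} (h : ValidTiles b L) (hL : L ≠ []) :
    ∃ x y, boardOf b L x y ≠ none := by
  obtain ⟨t, L, rfl⟩ := List.exists_cons_of_ne_nil hL
  obtain ⟨h₁, h₂, -⟩ := h.1 t (by simp)
  exact ⟨⟨t.col, h₁⟩, ⟨t.row, h₂⟩, by simp [boardOf]⟩

/-- No move changes an empty board, so there is no turn at all and the new tiles never come into
play. -/
theorem not_canMake_boardOf_nil (b T : ℕ) (S : List (ℕ × ℕ)) :
    ¬ CanMake T (⟨boardOf b [], S⟩ : Position b) := by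
  have h₁ : tiles (fun _ : Fin b => none) = [] :=
    List.eq_nil_iff_forall_not_mem.2 fun v hv => by simpa using mem_tiles.1 hv
  have h₂ : ∀ i, slideLine (fun _ : Fin b => none) i = none := fun i => by
    rw [slideLine_eq, h₁]; rfl
  rintro ⟨Q, hQ, x, y, hT⟩
  rcases Relation.ReflTransGen.cases_head hQ with rfl | ⟨R, ⟨d, hd, -⟩, -⟩
  · cases hT
  · refine hd ?_
    cases d <;> funext x y <;> exact h₂ _

theorem length_add_length_le (b : ℕ) (L : List Tile) (S : List (ℕ × ℕ)) :
    L.length + S.length ≤ (encodeInput b L ++ S.flatMap encodeLocation).length := by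
  have h : ∀ {α : Type} (f : α → List Γ') (l : List α), (∀ a, 1 ≤ (f a).length) →
      l.length ≤ (l.flatMap f).length := by
    intro α f l hf
    induction l with
    | nil => simp
    | cons a l ih =>
      have := hf a
      simp only [List.flatMap_cons, List.length_append, List.length_cons]
      omega
  have h₁ := h encodeTile L fun t => by simp [encodeTile]
  have h₂ := h encodeLocation S fun t => by simp [encodeLocation]
  rw [List.length_append, encodeInput, List.length_append]
  omega

/-- The length of `u` bounds the number of tiles plus locations. A side of at least `u.length + 2 *
c + 8` is therefore large in the sense of `canMake_of_large`, and a smaller side is polynomial. -/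
theorem canMake_iff_verify {loc : Bool} {c : ℕ} (hc : 1 ≤ c) {b : ℕ} {L : List Tile}
    {S : List (ℕ × ℕ)} (hL : ValidTiles b L) (hS : ValidLocations b S) (hloc : loc = true ∨ S = [])
    {u : List Γ'} (hu : u = encodeInput b L ++ S.flatMap encodeLocation) {m : ℕ}
    (hm : (u.length + 2 * c + 8) * ((u.length + 2 * c + 8) * 2 ^ c) + 4 ≤ m) :
    CanMake (2 ^ c) (⟨boardOf b L, S⟩ : Position b) ↔
      ∃ w : List Bool, w.length ≤ m ∧ verify loc c u w = true := by
  have h₁ : parse u = (encodeNat b, [], entries L S) := by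
    rw [hu, ← inputWord_entries, parse_inputWord]
    intro e he
    rcases List.mem_append.1 he with he | he <;> obtain ⟨t, -, rfl⟩ := List.mem_map.1 he
    · exact List.cons_ne_nil _ _
    · exact List.cons_ne_nil _ _
  have h₂ := length_add_length_le b L S
  rw [← hu] at h₂
  have h₃ := powBoard_boardOf hL
  simp only [verify, h₁, (wellFormed_entries loc u b L S).2 ⟨hu, hL, hS, hloc⟩, Bool.true_and,
    accepts, entriesOfLength_three, entriesOfLength_two]
  generalize hM : u.length + 2 * c + 8 = M at hm
  by_cases hb : b < M
  -- On a small board `clamp` is exact on the side and on all coordinates, which are smaller still.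
  · simp only [clamp_encodeNat hb.le, if_neg hb.ne]
    refine canMake_iff_simulate hc h₃ ⟨represents_initialBoard hb.le hL, ?_⟩ (le_trans ?_ hm)
    · rw [List.map_map]
      refine (List.map_congr_left fun a ha => ?_).trans (List.map_id _)
      obtain ⟨h₄, h₅⟩ := hS a ha
      exact Prod.ext (clamp_encodeNat (by omega)) (clamp_encodeNat (by omega))
    · gcongr
  · have hb' : clamp M (encodeNat b) = M := by rw [clamp_eq, bitsVal_encodeNat]; omega
    simp only [if_pos hb']
    rcases eq_or_ne L [] with rfl | hne
    · simp [not_canMake_boardOf_nil]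
    · have h₄ := count_boardOf_le b L
      have h₅ : CanMake (2 ^ c) (⟨boardOf b L, S⟩ : Position b) :=
        canMake_of_large hc h₃ (boardOf_ne_none hL hne) (by dsimp only; omega)
      -- On a large board with a tile any certificate is accepted, in particular the empty one.
      exact iff_of_true h₅ ⟨[], Nat.zero_le _, by simpa using hne⟩

/-- For the converse, an accepted word passes the check of its form, which returns the instance that
it encodes. -/
theorem mem_iff_verify (loc : Bool) {c : ℕ} (hc : 1 ≤ c) (u : List Γ') {m : ℕ}
    (hm : (u.length + 2 * c + 8) * ((u.length + 2 * c + 8) * 2 ^ c) + 4 ≤ m) :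
    (∃ (b : ℕ) (L : List Tile) (S : List (ℕ × ℕ)), ValidTiles b L ∧ ValidLocations b S ∧
      (loc = true ∨ S = []) ∧ u = encodeInput b L ++ S.flatMap encodeLocation ∧
      CanMake (2 ^ c) (⟨boardOf b L, S⟩ : Position b)) ↔
    ∃ w : List Bool, w.length ≤ m ∧ verify loc c u w = true := by
  constructor
  · rintro ⟨b, L, S, hL, hS, hloc, hu, h⟩
    exact (canMake_iff_verify hc hL hS hloc hu hm).1 h
  · rintro ⟨w, hw, h⟩
    have h₁ := (Bool.and_eq_true_iff.1 h).1
    obtain ⟨b, L, S, hp, hes⟩ := eq_entries_of_wellFormed h₁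
    rw [hp, hes, wellFormed_entries] at h₁
    obtain ⟨hu, hL, hS, hloc⟩ := h₁
    exact ⟨b, L, S, hL, hS, hloc, hu, (canMake_iff_verify hc hL hS hloc hu hm).2 ⟨w, hw, h⟩⟩

theorem inNP_of_mem_iff {A : Language Γ'} {c : ℕ} (hc : 1 ≤ c) (loc : Bool)
    (hA : ∀ u, u ∈ A ↔ ∃ (b : ℕ) (L : List Tile) (S : List (ℕ × ℕ)), ValidTiles b L ∧
      ValidLocations b S ∧ (loc = true ∨ S = []) ∧
      u = encodeInput b L ++ S.flatMap encodeLocation ∧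
      CanMake (2 ^ c) (⟨boardOf b L, S⟩ : Position b)) : InNP A := by
  -- With `M` the threshold for the side, this is `M * (M * 2 ^ c) + 4`: four symbols for each move
  -- of a play cut at the target.
  refine ⟨(.X + .C (2 * c + 8)) * ((.X + .C (2 * c + 8)) * .C (2 ^ c)) + .C 4,
    fun p => verify loc c p.1 p.2, computable_verify loc c, fun u => ?_⟩
  rw [hA u]
  refine mem_iff_verify loc hc u (le_of_eq ?_)
  simp only [Polynomial.eval_add, Polynomial.eval_mul, Polynomial.eval_X, Polynomial.eval_C,
    Nat.add_assoc]

end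

end Make2048

theorem mainTheorem2 (c : ℕ) (hc : 1 ≤ c) :
    Make2048.InNP (Make2048.MakeOnlyTwo (2 ^ c)) ∧
    Make2048.InNP (Make2048.MakeOnlyTwoLocated (2 ^ c)) ∧
    (∀ (b : ℕ) (L : List Make2048.Tile) (S : List (ℕ × ℕ)),
      Make2048.ValidTiles b L → Make2048.ValidLocations b S →
      ∀ (k : ℕ) (P : ℕ → Make2048.Position b),
        P 0 = ⟨Make2048.boardOf b L, S⟩ →
        (∀ i < k, Make2048.Turn (P i) (P (i + 1))) →
        (∀ i ≤ k, ¬ Make2048.HasTile (2 ^ c) (P i).board) →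
        (k : ℝ) ≤ 2 ^ c * (b : ℝ) ^ 2 / 4) := by
  refine ⟨Make2048.inNP_of_mem_iff hc false fun u => ?_,
    Make2048.inNP_of_mem_iff hc true fun u => ?_, fun b L S hL _ k P h₀ hT hN => ?_⟩
  · constructor
    · rintro ⟨b, L, hL, rfl, h⟩
      exact ⟨b, L, [], hL, by simp [Make2048.ValidLocations], .inr rfl, by simp, h⟩
    · rintro ⟨b, L, S, hL, -, hS, rfl, h⟩
      obtain rfl : S = [] := by simpa using hS
      exact ⟨b, L, hL, by simp, h⟩
  · constructor
    · rintro ⟨b, L, S, hL, hS, hu, h⟩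
      exact ⟨b, L, S, hL, hS, .inl rfl, hu, h⟩
    · rintro ⟨b, L, S, hL, hS, -, hu, h⟩
      exact ⟨b, L, S, hL, hS, hu, h⟩
  · have h₁ : Make2048.PowBoard (P 0).board := by
      rw [h₀]; exact Make2048.powBoard_boardOf hL
    have h₂ : (4 : ℝ) * k ≤ b * (b * 2 ^ c) := by
      exact_mod_cast Make2048.moves_bound hc h₁ hT hN
    rw [le_div_iff₀ (by norm_num)]
    linarith
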